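/- A (one-sided or two-sided) shift space is a nonempty closed set $X\subset\{1,\dots,p\}^{\mathbb N}$ with $\sigma(X)\subset X$, respectively a nonempty closed set $X\subset\{1,\dots,p\}^{\mathbb Z}$ with $\sigma(X)=X$, where $(\sigma x)_i=x_{i+1}$. Its language $\mathcal L$ is the set of all finite words (including the empty word) that appear in points of $X$; $|w|$ denotes the length of a word $w$. For $\mathcal D\subset\mathcal L$ put $h(\mathcal D)=\varlimsup_{n\to\infty}\frac1n\log\#\{w\in\mathcal D : |w|=n\}$, with $\log 0=-\infty$. The space $X$ is intrinsically ergodic if there is exactly one $\sigma$-invariant Borel probability measure on $X$ whose measure-theoretic (Kolmogorov--Sinai) entropy is maximal among all such measures; this is the measure of maximal entropy. Theorem. Let $(X,\sigma)$ be a one-sided (respectively two-sided) shift space with language $\mathcal L$, and let $\mathcal C^p,\mathcal G,\mathcal C^s\subset\mathcal L$ be such that every word of $\mathcal L$ can be written as $uvw$ with $u\in\mathcal C^p$, $v\in\mathcal G$, $w\in\mathcal C^s$. Suppose that (I) (S)-specification on $\mathcal G$: there is $t\in\mathbb N$ such that for all $m\ge1$ and $w^1,\dots,w^m\in\mathcal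 G$ there are $v^1,\dots,v^{m-1}\in\mathcal L$ with $|v^i|=t$ for all $i$ and $x:=w^1v^1w^2v^2\cdots v^{m-1}w^m\in\mathcal L$; (II$'$) $h(\mathcal C^p\cup\mathcal C^s)\le 0$, i.e. the number of words of length $n$ in $\mathcal C^p\cup\mathcal C^s$ grows subexponentially; (III) for every $M\in\mathbb N$ there is $\tau\in\mathbb N$ such that for every word $v\in\mathcal L$ of the form $v=abc$ with $a\in\mathcal C^p$, $b\in\mathcal G$, $c\in\mathcal C^s$, $|a|\le M$, $|c|\le M$, there are words $u,w$ with $|u|\le\tau$, $|w|\le\tau$ and $uvw\in\mathcal G$. Let $(\tilde X,\sigma)$ be a subshift factor of $(X,\sigma)$, i.e. a one-sided (respectively two-sided) shift space over some finite alphabet for which there is a continuous surjection $\pi:X\to\tilde X$ with $\pi\circ\sigma=\sigma\circ\pi$. Then $(\tilde X,\sigma)$ is intrinsically ergodic. Suppose in addition that $\mathcal G$ has (Per)-specification: for some $t\in\mathbb N$, the words $v^i$ in (I) can always be chosen so that, moreover, some $y\in X$ that begins with $x$ at its initial coordinate (coordinate $0$ if $X$ is two-sided) satisfies $\sigma^{|x|+t}y=y$.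 Let $\mathrm{Per}(n)=\{x\in\tilde X : \sigma^kx=x \text{ for some } 1\le k\le n\}$. Then $\mathrm{Per}(n)$ is finite and nonempty for all large $n$, and the measures $$\mu_n=\frac1{\#\mathrm{Per}(n)}\sum_{x\in\mathrm{Per}(n)}\delta_x$$ converge in the weak* topology to the unique measure of maximal entropy of $(\tilde X,\sigma)$. -/

import Mathlib

open Filter Topology MeasureTheory SymbolicDynamics.FullShift
open scoped ENNReal

/-! ### Measure-theoretic entropy and measures of maximal entropy -/

namespace IntrinsicErgodicity

section Entropy

variable {X : Type*} [MeasurableSpace X]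

/-- Shannon entropy of the join `P ∨ T⁻¹P ∨ ⋯ ∨ T⁻⁽ⁿ⁻¹⁾P`, where the finite partition `P` is given by
the function sending a point to the label of its cell. -/
noncomputable def partitionEntropy (T : X → X) (μ : Measure X) {k : ℕ} (P : X → Fin k) (n : ℕ) : ℝ :=
  ∑ a : Fin n → Fin k, Real.negMulLog (μ.real {x | ∀ i : Fin n, P (T^[(i : ℕ)] x) = a i})

/-- Kolmogorov–Sinai entropy `h_μ(T)`: the supremum over all finite measurable partitions `P` of
`lim (1/n) H_μ(P ∨ ⋯ ∨ T⁻⁽ⁿ⁻¹⁾P)`. -/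
noncomputable def measureEntropy (T : X → X) (μ : Measure X) : EReal :=
  ⨆ (k : ℕ) (P : X → Fin k) (_ : Measurable P),
    limsup (fun n : ℕ => ((partitionEntropy T μ P n / n : ℝ) : EReal)) atTop

/-- `μ` is a measure of maximal entropy: an invariant probability measure attaining the supremum of
the entropies of all invariant probability measures. -/
def IsMME (T : X → X) (μ : ProbabilityMeasure X) : Prop :=
  MeasurePreserving T (μ : Measure X) (μ : Measure X) ∧
    ∀ ν : ProbabilityMeasure X, MeasurePreserving T (ν : Measure X) (ν : Measure X) →
      measureEntropy T (ν : Measure X) ≤ measureEntropy T (μ : Measure X)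

/-- A measure of maximal entropy exists and is unique. -/
def IntrinsicallyErgodic (T : X → X) : Prop :=
  ∃! μ : ProbabilityMeasure X, IsMME T μ

/-- The points of period at most `n`. -/
def perPts (T : X → X) (n : ℕ) : Set X :=
  {x | ∃ k : ℕ, 1 ≤ k ∧ k ≤ n ∧ Function.IsPeriodicPt T k x}

/-- The measure `(1 / #Per(n)) ∑_{x ∈ Per(n)} δ_x`. -/
noncomputable def perMeasure (T : X → X) (n : ℕ) : Measure X :=
  ((perPts T n).ncard : ℝ≥0∞)⁻¹ • Measure.sum (fun x : perPts T n => Measure.dirac (x : X))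

/-- The periodic orbit measures are, for all large `n`, well defined probability measures
(`Per(n)` is finite and nonempty), and they converge to `μ` in the weak* topology. -/
def PerMeasuresTendsto [TopologicalSpace X] [OpensMeasurableSpace X] (T : X → X)
    (μ : ProbabilityMeasure X) : Prop :=
  (∀ᶠ n in atTop, (perPts T n).Finite ∧ (perPts T n).Nonempty) ∧
    ∃ ν : ℕ → ProbabilityMeasure X,
      (∀ᶠ n in atTop, (ν n : Measure X) = perMeasure T n) ∧ Tendsto ν atTop (𝓝 μ)

end Entropy

/-! ### Shift spaces and their languages

The index monoid `I` is `ℕ` for one-sided and `ℤ` for two-sided shift spaces. -/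

section Shifts

variable {I : Type} [AddMonoidWithOne I] {p q : ℕ}

/-- The shift map `σ`, `(σ x)_i = x_{i+1}`, restricted to a shift space. -/
def shiftMap (X : Subshift (Fin p) I) : X.carrier → X.carrier :=
  (X.mapsTo 1).restrict _ _ _

/-- The word `x_i x_{i+1} ⋯ x_{i+n-1}`. -/
def wordAt (x : I → Fin p) (i : I) (n : ℕ) : List (Fin p) :=
  List.ofFn fun k : Fin n => x (i + ((k : ℕ) : I))

/-- The language of a shift space: all finite words (including the empty one) that appear in
its points. -/
def language (X : Subshift (Fin p) I) : Set (List (Fin p)) :=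
  {w | ∃ x ∈ X.carrier, ∃ i : I, wordAt x i w.length = w}

/-- `Y` is a subshift factor of `X`. -/
def IsFactor (X : Subshift (Fin p) I) (Y : Subshift (Fin q) I) : Prop :=
  ∃ π : X.carrier → Y.carrier,
    Continuous π ∧ Function.Surjective π ∧ Function.Semiconj π (shiftMap X) (shiftMap Y)

/-- The growth rate `h(D) = limsup (1/n) log #D_n`, where `D_n` is the set of words of length `n` in
`D` and `log 0 = -∞`. -/
noncomputable def growthRate (D : Set (List (Fin p))) : EReal :=
  ExpGrowth.expGrowthSup fun n => (({w | w ∈ D ∧ w.length = n}.encard : ℕ∞) : ℝ≥0∞)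

/-- The word `w⁰ v⁰ w¹ v¹ ⋯ vᵐ⁻¹ wᵐ`. -/
def glue (w v : ℕ → List (Fin p)) : ℕ → List (Fin p)
  | 0 => w 0
  | m + 1 => glue w v m ++ v m ++ w (m + 1)

/-- (S)-specification on `G` with gap size `t`. -/
def SpecS (X : Subshift (Fin p) I) (G : Set (List (Fin p))) (t : ℕ) : Prop :=
  ∀ (m : ℕ) (w : ℕ → List (Fin p)), (∀ i ≤ m, w i ∈ G) →
    ∃ v : ℕ → List (Fin p), (∀ i < m, v i ∈ language X ∧ (v i).length = t) ∧
      glue w v m ∈ language X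

/-- (Per)-specification on `G` with gap size `t`: the glued word `x` can moreover be chosen such that
its cylinder contains a point `y` with `σ^(|x|+t) y = y`. -/
def SpecPer (X : Subshift (Fin p) I) (G : Set (List (Fin p))) (t : ℕ) : Prop :=
  ∀ (m : ℕ) (w : ℕ → List (Fin p)), (∀ i ≤ m, w i ∈ G) →
    ∃ v : ℕ → List (Fin p), (∀ i < m, v i ∈ language X ∧ (v i).length = t) ∧
      glue w v m ∈ language X ∧
      ∃ y : X.carrier, wordAt (y : I → Fin p) 0 (glue w v m).length = glue w v m ∧
        Function.IsPeriodicPt (shiftMap X) ((glue w v m).length + t) y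

/-- `L = Cp G Cs`, where `L` is the language of `X`. -/
def IsDecomposition (X : Subshift (Fin p) I) (Cp G Cs : Set (List (Fin p))) : Prop :=
  Cp ⊆ language X ∧ G ⊆ language X ∧ Cs ⊆ language X ∧
    ∀ x ∈ language X, ∃ u ∈ Cp, ∃ v ∈ G, ∃ w ∈ Cs, x = u ++ v ++ w

/-- The set `G(M)` of the words `uvw` of the language with `u ∈ Cp`, `v ∈ G`, `w ∈ Cs` and
`|u|, |w| ≤ M`. -/
def goodWords (X : Subshift (Fin p) I) (Cp G Cs : Set (List (Fin p))) (M : ℕ) :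
    Set (List (Fin p)) :=
  {x | x ∈ language X ∧
    ∃ u ∈ Cp, ∃ v ∈ G, ∃ w ∈ Cs, u.length ≤ M ∧ w.length ≤ M ∧ x = u ++ v ++ w}

/-- For every `M` there is `τ` such that every word of `G(M)` can be extended to a word of `G` by
adding at most `τ` symbols on each side. -/
def ExtensionCondition (X : Subshift (Fin p) I) (Cp G Cs : Set (List (Fin p))) : Prop :=
  ∀ M : ℕ, ∃ τ : ℕ, ∀ v ∈ goodWords X Cp G Cs M,
    ∃ u w : List (Fin p), u.length ≤ τ ∧ w.length ≤ τ ∧ u ++ v ++ w ∈ G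

end Shifts

end IntrinsicErgodicity

namespace IntrinsicErgodicity

/-! Everything rests on counting words of the factor `Y`. Let `h` be its topological entropy. A
factor map may be replaced by a block code `Φ` with window `[0, R]`, so words of `Y` are images of
words of `X`, and the properties of `G` can be used in `Y` at the cost of bounded constants.

Suppose `h > 0`. By specification, images of words of `G` can be chained freely, so at most
`e^((k+t)h)` of them come from length `k`. Since `C = Cp ∪ Cs` grows subexponentially, `∑ #C_n
e^(-nh)` converges; hence the words of `Y` all of whose preimages have a long prefix or suffix are a
small share of `e^(nh)` (`exists_ncard_bad_le`). The other words come from some `G(M)` and can be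
joined with bounded gaps. Uniqueness uses nothing but these two facts (`HasJoinableWords`). They
give `#L_n ≤ C e^(nh)`, so a set of `n`-words of mass at least 1/2 for a measure of maximal entropy
has at least `c e^(nh)` elements. If two such measures were mutually singular, consider words that
look like the first up to a switching position and like the second afterwards. Each of `K` positions
yields a fixed share of `e^(Nh)`, and different positions yield different words, which contradicts
the upper bound once `K` is large (`not_mutuallySingular`). Two arbitrary distinct measures of
maximal entropy reduce to this case by conditioning on invariant sets.

If `h = 0`, exchanging neighbouring words of `G` would create entropy unless the points of `Y` have
a common period. Then all points have the same word frequencies and there is only one invariant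
measure.

Existence follows from a Misiurewicz-type averaging argument. Under (Per)-specification there are at
least a constant times `e^(nh)` points of period at most `n`; every limit of the periodic orbit
measures therefore has maximal entropy, and uniqueness identifies it. -/

/-- Index monoids in which every finite set can be translated into the natural numbers by an
invertible natural number; this covers `ℕ` and `ℤ`. -/
class ShiftIndex (I : Type) [AddMonoidWithOne I] : Prop where
  exists_translate : ∀ F : Finset I, ∃ j : ℕ, (∃ j' : I, (j : I) + j' = 0 ∧ j' + (j : I) = 0) ∧
    ∀ f ∈ F, ∃ k : ℕ, (j : I) + f = k ∧ f + (j : I) = k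

/-- The translation has to be invertible because following a factor map by `σ^j` must keep it
surjective, and a one-sided shift need not be onto. On `ℕ` only `j = 0` qualifies. -/
instance : ShiftIndex ℕ where
  exists_translate F := ⟨0, ⟨0, by simp⟩, fun f _ => ⟨f, by simp⟩⟩

instance : ShiftIndex ℤ where
  exists_translate F := by
    refine ⟨∑ f ∈ F, f.natAbs, ⟨-((∑ f ∈ F, f.natAbs : ℕ) : ℤ), by simp⟩, fun f hf => ?_⟩
    have h : f.natAbs ≤ ∑ f ∈ F, f.natAbs :=
      Finset.single_le_sum (f := fun f : ℤ => f.natAbs) (fun _ _ => Nat.zero_le _) hf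
    refine ⟨(((∑ f ∈ F, f.natAbs : ℕ) : ℤ) + f).toNat, ?_⟩
    generalize (∑ f ∈ F, f.natAbs) = N at *
    omega

/-! ### Words, languages and topological entropy. -/

section Words

variable {I : Type} [AddMonoidWithOne I] {p q : ℕ}

@[simp] theorem length_wordAt (x : I → Fin p) (i : I) (n : ℕ) : (wordAt x i n).length = n := by
  simp [wordAt]

@[simp] theorem getElem_wordAt (x : I → Fin p) (i : I) (n k : ℕ) (h : k < (wordAt x i n).length) :
    (wordAt x i n)[k] = x (i + (k : I)) := by
  simp [wordAt]

theorem wordAt_eq_iff (x y : I → Fin p) (i j : I) (n : ℕ) :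
    wordAt x i n = wordAt y j n ↔ ∀ k < n, x (i + (k : I)) = y (j + (k : I)) := by
  constructor
  · intro h k hk
    have := congrArg (fun l => l[k]?) h
    simpa [hk] using this
  · intro h
    apply List.ext_getElem <;> simp
    intro k hk
    exact h k hk

theorem wordAt_add (x : I → Fin p) (i : I) (m n : ℕ) :
    wordAt x i (m + n) = wordAt x i m ++ wordAt x (i + (m : I)) n := by
  apply List.ext_getElem
  · simp
  · intro k h1 h2
    simp only [getElem_wordAt, List.getElem_append, length_wordAt]
    split_ifs with h
    · rfl
    · rw [add_assoc, ← Nat.cast_add, Nat.add_sub_cancel' (not_lt.1 h)]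

theorem drop_wordAt (x : I → Fin p) (i : I) (m n : ℕ) :
    (wordAt x i n).drop m = wordAt x (i + (m : I)) (n - m) := by
  apply List.ext_getElem
  · simp
  · intro k h1 h2
    simp [add_assoc]

theorem take_wordAt (x : I → Fin p) (i : I) {m n : ℕ} (h : m ≤ n) :
    (wordAt x i n).take m = wordAt x i m := by
  apply List.ext_getElem
  · simp [h]
  · intro k h1 h2
    simp

theorem window_wordAt (x : I → Fin p) (i : I) {a b n : ℕ} (h : a + b ≤ n) :
    ((wordAt x i n).drop a).take b = wordAt x (i + (a : I)) b := by
  rw [drop_wordAt, take_wordAt _ _ (by omega)]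

theorem wordAt_shift (g : I) (x : I → Fin p) (i : I) (n : ℕ) :
    wordAt (shift g x) i n = wordAt x (g + i) n := by
  rw [wordAt_eq_iff]
  intro k _
  simp [add_assoc]

theorem shiftMap_iterate (X : Subshift (Fin p) I) (k : ℕ) (y : X.carrier) :
    (((shiftMap X)^[k] y : X.carrier) : I → Fin p) = shift (k : I) (y : I → Fin p) := by
  induction k with
  | zero => ext; simp
  | succ k ih =>
    rw [Function.iterate_succ_apply']
    change shift 1 (((shiftMap X)^[k] y : X.carrier) : I → Fin p) = _
    rw [ih, ← shift_add, Nat.cast_succ]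

theorem shiftMap_iterate_apply (X : Subshift (Fin p) I) (k : ℕ) (y : X.carrier) (i : I) :
    ((shiftMap X)^[k] y : X.carrier).1 i = y.1 ((k : I) + i) := by
  rw [shiftMap_iterate]; rfl

theorem wordAt_iterate (X : Subshift (Fin p) I) (k : ℕ) (y : X.carrier) (i : I) (n : ℕ) :
    wordAt ((shiftMap X)^[k] y : X.carrier).1 i n = wordAt y.1 ((k : I) + i) n := by
  rw [shiftMap_iterate, wordAt_shift]

theorem wordAt_mem_language (X : Subshift (Fin p) I) (y : X.carrier) (i : I) (n : ℕ) :
    wordAt y.1 i n ∈ language X :=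
  ⟨y.1, y.2, i, by simp⟩

theorem exists_of_mem_language {X : Subshift (Fin p) I} {w : List (Fin p)} (h : w ∈ language X) :
    ∃ y : X.carrier, wordAt y.1 0 w.length = w := by
  obtain ⟨x, hx, i, hi⟩ := h
  refine ⟨⟨shift i x, X.mapsTo i hx⟩, ?_⟩
  rw [wordAt_shift, add_zero, hi]

theorem wordAt_append {x : I → Fin p} {i : I} {u v : List (Fin p)}
    (h : wordAt x i (u ++ v).length = u ++ v) :
    wordAt x i u.length = u ∧ wordAt x (i + (u.length : I)) v.length = v := by
  rw [List.length_append, wordAt_add] at h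
  exact List.append_inj h (by simp)

theorem language_of_append {X : Subshift (Fin p) I} {u v : List (Fin p)}
    (h : u ++ v ∈ language X) : u ∈ language X ∧ v ∈ language X := by
  obtain ⟨y, hy⟩ := exists_of_mem_language h
  obtain ⟨h1, h2⟩ := wordAt_append hy
  exact ⟨h1 ▸ wordAt_mem_language X y _ _, h2 ▸ wordAt_mem_language X y _ _⟩

theorem exists_extension {X : Subshift (Fin p) I} {w : List (Fin p)} (h : w ∈ language X)
    {n : ℕ} (hn : w.length ≤ n) : ∃ v, w ++ v ∈ language X ∧ (w ++ v).length = n := by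
  obtain ⟨y, hy⟩ := exists_of_mem_language h
  refine ⟨wordAt y.1 (0 + (w.length : I)) (n - w.length), ?_, by simp; omega⟩
  have := wordAt_add y.1 0 w.length (n - w.length)
  rw [hy] at this
  rw [← this]
  exact wordAt_mem_language X y _ _

/-- The words of length `n` of the language. -/
def wordsOfLength (X : Subshift (Fin p) I) (n : ℕ) : Set (List (Fin p)) :=
  {w | w ∈ language X ∧ w.length = n}

theorem finite_words (D : Set (List (Fin p))) (n : ℕ) : {w | w ∈ D ∧ w.length = n}.Finite :=
  (List.finite_length_eq (Fin p) n).subset fun _ h => h.2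

theorem finite_wordsOfLength (X : Subshift (Fin p) I) (n : ℕ) : (wordsOfLength X n).Finite :=
  finite_words _ n

/-- The number of words of length `n` of the language. -/
noncomputable def wordCount (X : Subshift (Fin p) I) (n : ℕ) : ℕ := (wordsOfLength X n).ncard

theorem wordCount_pos {X : Subshift (Fin p) I} (hX : X.carrier.Nonempty) (n : ℕ) :
    0 < wordCount X n := by
  obtain ⟨x, hx⟩ := hX
  exact (Set.ncard_pos (finite_wordsOfLength X n)).2
    ⟨wordAt x 0 n, wordAt_mem_language X ⟨x, hx⟩ 0 n, by simp⟩

theorem wordCount_add_le (X : Subshift (Fin p) I) (m n : ℕ) :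
    wordCount X (m + n) ≤ wordCount X m * wordCount X n := by
  rw [wordCount, wordCount, wordCount, ← Set.ncard_prod]
  refine Set.ncard_le_ncard_of_injOn (fun w => (w.take m, w.drop m)) ?_ ?_
    ((finite_wordsOfLength X m).prod (finite_wordsOfLength X n))
  · rintro w ⟨hw, hl⟩
    have := language_of_append (X := X) (u := w.take m) (v := w.drop m) (by simpa using hw)
    exact ⟨⟨this.1, by simp [hl]⟩, ⟨this.2, by simp [hl]⟩⟩
  · intro w _ w' _ h
    simp only [Prod.mk.injEq] at h
    rw [← List.take_append_drop m w, h.1, h.2, List.take_append_drop]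

theorem wordCount_eq_zero {X : Subshift (Fin p) I} (hX : ¬ X.carrier.Nonempty) (n : ℕ) :
    wordCount X n = 0 := by
  rw [wordCount, Set.ncard_eq_zero (finite_wordsOfLength X n), Set.eq_empty_iff_forall_notMem]
  rintro w ⟨⟨x, hx, _⟩, _⟩
  exact hX ⟨x, hx⟩

theorem subadditive_log_wordCount (X : Subshift (Fin p) I) :
    Subadditive fun n => Real.log (wordCount X n) := by
  intro m n
  by_cases hX : X.carrier.Nonempty
  · have h1 := wordCount_pos hX m
    have h2 := wordCount_pos hX n
    rw [← Real.log_mul (by positivity) (by positivity)]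
    have := wordCount_pos hX (m + n)
    exact Real.log_le_log (by positivity) (by exact_mod_cast wordCount_add_le X m n)
  · simp [wordCount_eq_zero hX]

/-- The topological entropy, i.e. the exponential growth rate of the number of words. -/
noncomputable def topEntropy (X : Subshift (Fin p) I) : ℝ := (subadditive_log_wordCount X).lim

theorem bddBelow_log_wordCount (X : Subshift (Fin p) I) :
    BddBelow (Set.range fun n : ℕ => Real.log (wordCount X n) / n) := by
  refine ⟨0, ?_⟩
  rintro _ ⟨n, rfl⟩
  have := Real.log_natCast_nonneg (wordCount X n)
  positivity

theorem tendsto_topEntropy (X : Subshift (Fin p) I) :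
    Tendsto (fun n : ℕ => Real.log (wordCount X n) / n) atTop (𝓝 (topEntropy X)) :=
  (subadditive_log_wordCount X).tendsto_lim (bddBelow_log_wordCount X)

theorem topEntropy_nonneg (X : Subshift (Fin p) I) : 0 ≤ topEntropy X :=
  ge_of_tendsto' (tendsto_topEntropy X) fun n => by
    have := Real.log_natCast_nonneg (wordCount X n)
    positivity

theorem mul_topEntropy_le (X : Subshift (Fin p) I) (n : ℕ) :
    n * topEntropy X ≤ Real.log (wordCount X n) := by
  rcases eq_or_ne n 0 with rfl | hn
  · simpa using Real.log_natCast_nonneg _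
  · have := (subadditive_log_wordCount X).lim_le_div (bddBelow_log_wordCount X) hn
    have hn' : (0 : ℝ) < n := by positivity
    rw [le_div_iff₀ hn'] at this
    rw [mul_comm]
    exact this

theorem exp_le_wordCount {X : Subshift (Fin p) I} (hX : X.carrier.Nonempty) (n : ℕ) :
    Real.exp (n * topEntropy X) ≤ wordCount X n := by
  rw [← Real.le_log_iff_exp_le (by exact_mod_cast wordCount_pos hX n)]
  exact mul_topEntropy_le X n

/-- If `c ^ m` words of length `m * Q` exist for all `m`, then `c ≤ e^(Q h)`. -/
theorem le_exp_of_pow_le {X : Subshift (Fin p) I} {c : ℝ} {Q : ℕ}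
    (hc : 0 < c) (h : ∀ m : ℕ, c ^ m ≤ wordCount X (m * Q)) :
    c ≤ Real.exp (Q * topEntropy X) := by
  rw [← Real.log_le_iff_le_exp hc]
  have h1 : ∀ m : ℕ, m * Real.log c ≤ Real.log (wordCount X (m * Q)) := fun m => by
    rw [← Real.log_pow]
    exact Real.log_le_log (by positivity) (h m)
  rcases Nat.eq_zero_or_pos Q with rfl | hQ
  · simp only [Nat.cast_zero, zero_mul]
    simp only [mul_zero] at h1
    -- With blocks of length 0 all powers of `c` are bounded by `#L_0`, so `c ≤ 1`.
    by_contra! hlt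
    obtain ⟨m, hm⟩ := exists_nat_gt (Real.log (wordCount X 0) / Real.log c)
    rw [div_lt_iff₀ hlt] at hm
    exact absurd (h1 m) (not_le.2 hm)
  -- The rates `log #L_(mQ) / (mQ)` tend to `h`, and each dominates `log c / Q`.
  · have ht : Tendsto (fun m : ℕ => m * Q) atTop atTop :=
      tendsto_id.atTop_mul_const' hQ
    have := ((tendsto_topEntropy X).comp ht).const_mul (Q : ℝ)
    refine ge_of_tendsto this ?_
    filter_upwards [eventually_gt_atTop 0] with m hm
    have hm' : (0 : ℝ) < m := by exact_mod_cast hm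
    have hQ' : (0 : ℝ) < Q := by exact_mod_cast hQ
    simp only [Function.comp, Nat.cast_mul]
    rw [mul_div_assoc', le_div_iff₀ (by positivity)]
    nlinarith [h1 m]

/-- If every sequence of symbols of a finite set `S` can be read off, block by block, from a word,
then the number of symbols is at most `e^(Q h)` where `Q` is the length of the blocks. -/
theorem card_le_exp_of_decode {X : Subshift (Fin p) I}
    {S : Type*} [Finite S] [Nonempty S] {Q : ℕ}
    (d : List (Fin p) → S)
    (h : ∀ s : ℕ → S, ∀ m : ℕ, ∃ z ∈ wordsOfLength X (m * Q),
      ∀ a < m, d ((z.drop (a * Q)).take Q) = s a) :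
    (Nat.card S : ℝ) ≤ Real.exp (Q * topEntropy X) := by
  have := Fintype.ofFinite S
  refine le_exp_of_pow_le (by exact_mod_cast Nat.card_pos) fun m => ?_
  have hinh : Inhabited S := Classical.inhabited_of_nonempty inferInstance
  choose z hz hd using fun s : Fin m → S =>
    h (fun a => if h : a < m then s ⟨a, h⟩ else default) m
  have hinj : Function.Injective z := by
    intro s s' hs
    ext a
    have h1 := hd s a a.2
    rw [hs, hd s' a a.2] at h1
    simpa using h1.symm
  have : (Set.univ : Set (Fin m → S)).ncard ≤ (wordsOfLength X (m * Q)).ncard :=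
    Set.ncard_le_ncard_of_injOn z (fun s _ => hz s) hinj.injOn (finite_wordsOfLength X _)
  rw [Set.ncard_univ, Nat.card_fun, Nat.card_fin] at this
  exact_mod_cast this

end Words

/-! ### Factor maps as block codes, and the words they carry over. -/

section Factors

variable {I : Type} [AddMonoidWithOne I] {p q : ℕ}

instance compactSpace_carrier (X : Subshift (Fin p) I) : CompactSpace X.carrier :=
  isCompact_iff_compactSpace.1 X.isClosed.isCompact

theorem continuous_shiftMap (X : Subshift (Fin p) I) : Continuous (shiftMap X) :=
  (continuous_shift (1 : I)).restrict (X.mapsTo 1)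

/-- A continuous function to a discrete space depends, up to an iterate of the shift, only on a
word. -/
theorem exists_word_determines [ShiftIndex I] {X : Subshift (Fin p) I} {S : Type*}
    [TopologicalSpace S] [DiscreteTopology S] {Q : X.carrier → S} (hQ : Continuous Q) :
    ∃ j n : ℕ, (∃ j' : I, (j : I) + j' = 0 ∧ j' + (j : I) = 0) ∧ ∀ y y' : X.carrier,
      wordAt y.1 0 n = wordAt y'.1 0 n → Q ((shiftMap X)^[j] y) = Q ((shiftMap X)^[j] y') := by
  have h1 : ∀ y : X.carrier, ∃ F : Finset I, ∀ y' : X.carrier,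
      (∀ f ∈ F, y'.1 f = y.1 f) → Q y' = Q y := by
    intro y
    obtain ⟨V, hV, hVQ⟩ := isOpen_induced_iff.1 ((isOpen_discrete {Q y}).preimage hQ)
    have hy : y.1 ∈ V := by
      have : y ∈ Subtype.val ⁻¹' V := by rw [hVQ]; rfl
      exact this
    obtain ⟨F, u, hu, hFV⟩ := isOpen_pi_iff.1 hV y.1 hy
    refine ⟨F, fun y' hy' => ?_⟩
    have : y' ∈ Subtype.val ⁻¹' V := by
      apply hFV
      intro f hf
      rw [hy' f hf]
      exact (hu f hf).2
    rw [hVQ] at this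
    exact this
  choose F hF using h1
  -- By compactness finitely many coordinates decide the value of `Q`; `j` then moves all of them
  -- into `ℕ`, where one word covers them.
  obtain ⟨t, ht⟩ := CompactSpace.elim_nhds_subcover
    (fun y : X.carrier => {y' : X.carrier | ∀ f ∈ F y, y'.1 f = y.1 f}) (fun y => by
      refine IsOpen.mem_nhds ?_ (fun f _ => rfl)
      have : {y' : X.carrier | ∀ f ∈ F y, y'.1 f = y.1 f} =
          Subtype.val ⁻¹' (cylinder (F y) y.1) := rfl
      rw [this]
      exact (isOpen_cylinder _ _).preimage continuous_subtype_val)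
  classical
  obtain ⟨j, hj, hk⟩ := ShiftIndex.exists_translate (t.biUnion F)
  choose! k hk using hk
  refine ⟨j, (t.biUnion F).sup k + 1, hj, fun y y' h => ?_⟩
  rw [wordAt_eq_iff] at h
  have h2 : ∀ f ∈ t.biUnion F,
      ((shiftMap X)^[j] y').1 f = ((shiftMap X)^[j] y).1 f := by
    intro f hf
    rw [shiftMap_iterate_apply, shiftMap_iterate_apply, (hk f hf).1]
    have := h (k f) (Nat.lt_succ_of_le (Finset.le_sup hf))
    simpa using this.symm
  have h3 : (shiftMap X)^[j] y ∈ (⊤ : Set X.carrier) := trivial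
  rw [← ht] at h3
  simp only [Set.mem_iUnion] at h3
  obtain ⟨z, hz, hyz⟩ := h3
  rw [hF z _ hyz]
  refine (hF z _ fun f hf => ?_).symm
  rw [h2 f (Finset.mem_biUnion.2 ⟨z, hz, hf⟩)]
  exact hyz f hf

/-- `π` is a factor map given by the block code `Φ` with window `[0, R]`. -/
structure IsBlockFactor (X : Subshift (Fin p) I) (Y : Subshift (Fin q) I) (R : ℕ)
    (Φ : List (Fin p) → List (Fin q)) (π : X.carrier → Y.carrier) : Prop where
  surjective : Function.Surjective π
  semiconj : Function.Semiconj π (shiftMap X) (shiftMap Y)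
  wordAt_eq : ∀ (ξ : X.carrier) (i n : ℕ),
    wordAt (π ξ).1 (i : I) (n - R) = Φ (wordAt ξ.1 (i : I) n)

theorem surjective_iterate (Y : Subshift (Fin q) I) {j : ℕ} {j' : I} (h : j' + (j : I) = 0) :
    Function.Surjective (shiftMap Y)^[j] := by
  intro y
  refine ⟨⟨shift j' y.1, Y.mapsTo j' y.2⟩, Subtype.ext ?_⟩
  rw [shiftMap_iterate, ← shift_add, h, shift_zero]

/-- This is the Curtis–Hedlund–Lyndon theorem. Only the existence of a factor map onto `Y` matters
later, so the given one is followed by `σ^j` to make its window start at 0. -/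
theorem IsFactor.exists_isBlockFactor [ShiftIndex I] {X : Subshift (Fin p) I}
    {Y : Subshift (Fin q) I} (h : IsFactor X Y) : ∃ R Φ π, IsBlockFactor X Y R Φ π := by
  obtain ⟨π, hc, hs, hsc⟩ := h
  obtain ⟨j, n, ⟨j', hj, hj'⟩, hn⟩ := exists_word_determines
    (Q := fun ξ : X.carrier => (π ξ).1 0) ((continuous_apply 0).comp
      (continuous_subtype_val.comp hc))
  have key : ∀ (ξ ξ' : X.carrier) (i i' m m' : ℕ), wordAt ξ.1 (i : I) m = wordAt ξ'.1 (i' : I) m' →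
      wordAt ((shiftMap Y)^[j] (π ξ)).1 (i : I) (m - n) =
      wordAt ((shiftMap Y)^[j] (π ξ')).1 (i' : I) (m' - n) := by
    intro ξ ξ' i i' m m' h
    obtain rfl : m = m' := by simpa using congrArg List.length h
    have letter : ∀ (ξ : X.carrier) (k : ℕ), ((shiftMap Y)^[j] (π ξ)).1 (k : I) =
        (π ((shiftMap X)^[j] ((shiftMap X)^[k] ξ))).1 0 := by
      intro ξ k
      rw [(hsc.iterate_right j).eq, (hsc.iterate_right k).eq, shiftMap_iterate_apply,
        shiftMap_iterate_apply, shiftMap_iterate_apply, add_zero, ← Nat.cast_add, ← Nat.cast_add,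
        add_comm]
    rw [wordAt_eq_iff] at h ⊢
    intro k hk
    rw [← Nat.cast_add, ← Nat.cast_add, letter, letter]
    apply hn
    rw [wordAt_iterate, wordAt_iterate, wordAt_eq_iff]
    intro l hl
    have := h (k + l) (by omega)
    simpa [add_assoc] using this
  classical
  -- By `key` any occurrence of `w` may be used to define its image; words without an occurrence get
  -- the filler `[]`.
  refine ⟨n, fun w => if h : ∃ (ξ : X.carrier) (i : ℕ), wordAt ξ.1 (i : I) w.length = w then
    wordAt ((shiftMap Y)^[j] (π h.choose)).1 (h.choose_spec.choose : I) (w.length - n) else [],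
    (shiftMap Y)^[j] ∘ π, (surjective_iterate Y hj').comp hs, fun ξ => ?_, fun ξ i m => ?_⟩
  · simp only [Function.comp]
    rw [hsc.eq, ← Function.iterate_succ_apply, Function.iterate_succ_apply']
  · have h : ∃ (ξ' : X.carrier) (i' : ℕ), wordAt ξ'.1 (i' : I) (wordAt ξ.1 (i : I) m).length =
        wordAt ξ.1 (i : I) m := ⟨ξ, i, by simp⟩
    simp only [dif_pos h]
    exact key _ _ _ _ _ _ h.choose_spec.choose_spec.symm

theorem IsFactor.nonempty {X : Subshift (Fin p) I} {Y : Subshift (Fin q) I} (h : IsFactor X Y)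
    (hX : X.carrier.Nonempty) : Y.carrier.Nonempty := by
  obtain ⟨π, _⟩ := h
  obtain ⟨x, hx⟩ := hX
  exact ⟨_, (π ⟨x, hx⟩).2⟩

variable {X : Subshift (Fin p) I} {Y : Subshift (Fin q) I} {R : ℕ}
  {Φ : List (Fin p) → List (Fin q)} {π : X.carrier → Y.carrier}

theorem IsBlockFactor.wordAt_zero_eq (h : IsBlockFactor X Y R Φ π) (ξ : X.carrier) (n : ℕ) :
    wordAt (π ξ).1 0 (n - R) = Φ (wordAt ξ.1 0 n) := by
  simpa using h.wordAt_eq ξ 0 n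

theorem IsBlockFactor.exists_preimage (h : IsBlockFactor X Y R Φ π) {w : List (Fin q)}
    (hw : w ∈ language Y) : ∃ x ∈ language X, x.length = w.length + R ∧ Φ x = w := by
  obtain ⟨y, hy⟩ := exists_of_mem_language hw
  obtain ⟨ξ, rfl⟩ := h.surjective y
  refine ⟨wordAt ξ.1 0 (w.length + R), wordAt_mem_language X ξ _ _, by simp, ?_⟩
  rw [← h.wordAt_zero_eq, Nat.add_sub_cancel, hy]

theorem IsBlockFactor.length_map (h : IsBlockFactor X Y R Φ π) {x : List (Fin p)}
    (hx : x ∈ language X) : (Φ x).length = x.length - R := by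
  obtain ⟨ξ, hξ⟩ := exists_of_mem_language hx
  rw [← hξ, ← h.wordAt_zero_eq]; simp

/-- The image of a subword is a subword of the image. -/
theorem IsBlockFactor.map_append (h : IsBlockFactor X Y R Φ π) {u v w : List (Fin p)}
    (hx : u ++ v ++ w ∈ language X) :
    ((Φ (u ++ v ++ w)).drop u.length).take (v.length - R) = Φ v := by
  rcases le_total v.length R with hv | hv
  · have := h.length_map (language_of_append (language_of_append hx).1).2
    rw [Nat.sub_eq_zero_of_le hv] at this ⊢
    rw [List.take_zero, List.eq_nil_of_length_eq_zero this]
  · obtain ⟨ξ, hξ⟩ := exists_of_mem_language hx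
    have h1 := (wordAt_append (wordAt_append hξ).1).2
    rw [← hξ, ← h.wordAt_zero_eq, window_wordAt _ _ (by simp; omega), zero_add, h.wordAt_eq]
    rw [zero_add] at h1
    rw [h1]

/-- The starting position of the `i`-th word in a concatenation with gaps of length `t`. -/
def gluePos {A : Type*} (w : ℕ → List A) (t : ℕ) (i : ℕ) : ℕ :=
  ∑ l ∈ Finset.range i, ((w l).length + t)

theorem wordAt_of_glue {x : I → Fin p} {w v : ℕ → List (Fin p)} {t : ℕ} (m : ℕ)
    (hv : ∀ i < m, (v i).length = t)
    (hx : wordAt x 0 (glue w v m).length = glue w v m) :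
    (glue w v m).length + t = gluePos w t (m + 1) ∧
    ∀ i ≤ m, wordAt x (gluePos w t i : I) (w i).length = w i := by
  induction m with
  | zero =>
    refine ⟨by simp [glue, gluePos], fun i hi => ?_⟩
    obtain rfl : i = 0 := by omega
    simpa [glue, gluePos] using hx
  | succ m ih =>
    simp only [glue] at hx
    obtain ⟨h1, h2⟩ := wordAt_append hx
    obtain ⟨h3, -⟩ := wordAt_append h1
    obtain ⟨h4, h5⟩ := ih (fun i hi => hv i (by omega)) h3
    have hlen : (glue w v m ++ v m).length = gluePos w t (m + 1) := by
      rw [List.length_append, hv m (by omega), h4]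
    refine ⟨?_, fun i hi => ?_⟩
    · simp only [glue]
      rw [List.length_append, hlen]
      conv_rhs => rw [gluePos, Finset.sum_range_succ]
      simp only [gluePos]; omega
    · rcases Nat.lt_or_ge i (m + 1) with hi' | hi'
      · exact h5 i (by omega)
      · obtain rfl : i = m + 1 := by omega
        rw [hlen, zero_add] at h2
        exact h2

theorem SpecS.exists_point {G : Set (List (Fin p))} {t : ℕ} (h : SpecS X G t) (m : ℕ)
    {w : ℕ → List (Fin p)} (hw : ∀ i ≤ m, w i ∈ G) :
    ∃ ξ : X.carrier, ∀ i ≤ m, wordAt ξ.1 (gluePos w t i : I) (w i).length = w i := by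
  obtain ⟨v, hv, hg⟩ := h m w hw
  obtain ⟨ξ, hξ⟩ := exists_of_mem_language hg
  exact ⟨ξ, (wordAt_of_glue m (fun i hi => (hv i hi).2) hξ).2⟩

/-- Every word of `X` belongs to some `G(M)`, hence extends to a word of `G`. -/
theorem exists_extension_mem {Cp G Cs : Set (List (Fin p))} (h : IsDecomposition X Cp G Cs)
    (hE : ExtensionCondition X Cp G Cs) {x : List (Fin p)} (hx : x ∈ language X) :
    ∃ u w, u ++ x ++ w ∈ G := by
  obtain ⟨u, hu, v, hv, w, hw, he⟩ := h.2.2.2 x hx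
  obtain ⟨τ, hτ⟩ := hE (u.length + w.length)
  obtain ⟨a, b, -, -, hab⟩ := hτ x ⟨hx, u, hu, v, hv, w, hw, by omega, by omega, he⟩
  exact ⟨a, b, hab⟩

/-- Under the specification property the images of words of `G` of length `k` number at most
`e^((k + t) h)`. -/
theorem IsBlockFactor.ncard_image_le (h : IsBlockFactor X Y R Φ π) {G : Set (List (Fin p))} {t : ℕ}
    (hG : SpecS X G t) (k : ℕ) :
    ((Φ '' {w | w ∈ G ∧ w.length = k}).ncard : ℝ) ≤
      Real.exp (((k + t : ℕ) : ℝ) * topEntropy Y) := by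
  set S := Φ '' {w | w ∈ G ∧ w.length = k} with hS
  have hfin : S.Finite := (finite_words G k).image Φ
  rcases S.eq_empty_or_nonempty with he | hne
  · rw [he, Set.ncard_empty, Nat.cast_zero]; exact (Real.exp_pos _).le
  have : Finite S := hfin
  have : Nonempty S := hne.to_subtype
  classical
  have s0 : S := Classical.choice this
  rw [← Nat.card_coe_set_eq]
  -- All words have length `k` and all gaps length `t`, so the `a`-th image is read off the first `k
  -- - R` letters of the `a`-th block of length `k + t`; `s0` is a filler.
  refine card_le_exp_of_decode (X := Y)
    (fun z => if hz : z.take (k - R) ∈ S then ⟨z.take (k - R), hz⟩ else s0) ?_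
  intro s m
  have hs : ∀ a, ∃ w, (w ∈ G ∧ w.length = k) ∧ Φ w = s a := fun a => (s a).2
  choose w hw hΦ using hs
  obtain ⟨ξ, hξ⟩ := hG.exists_point m (w := w) fun i _ => (hw i).1
  refine ⟨wordAt (π ξ).1 0 (m * (k + t)), ⟨wordAt_mem_language _ _ _ _, by simp⟩, fun a ha => ?_⟩
  have hpos : gluePos w t a = a * (k + t) := by
    simp [gluePos, (hw _).2]
  have h1 : ((List.drop (a * (k + t)) (wordAt (π ξ).1 0 (m * (k + t)))).take (k + t)).take (k - R)
      = s a := by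
    rw [window_wordAt _ _ (by nlinarith), take_wordAt _ _ (by omega), zero_add, h.wordAt_eq]
    have := hξ a ha.le
    rw [hpos, (hw a).2] at this
    rw [this, hΦ]
  rw [dif_pos (by rw [h1]; exact (s a).2)]
  exact Subtype.ext h1

end Factors

/-! ### Word counts in the factor and joinability with bounded gaps. -/

section Counting

variable {I : Type} [AddMonoidWithOne I] {p q : ℕ}

/-- The number of words of length `n` in `D`. -/
noncomputable def countIn (D : Set (List (Fin p))) (n : ℕ) : ℕ := {w | w ∈ D ∧ w.length = n}.ncard

/-- Growth rate below `a / 2` bounds the count by `e^(na/2)` eventually, which leaves a geometric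
majorant. -/
theorem summable_countIn_mul_exp {D : Set (List (Fin p))} (hD : growthRate D ≤ 0) {a : ℝ}
    (ha : 0 < a) : Summable fun n : ℕ => (countIn D n : ℝ) * Real.exp (-(n * a)) := by
  have h1 : growthRate D < ((a / 2 : ℝ) : EReal) :=
    hD.trans_lt (by exact_mod_cast half_pos ha)
  have h2 := ExpGrowth.eventually_le_exp h1
  refine Summable.of_norm_bounded_eventually_nat (g := fun n => (Real.exp (-(a / 2))) ^ n)
    (summable_geometric_of_lt_one (Real.exp_pos _).le (by simpa using ha)) ?_
  filter_upwards [h2] with n hn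
  have h3 : (countIn D n : ℝ) ≤ Real.exp (a / 2 * n) := by
    rw [← (finite_words D n).cast_ncard_eq] at hn
    have he : ((a / 2 : ℝ) : EReal) * (n : EReal) = ((a / 2 * n : ℝ) : EReal) := by
      rw [EReal.coe_mul]; rfl
    rw [he, EReal.exp_coe] at hn
    have := ENNReal.toReal_mono ENNReal.ofReal_ne_top hn
    rw [ENNReal.toReal_ofReal (Real.exp_pos _).le] at this
    simpa [countIn] using this
  rw [Real.norm_eq_abs, abs_of_nonneg (by positivity), ← Real.exp_nat_mul]
  calc (countIn D n : ℝ) * Real.exp (-(n * a)) ≤ Real.exp (a / 2 * n) * Real.exp (-(n * a)) := by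
        gcongr
    _ = Real.exp (n * -(a / 2)) := by
        rw [← Real.exp_add]; congr 1; ring

variable {X : Subshift (Fin p) I} {Y : Subshift (Fin q) I} {R : ℕ}
  {Φ : List (Fin p) → List (Fin q)} {π : X.carrier → Y.carrier}

theorem ncard_image2_le {A B C : Type*} (f : A → B → C) {s : Set A} {t : Set B} (hs : s.Finite)
    (ht : t.Finite) : (Set.image2 f s t).ncard ≤ s.ncard * t.ncard := by
  rw [← Set.image_prod, ← Set.ncard_prod]
  exact Set.ncard_image_le (hs.prod ht)

/-- The number of words of length at most `R`, plus one. -/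
noncomputable def shortWordBound (p R : ℕ) : ℕ :=
  {w : List (Fin p) | w.length ≤ R}.ncard + 1

theorem finite_short (p R : ℕ) : {w : List (Fin p) | w.length ≤ R}.Finite :=
  List.finite_length_le (Fin p) R

/-- Bound for the number of images of words `u v w` with prescribed lengths of `u ∈ C`, `v ∈ G` and
`w ∈ C`. -/
theorem IsBlockFactor.ncard_decomposed_le (h : IsBlockFactor X Y R Φ π)
    {G C : Set (List (Fin p))} {t : ℕ} (hG : SpecS X G t) (i j k : ℕ) :
    (({y | ∃ u ∈ C, ∃ v ∈ G, ∃ w ∈ C, u.length = i ∧ w.length = j ∧ v.length = k ∧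
        u ++ v ++ w ∈ language X ∧ Φ (u ++ v ++ w) = y}).ncard : ℝ) ≤
      countIn C i * countIn C j * (shortWordBound p R : ℝ) ^ 2 *
        Real.exp (((k + t : ℕ) : ℝ) * topEntropy Y) := by
  set U := {w | w ∈ C ∧ w.length = i} with hU
  set W := {w | w ∈ C ∧ w.length = j} with hW
  set S := {w : List (Fin p) | w.length ≤ R} with hS
  have hUf : U.Finite := finite_words C i
  have hWf : W.Finite := finite_words C j
  have hSf : S.Finite := finite_short p R
  have hScard : S.ncard ≤ shortWordBound p R := Nat.le_succ _
  have hB1 : 1 ≤ shortWordBound p R := Nat.le_add_left _ _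
  have hcount : countIn C i = U.ncard := rfl
  have hcount' : countIn C j = W.ncard := rfl
  have hn := h.ncard_image_le hG k
  set B := Φ '' {w | w ∈ G ∧ w.length = k} with hB
  have hBf : B.Finite := (finite_words G k).image Φ
  rcases le_or_gt R k with hk | hk
  -- For `k ≥ R` the image splits into three parts: one determined by `u` and the next `R` letters,
  -- the image of `v`, and one determined by `w` and the `R` letters before it.
  · let A1 := Φ '' (Set.image2 (· ++ ·) U S)
    let A2 := Φ '' (Set.image2 (· ++ ·) S W)
    have hA1f : A1.Finite := (hUf.image2 _ hSf).image _
    have hA2f : A2.Finite := (hSf.image2 _ hWf).image _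
    have hsub : {y | ∃ u ∈ C, ∃ v ∈ G, ∃ w ∈ C, u.length = i ∧ w.length = j ∧ v.length = k ∧
        u ++ v ++ w ∈ language X ∧ Φ (u ++ v ++ w) = y} ⊆
        Set.image2 (· ++ ·) A1 (Set.image2 (· ++ ·) B A2) := by
      rintro y ⟨u, hu, v, hv, w, hw, hui, hwj, hvk, hx, rfl⟩
      obtain ⟨ξ, hξ⟩ := exists_of_mem_language hx
      obtain ⟨h1, h2⟩ := wordAt_append hξ
      obtain ⟨h3, h4⟩ := wordAt_append h1
      simp only [zero_add] at h2 h4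
      have hlen : (u ++ v ++ w).length - R = i + ((k - R) + j) := by simp; omega
      refine ⟨wordAt (π ξ).1 0 i, ?_, _, ⟨wordAt (π ξ).1 (i : I) (k - R), ?_,
        wordAt (π ξ).1 ((i + (k - R) : ℕ) : I) j, ?_, rfl⟩, ?_⟩
      · refine ⟨wordAt ξ.1 0 (i + R), ⟨u, ⟨hu, hui⟩, wordAt ξ.1 (0 + (i : I)) R, by simp [S], ?_⟩, ?_⟩
        · rw [wordAt_add]; simp only; rw [← hui, h3]
        · rw [← h.wordAt_zero_eq]; simp
      · refine ⟨v, ⟨hv, hvk⟩, ?_⟩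
        rw [h.wordAt_eq, ← hvk, ← hui, h4]
      · refine ⟨wordAt ξ.1 ((i + (k - R) : ℕ) : I) (R + j), ⟨wordAt ξ.1 ((i + (k - R) : ℕ) : I) R, ?_, w,
          ⟨hw, hwj⟩, ?_⟩, ?_⟩
        · simp [S]
        · rw [wordAt_add, ← Nat.cast_add]
          have : i + (k - R) + R = (u ++ v).length := by simp; omega
          rw [this, ← hwj, h2]
        · rw [← h.wordAt_eq]; simp
      · conv_rhs => rw [← hξ, ← h.wordAt_zero_eq, hlen, wordAt_add, wordAt_add]
        simp
    have hfin2 := hBf.image2 (· ++ ·) hA2f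
    have h5 := Set.ncard_le_ncard hsub (hA1f.image2 _ hfin2)
    have h6 : A1.ncard ≤ U.ncard * S.ncard :=
      (Set.ncard_image_le (hUf.image2 _ hSf)).trans (ncard_image2_le _ hUf hSf)
    have h7 : A2.ncard ≤ S.ncard * W.ncard :=
      (Set.ncard_image_le (hSf.image2 _ hWf)).trans (ncard_image2_le _ hSf hWf)
    have h8 := ncard_image2_le (· ++ ·) hA1f hfin2
    have h9 := ncard_image2_le (· ++ ·) hBf hA2f
    have h10 : A1.ncard * (B.ncard * A2.ncard) ≤
        (U.ncard * shortWordBound p R) * (B.ncard * (shortWordBound p R * W.ncard)) := by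
      gcongr
      · exact h6.trans (by gcongr)
      · exact h7.trans (by gcongr)
    have h11 := h5.trans (h8.trans ((Nat.mul_le_mul_left _ h9).trans h10))
    rw [hcount, hcount']
    calc _ ≤ (((U.ncard * shortWordBound p R) * (B.ncard * (shortWordBound p R * W.ncard)) : ℕ) : ℝ)
          := by exact_mod_cast h11
      _ = U.ncard * W.ncard * (shortWordBound p R : ℝ) ^ 2 * B.ncard := by push_cast; ring
      _ ≤ _ := by gcongr
  -- For `k < R` the word `v` is itself one of the short words, and the remaining factors of the
  -- bound are at least 1.
  · have hsub : {y | ∃ u ∈ C, ∃ v ∈ G, ∃ w ∈ C, u.length = i ∧ w.length = j ∧ v.length = k ∧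
        u ++ v ++ w ∈ language X ∧ Φ (u ++ v ++ w) = y} ⊆
        Φ '' (Set.image2 (· ++ ·) (Set.image2 (· ++ ·) U S) W) := by
      rintro y ⟨u, hu, v, hv, w, hw, hui, hwj, hvk, hx, rfl⟩
      exact ⟨_, ⟨_, ⟨u, ⟨hu, hui⟩, v, by simp [S]; omega, rfl⟩, w, ⟨hw, hwj⟩, rfl⟩, rfl⟩
    have hf1 := hUf.image2 (· ++ ·) hSf
    have h5 := Set.ncard_le_ncard hsub ((hf1.image2 _ hWf).image _)
    have h6 := (Set.ncard_image_le (f := Φ) (hf1.image2 (· ++ ·) hWf)).trans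
      (ncard_image2_le (· ++ ·) hf1 hWf)
    have h7 := ncard_image2_le (· ++ ·) hUf hSf
    have h8 := h5.trans (h6.trans (Nat.mul_le_mul_right _ (h7.trans (Nat.mul_le_mul_left _ hScard))))
    have h9 : (1 : ℝ) ≤ Real.exp (((k + t : ℕ) : ℝ) * topEntropy Y) :=
      Real.one_le_exp (mul_nonneg (Nat.cast_nonneg _) (topEntropy_nonneg Y))
    have h10 : (1 : ℝ) ≤ shortWordBound p R := by exact_mod_cast hB1
    rw [hcount, hcount']
    calc _ ≤ ((U.ncard * shortWordBound p R * W.ncard : ℕ) : ℝ) := by exact_mod_cast h8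
      _ = U.ncard * W.ncard * (shortWordBound p R : ℝ) * 1 := by push_cast; ring
      _ ≤ _ := by gcongr; nlinarith

theorem exists_tail_sum_lt {b : ℕ → ℝ} (hb : Summable b) {ε : ℝ} (hε : 0 < ε) :
    ∃ M : ℕ, ∀ s : Finset ℕ, (∀ i ∈ s, M < i) → ∑ i ∈ s, b i < ε := by
  obtain ⟨s0, hs0⟩ := summable_iff_vanishing_norm.1 hb ε hε
  refine ⟨s0.sup id, fun s hs => lt_of_le_of_lt (le_abs_self _) (hs0 s ?_)⟩
  rw [Finset.disjoint_left]
  intro i hi hi0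
  exact absurd (Finset.le_sup (f := id) hi0) (not_le.2 (hs i hi))

/-- If `h > 0`, for large `M` most words are images of words in `G(M)`. -/
theorem IsBlockFactor.exists_ncard_bad_le (h : IsBlockFactor X Y R Φ π)
    {Cp G Cs : Set (List (Fin p))} (hdec : IsDecomposition X Cp G Cs) {t : ℕ} (hG : SpecS X G t)
    (hgr : growthRate (Cp ∪ Cs) ≤ 0) (hpos : 0 < topEntropy Y) {δ : ℝ} (hδ : 0 < δ) :
    ∃ M : ℕ, ∀ n : ℕ, ((wordsOfLength Y n \ Φ '' goodWords X Cp G Cs M).ncard : ℝ) ≤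
      δ * Real.exp (n * topEntropy Y) := by
  set η := topEntropy Y with hη
  set C := Cp ∪ Cs with hC
  set b : ℕ → ℝ := fun n => (countIn C n : ℝ) * Real.exp (-(n * η)) with hb
  have hbs : Summable b := summable_countIn_mul_exp hgr hpos
  have hb0 : ∀ i, 0 ≤ b i := fun i => by positivity
  -- The constants of `ncard_decomposed_le` for `|v| = n + R - i - j`; the exponents `-ih` and `-jh`
  -- go into `b i` and `b j`.
  set K : ℝ := (shortWordBound p R : ℝ) ^ 2 * Real.exp ((R + t : ℕ) * η) with hK
  have hKpos : 0 < K := by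
    have : (0 : ℝ) < shortWordBound p R := by exact_mod_cast Nat.succ_pos _
    positivity
  set T := ∑' i, b i with hT
  have hT0 : 0 ≤ T := tsum_nonneg hb0
  -- One of `i`, `j` exceeds `M`, so the sum of `b i * b j` is at most `2 T` times a tail; this tail
  -- bound turns the total into `δ T / (T + 1)`. Using `T + 1` avoids dividing by zero.
  obtain ⟨M, hM⟩ := exists_tail_sum_lt hbs (ε := δ / (2 * K * (T + 1))) (by positivity)
  refine ⟨M, fun n => ?_⟩
  set s := Finset.range (n + R + 1) with hs
  set P := (s ×ˢ s).filter fun ij => (M < ij.1 ∨ M < ij.2) ∧ ij.1 + ij.2 ≤ n + R with hP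
  let E : ℕ × ℕ → Set (List (Fin q)) := fun ij =>
    {y | ∃ u ∈ C, ∃ v ∈ G, ∃ w ∈ C, u.length = ij.1 ∧ w.length = ij.2 ∧
      v.length = n + R - ij.1 - ij.2 ∧ u ++ v ++ w ∈ language X ∧ Φ (u ++ v ++ w) = y}
  have hsub : wordsOfLength Y n \ Φ '' goodWords X Cp G Cs M ⊆ ⋃ ij ∈ P, E ij := by
    rintro y ⟨⟨hy, hyn⟩, hbad⟩
    obtain ⟨x, hx, hxl, rfl⟩ := h.exists_preimage hy
    obtain ⟨u, hu, v, hv, w, hw, rfl⟩ := hdec.2.2.2 x hx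
    simp only [List.length_append] at hxl
    rw [hyn] at hxl
    simp only [Set.mem_iUnion]
    refine ⟨(u.length, w.length), ?_, u, Or.inl hu, v, hv, w, Or.inr hw, rfl, rfl, ?_, hx, rfl⟩
    · simp only [hP, hs, Finset.mem_filter, Finset.mem_product, Finset.mem_range]
      refine ⟨⟨by omega, by omega⟩, ?_, by omega⟩
      by_contra! hcon
      exact hbad ⟨_, ⟨hx, u, hu, v, hv, w, hw, hcon.1, hcon.2, rfl⟩, rfl⟩
    · simp only; omega
  have hEsub : ∀ ij, E ij ⊆ Φ '' {x | x.length ≤ ij.1 + ij.2 + (n + R)} := by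
    rintro ij y ⟨u, -, v, -, w, -, hu, hw, hv, -, rfl⟩
    refine ⟨_, ?_, rfl⟩
    simp; omega
  have hEfin : ∀ ij, (E ij).Finite := fun ij =>
    ((finite_short p _).image Φ).subset (hEsub ij)
  have h1 : (wordsOfLength Y n \ Φ '' goodWords X Cp G Cs M).ncard ≤ ∑ ij ∈ P, (E ij).ncard :=
    (Set.ncard_le_ncard hsub (P.finite_toSet.biUnion fun ij _ => hEfin ij)).trans
      (P.set_ncard_biUnion_le E)
  have h2 : ∀ ij ∈ P, ((E ij).ncard : ℝ) ≤ K * Real.exp (n * η) * (b ij.1 * b ij.2) := by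
    intro ij hij
    have hle : ij.1 + ij.2 ≤ n + R := by
      simp only [hP, Finset.mem_filter] at hij
      exact hij.2.2
    refine (h.ncard_decomposed_le hG ij.1 ij.2 (n + R - ij.1 - ij.2)).trans (le_of_eq ?_)
    have : (((n + R - ij.1 - ij.2 + t : ℕ)) : ℝ) * topEntropy Y =
        ((R + t : ℕ) : ℝ) * η + n * η + -(ij.1 * η) + -(ij.2 * η) := by
      rw [Nat.sub_sub, Nat.cast_add, Nat.cast_sub hle]; push_cast; ring
    rw [this, Real.exp_add, Real.exp_add, Real.exp_add]
    simp only [hb, hK]; ring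
  have h3 : ∑ ij ∈ P, b ij.1 * b ij.2 ≤ 2 * (δ / (2 * K * (T + 1)) * T) := by
    have hle1 : ∑ j ∈ s, b j ≤ T := hbs.sum_le_tsum s fun i _ => hb0 i
    have hle2 : ∑ i ∈ s.filter (M < ·), b i ≤ δ / (2 * K * (T + 1)) :=
      (hM _ fun i hi => (Finset.mem_filter.1 hi).2).le
    have hsubP : P ⊆ (s.filter (M < ·)) ×ˢ s ∪ s ×ˢ (s.filter (M < ·)) := by
      intro ij hij
      simp only [hP, Finset.mem_filter, Finset.mem_product, Finset.mem_union] at hij ⊢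
      tauto
    calc ∑ ij ∈ P, b ij.1 * b ij.2
        ≤ ∑ ij ∈ (s.filter (M < ·)) ×ˢ s ∪ s ×ˢ (s.filter (M < ·)), b ij.1 * b ij.2 :=
          Finset.sum_le_sum_of_subset_of_nonneg hsubP fun _ _ _ => mul_nonneg (hb0 _) (hb0 _)
      _ ≤ ∑ ij ∈ (s.filter (M < ·)) ×ˢ s, b ij.1 * b ij.2 +
          ∑ ij ∈ s ×ˢ (s.filter (M < ·)), b ij.1 * b ij.2 := by
          rw [← Finset.sum_union_inter]
          exact le_add_of_nonneg_right (Finset.sum_nonneg fun _ _ => mul_nonneg (hb0 _) (hb0 _))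
      _ = 2 * ((∑ i ∈ s.filter (M < ·), b i) * ∑ j ∈ s, b j) := by
          rw [Finset.sum_product, Finset.sum_product, ← Finset.sum_mul_sum, ← Finset.sum_mul_sum]; ring
      _ ≤ _ := by
          gcongr
  calc _ ≤ ∑ ij ∈ P, ((E ij).ncard : ℝ) := by exact_mod_cast h1
    _ ≤ ∑ ij ∈ P, K * Real.exp (n * η) * (b ij.1 * b ij.2) := Finset.sum_le_sum h2
    _ = K * Real.exp (n * η) * ∑ ij ∈ P, b ij.1 * b ij.2 := by rw [Finset.mul_sum]
    _ ≤ K * Real.exp (n * η) * (2 * (δ / (2 * K * (T + 1)) * T)) := by gcongr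
    _ = δ * Real.exp (n * η) * (T / (T + 1)) := by field_simp
    _ ≤ δ * Real.exp (n * η) * 1 := by
        gcongr
        rw [div_le_one (by positivity)]; linarith
    _ = _ := mul_one _

/-- Any two images of words in `G(M)` can be joined with a bounded gap. -/
theorem IsBlockFactor.exists_bridge (h : IsBlockFactor X Y R Φ π)
    {Cp G Cs : Set (List (Fin p))} {t : ℕ} (hG : SpecS X G t)
    (hE : ExtensionCondition X Cp G Cs) (M : ℕ) :
    ∃ g : ℕ, ∀ a ∈ Φ '' goodWords X Cp G Cs M, ∀ b ∈ Φ '' goodWords X Cp G Cs M,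
      ∃ y, y.length ≤ g ∧ a ++ y ++ b ∈ language Y := by
  obtain ⟨τ, hτ⟩ := hE M
  -- Between the two words lie at most `τ` added letters on either side and the gap `t`; the image
  -- of the first word ends up to `R` letters early.
  refine ⟨R + (2 * τ + t), ?_⟩
  rintro _ ⟨x, hx, rfl⟩ _ ⟨x', hx', rfl⟩
  obtain ⟨u, w, hu, hw, hxG⟩ := hτ x hx
  obtain ⟨u', w', hu', hw', hxG'⟩ := hτ x' hx'
  obtain ⟨v, hv, hgl⟩ := hG 1 (fun i => if i = 0 then u ++ x ++ w else u' ++ x' ++ w')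
    (fun i _ => by split_ifs <;> assumption)
  have hv0 := hv 0 one_pos
  simp only [glue, if_true, zero_add, one_ne_zero, if_false] at hgl
  have h1 : u ++ (x ++ (w ++ v 0 ++ u') ++ x' ++ w') ∈ language X := by
    simpa only [List.append_assoc] using hgl
  have h2 := (language_of_append (language_of_append h1).2).1
  obtain ⟨ξ, hξ⟩ := exists_of_mem_language h2
  obtain ⟨h3, h4⟩ := wordAt_append hξ
  obtain ⟨h5, h6⟩ := wordAt_append h3
  set z := w ++ v 0 ++ u' with hz
  have hzl : z.length ≤ 2 * τ + t := by simp only [hz, List.length_append, hv0.2]; omega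
  have h4' : wordAt (π ξ).1 ((x ++ z).length : I) (x'.length - R) = Φ x' := by
    rw [h.wordAt_eq]; simpa using congrArg Φ h4
  have h5' : wordAt (π ξ).1 0 (x.length - R) = Φ x := by
    rw [h.wordAt_zero_eq, h5]
  -- The bridge is what `π ξ` shows between the end of `Φ x` and the start of `Φ x'`.
  refine ⟨wordAt (π ξ).1 ((x.length - R : ℕ) : I) ((x ++ z).length - (x.length - R)), ?_, ?_⟩
  · simp; omega
  · have h7 := wordAt_add (π ξ).1 0 ((x.length - R) + ((x ++ z).length - (x.length - R)))
      (x'.length - R)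
    rw [Nat.add_sub_cancel' (by simp; omega), zero_add, h4'] at h7
    have h8 := wordAt_add (π ξ).1 0 (x.length - R) ((x ++ z).length - (x.length - R))
    rw [Nat.add_sub_cancel' (by simp; omega), zero_add, h5'] at h8
    rw [← h8, ← h7]
    exact wordAt_mem_language _ _ _ _

/-- The words of `Y` outside a set of words that can be joined with bounded gaps have arbitrarily
small proportion. -/
def HasJoinableWords (Y : Subshift (Fin q) I) : Prop :=
  ∀ δ > 0, ∃ (J : Set (List (Fin q))) (g : ℕ),
    (∀ n : ℕ, ((wordsOfLength Y n \ J).ncard : ℝ) ≤ δ * Real.exp (n * topEntropy Y)) ∧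
    ∀ a ∈ J, ∀ b ∈ J, ∃ y, y.length ≤ g ∧ a ++ y ++ b ∈ language Y

theorem IsBlockFactor.hasJoinableWords (h : IsBlockFactor X Y R Φ π)
    {Cp G Cs : Set (List (Fin p))} (hdec : IsDecomposition X Cp G Cs) {t : ℕ} (hG : SpecS X G t)
    (hgr : growthRate (Cp ∪ Cs) ≤ 0) (hE : ExtensionCondition X Cp G Cs)
    (hpos : 0 < topEntropy Y) : HasJoinableWords Y := fun δ hδ => by
  obtain ⟨M, hM⟩ := h.exists_ncard_bad_le hdec hG hgr hpos hδ
  obtain ⟨g, hg⟩ := h.exists_bridge hG hE M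
  exact ⟨_, g, hM, hg⟩

theorem ncard_le_of_bad_le {E J : Set (List (Fin q))} {n : ℕ} {c : ℝ}
    (hE : E ⊆ wordsOfLength Y n) (hbad : ((wordsOfLength Y n \ J).ncard : ℝ) ≤ c) :
    (E.ncard : ℝ) - c ≤ (E ∩ J).ncard := by
  have hfin := finite_wordsOfLength Y n
  have h1 : (E \ J).ncard ≤ (wordsOfLength Y n \ J).ncard :=
    Set.ncard_le_ncard (Set.sdiff_subset_sdiff_left hE) hfin.sdiff
  have h2 := Set.ncard_inter_add_ncard_sdiff_eq_ncard E J (hfin.subset hE)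
  have h3 : ((E ∩ J).ncard : ℝ) + (E \ J).ncard = E.ncard := by exact_mod_cast h2
  have h4 : ((E \ J).ncard : ℝ) ≤ (wordsOfLength Y n \ J).ncard := by exact_mod_cast h1
  linarith

/-- `#L_n ≤ C e^(n h)`. -/
theorem HasJoinableWords.exists_wordCount_le (h : HasJoinableWords Y) (hY : Y.carrier.Nonempty) :
    ∃ C : ℝ, 1 ≤ C ∧ ∀ n : ℕ, (wordCount Y n : ℝ) ≤ C * Real.exp (n * topEntropy Y) := by
  -- As `e^(nh) ≤ #L_n`, at most half of all words lie outside `J`.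
  obtain ⟨J, g, hJ, hg⟩ := h (1 / 2) (by norm_num)
  have hgood : ∀ n, (wordCount Y n : ℝ) / 2 ≤ (wordsOfLength Y n ∩ J).ncard := fun n => by
    have h1 := ncard_le_of_bad_le (subset_refl _) (hJ n)
    have h2 := exp_le_wordCount hY n
    change (wordCount Y n : ℝ) - _ ≤ _ at h1
    linarith
  -- `g + 1` counts the lengths of the bridge, and `#L_g` pays for cutting the joined words of
  -- length `m + n + g` down to `m + n`.
  set K : ℕ := (g + 1) * wordCount Y g with hK
  have hKpos : 0 < K := Nat.mul_pos g.succ_pos (wordCount_pos hY g)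
  -- Counts are supermultiplicative up to a constant: a joined word and the length of its bridge
  -- determine both pieces. The 4 comes from keeping half of the words twice.
  have hsuper : ∀ m n, (wordCount Y m : ℝ) * wordCount Y n ≤ 4 * K * wordCount Y (m + n) := by
    intro m n
    choose! y hy hyL using hg
    have hext : ∀ a b, ∃ z, a ∈ wordsOfLength Y m ∩ J → b ∈ wordsOfLength Y n ∩ J →
        a ++ y a b ++ b ++ z ∈ wordsOfLength Y (m + n + g) := by
      intro a b
      by_cases hab : a ∈ wordsOfLength Y m ∩ J ∧ b ∈ wordsOfLength Y n ∩ J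
      · obtain ⟨⟨⟨ha, hal⟩, haJ⟩, ⟨⟨hb, hbl⟩, hbJ⟩⟩ := hab
        have := hy a haJ b hbJ
        obtain ⟨z, hz, hzl⟩ := exists_extension (hyL a haJ b hbJ) (n := m + n + g)
          (by simp; omega)
        exact ⟨z, fun _ _ => ⟨hz, hzl⟩⟩
      · exact ⟨[], fun ha hb => (hab ⟨ha, hb⟩).elim⟩
    choose z hz using hext
    have h1 : ((wordsOfLength Y m ∩ J) ×ˢ (wordsOfLength Y n ∩ J)).ncard ≤
        (wordsOfLength Y (m + n + g) ×ˢ (Finset.range (g + 1) : Set ℕ)).ncard := by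
      refine Set.ncard_le_ncard_of_injOn
        (fun ab => (ab.1 ++ y ab.1 ab.2 ++ ab.2 ++ z ab.1 ab.2, (y ab.1 ab.2).length)) ?_ ?_
        ((finite_wordsOfLength Y _).prod (Finset.finite_toSet _))
      · rintro ⟨a, b⟩ ⟨ha, hb⟩
        refine ⟨hz a b ha hb, ?_⟩
        have := hy a ha.2 b hb.2
        simp; omega
      · rintro ⟨a, b⟩ ⟨ha, hb⟩ ⟨a', b'⟩ ⟨ha', hb'⟩ heq
        simp only [Prod.mk.injEq, List.append_assoc] at heq ha hb ha' hb' ⊢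
        obtain ⟨h1, h2⟩ := List.append_inj heq.1 (ha.1.2.trans ha'.1.2.symm)
        obtain ⟨h3, h4⟩ := List.append_inj h2 heq.2
        exact ⟨h1, (List.append_inj h4 (hb.1.2.trans hb'.1.2.symm)).1⟩
    rw [Set.ncard_prod, Set.ncard_prod, Set.ncard_coe_finset, Finset.card_range] at h1
    have h2 : wordCount Y (m + n + g) * (g + 1) ≤ K * wordCount Y (m + n) := by
      have := wordCount_add_le Y (m + n) g
      rw [hK]; nlinarith
    have h3 : ((wordsOfLength Y m ∩ J).ncard : ℝ) * (wordsOfLength Y n ∩ J).ncard ≤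
        K * wordCount Y (m + n) := by exact_mod_cast h1.trans h2
    have h4 := mul_le_mul (hgood m) (hgood n) (by positivity) (by positivity)
    linarith
  have hK1 : (1 : ℝ) ≤ K := by exact_mod_cast hKpos
  refine ⟨4 * K, by linarith, fun n => ?_⟩
  -- Iterating `hsuper` shows that the `n`-th count divided by `4 K` cannot exceed `e^(nh)`.
  have hpow : ∀ m : ℕ, ((wordCount Y n : ℝ) / (4 * K)) ^ m ≤ wordCount Y (m * n) := by
    intro m
    induction m with
    | zero =>
      have : 1 ≤ wordCount Y (0 * n) := wordCount_pos hY _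
      simpa using this
    | succ m ih =>
      rw [pow_succ, Nat.succ_mul]
      calc _ ≤ (wordCount Y (m * n) : ℝ) * ((wordCount Y n : ℝ) / (4 * K)) := by gcongr
        _ = (wordCount Y (m * n) : ℝ) * (wordCount Y n : ℝ) / (4 * K) := by ring
        _ ≤ _ := by
          rw [div_le_iff₀ (by positivity)]
          linarith [hsuper (m * n) n]
  have hcpos : (0 : ℝ) < wordCount Y n := by exact_mod_cast wordCount_pos hY n
  have := le_exp_of_pow_le (by positivity) hpow
  rw [div_le_iff₀ (by positivity)] at this
  linarith

end Counting

/-! ### Rigidity of the factor when `h = 0`. -/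

section ZeroEntropy

variable {I : Type} [AddMonoidWithOne I] {p q : ℕ}
variable {X : Subshift (Fin p) I} {Y : Subshift (Fin q) I} {R : ℕ}
  {Φ : List (Fin p) → List (Fin q)} {π : X.carrier → Y.carrier}

theorem getElem?_wordAt (x : I → Fin p) (i : I) {n k : ℕ} (h : k < n) :
    (wordAt x i n)[k]? = some (x (i + (k : I))) := by
  rw [List.getElem?_eq_getElem (by simpa using h), getElem_wordAt]

theorem gluePos_two_mul {A : Type*} {w : ℕ → List A} {t P : ℕ}
    (h : ∀ a, (w (2 * a)).length + t + ((w (2 * a + 1)).length + t) = P) (a : ℕ) :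
    gluePos w t (2 * a) = a * P := by
  induction a with
  | zero => simp [gluePos]
  | succ a ih =>
    have : gluePos w t (2 * (a + 1)) =
        gluePos w t (2 * a) + ((w (2 * a)).length + t + ((w (2 * a + 1)).length + t)) := by
      simp only [gluePos]
      rw [mul_add, mul_one, Finset.sum_range_succ, Finset.sum_range_succ, add_assoc]
    rw [this, ih, h, Nat.succ_mul]

/-- If `h = 0`, exchanging two neighbouring words of `G` may not be visible in the image. -/
theorem IsBlockFactor.getElem?_add_eq (h : IsBlockFactor X Y R Φ π) {G : Set (List (Fin p))}
    {t : ℕ} (hG : SpecS X G t) (h0 : topEntropy Y = 0) {g0 g : List (Fin p)} (hg0 : g0 ∈ G)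
    (hg : g ∈ G) {i : ℕ} (hi : i + (g0.length + t) < g.length - R) :
    (Φ g)[i]? = (Φ g)[i + (g0.length + t)]? := by
  by_contra hne
  set Q := g0.length + t with hQ
  set P := g0.length + t + (g.length + t) with hP
  -- Either order of `g0`, `g` fills a block of length `P`. Position `i + Q` of the image shows
  -- letter `i` of `Φ g` if `g0` comes first and letter `i + Q` if `g` does. Were these different,
  -- each block would encode a bit, giving `2 ≤ e^(Ph) = 1`.
  have key : (Nat.card Bool : ℝ) ≤ Real.exp (P * topEntropy Y) := by
    classical
    refine card_le_exp_of_decode (X := Y) (fun z => decide (z[i + Q]? = (Φ g)[i]?)) ?_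
    intro s m
    -- The `a`-th pair is `g0, g` if `s a` is true and `g, g0` otherwise.
    let w : ℕ → List (Fin p) := fun l => if s (l / 2) = decide (l % 2 = 0) then g0 else g
    have hw0 : ∀ a, w (2 * a) = if s a then g0 else g := fun a => by
      simp [w]
    have hw1 : ∀ a, w (2 * a + 1) = if s a then g else g0 := fun a => by
      have h1 : (2 * a + 1) / 2 = a := by omega
      have h2 : (2 * a + 1) % 2 = 1 := by omega
      simp only [w, h1, h2]
      cases s a <;> simp
    have hpos : ∀ a, gluePos w t (2 * a) = a * P := gluePos_two_mul fun a => by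
      rw [hw0, hw1]
      cases s a <;> simp [hP]; omega
    obtain ⟨ξ, hξ⟩ := hG.exists_point (2 * m) (w := w) fun l _ => by
      simp only [w]; split_ifs <;> assumption
    refine ⟨wordAt (π ξ).1 0 (m * P), ⟨wordAt_mem_language _ _ _ _, by simp⟩, fun a ha => ?_⟩
    rw [window_wordAt _ _ (by nlinarith), zero_add, getElem?_wordAt _ _ (by omega)]
    cases hsa : s a
    · have h1 := hξ (2 * a) (by omega)
      rw [hpos, hw0, hsa] at h1
      have h2 := h.wordAt_eq ξ (a * P) g.length
      simp only [Bool.false_eq_true, if_false] at h1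
      rw [h1] at h2
      rw [decide_eq_false_iff_not]
      intro hcon
      apply hne
      rw [← hcon, ← h2, getElem?_wordAt _ _ hi]
    · have h1 := hξ (2 * a + 1) (by omega)
      have h3 : gluePos w t (2 * a + 1) = a * P + Q := by
        rw [← hpos a, gluePos, Finset.sum_range_succ, hw0, hsa]; rfl
      rw [h3, hw1, hsa] at h1
      have h2 := h.wordAt_eq ξ (a * P + Q) g.length
      simp only [if_true] at h1
      rw [h1] at h2
      rw [decide_eq_true_iff, ← h2, getElem?_wordAt _ _ (by omega), add_comm i Q]
      push_cast
      rw [add_assoc]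
  rw [h0, mul_zero, Real.exp_zero, Nat.card_eq_fintype_card, Fintype.card_bool] at key
  norm_num at key

/-- Every window of a point sits inside the image of a word of `G`, where `getElem?_add_eq` makes
letters at distance `|g0| + t` agree. The fixed `g0` contains a letter, so this distance is positive
even for `t = 0`. -/
theorem IsBlockFactor.exists_periodic (h : IsBlockFactor X Y R Φ π) (hX : X.carrier.Nonempty)
    {Cp G Cs : Set (List (Fin p))} (hdec : IsDecomposition X Cp G Cs) {t : ℕ} (hG : SpecS X G t)
    (hE : ExtensionCondition X Cp G Cs) (h0 : topEntropy Y = 0) :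
    ∃ Q : ℕ, 0 < Q ∧ ∀ (y : Y.carrier) (i : ℕ), y.1 ((i : ℕ) : I) = y.1 ((i + Q : ℕ) : I) := by
  obtain ⟨x0, hx0⟩ := hX
  obtain ⟨u, w, hg0⟩ := exists_extension_mem hdec hE (wordAt_mem_language X ⟨x0, hx0⟩ 0 1)
  refine ⟨(u ++ wordAt x0 0 1 ++ w).length + t, by simp, fun y i => ?_⟩
  set Q := (u ++ wordAt x0 0 1 ++ w).length + t
  obtain ⟨ξ, rfl⟩ := h.surjective y
  -- The window `Q + 1 + R` leaves `Q + 1` letters in the image, enough to see positions `i` and `i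
  -- + Q`.
  obtain ⟨a, b, hab⟩ := exists_extension_mem hdec hE
    (wordAt_mem_language X ξ (i : I) (Q + 1 + R))
  have h1 := h.map_append (hdec.2.1 hab)
  rw [← h.wordAt_eq, length_wordAt, Nat.add_sub_cancel] at h1
  have h2 := h.getElem?_add_eq hG h0 hg0 hab (i := a.length) (by
    have hl : ∀ m, (a ++ m ++ b).length = a.length + m.length + b.length := by
      simp [add_assoc]
    rw [hl (wordAt _ _ _), length_wordAt]
    change a.length + Q < _
    omega)
  have h3 : ∀ k < Q + 1, (Φ (a ++ wordAt ξ.1 (i : I) (Q + 1 + R) ++ b))[a.length + k]? =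
      some ((π ξ).1 ((i : I) + (k : I))) := by
    intro k hk
    have := congrArg (fun l => l[k]?) h1
    simp only [getElem?_wordAt _ _ hk] at this
    rw [← this, List.getElem?_take_of_lt hk, List.getElem?_drop]
  have h4 := h3 0 (by omega)
  rw [add_zero, h2, h3 Q (by omega)] at h4
  simpa using h4.symm

/-- Each word belongs to some `G(M)`. Here the gap may depend on the two words, so no entropy
estimate is needed. -/
theorem IsBlockFactor.exists_joined (h : IsBlockFactor X Y R Φ π)
    {Cp G Cs : Set (List (Fin p))} (hdec : IsDecomposition X Cp G Cs) {t : ℕ} (hG : SpecS X G t)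
    (hE : ExtensionCondition X Cp G Cs) {a b : List (Fin q)} (ha : a ∈ language Y)
    (hb : b ∈ language Y) : ∃ y, a ++ y ++ b ∈ language Y := by
  obtain ⟨x, hx, -, rfl⟩ := h.exists_preimage ha
  obtain ⟨x', hx', -, rfl⟩ := h.exists_preimage hb
  obtain ⟨u, hu, v, hv, w, hw, he⟩ := hdec.2.2.2 x hx
  obtain ⟨u', hu', v', hv', w', hw', he'⟩ := hdec.2.2.2 x' hx'
  obtain ⟨g, hg⟩ := h.exists_bridge hG hE (u.length + w.length + u'.length + w'.length)
  obtain ⟨y, -, hy⟩ := hg _ ⟨x, ⟨hx, u, hu, v, hv, w, hw, by omega, by omega, he⟩, rfl⟩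
    _ ⟨x', ⟨hx', u', hu', v', hv', w', hw', by omega, by omega, he'⟩, rfl⟩
  exact ⟨y, hy⟩

/-- If `h = 0`, all points of `Y` are periodic with a common period, over which every word occurs
equally often in all points. -/
theorem IsBlockFactor.exists_count_eq (h : IsBlockFactor X Y R Φ π) (hX : X.carrier.Nonempty)
    {Cp G Cs : Set (List (Fin p))} (hdec : IsDecomposition X Cp G Cs) {t : ℕ} (hG : SpecS X G t)
    (hE : ExtensionCondition X Cp G Cs) (h0 : topEntropy Y = 0) :
    ∃ Q : ℕ, 0 < Q ∧ ∀ (w : List (Fin q)) (y y' : Y.carrier),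
      Q.count (fun i => wordAt y.1 (i : I) w.length = w) =
        Q.count (fun i => wordAt y'.1 (i : I) w.length = w) := by
  obtain ⟨Q, hQ, hper⟩ := h.exists_periodic hX hdec hG hE h0
  refine ⟨Q, hQ, fun w y y' => ?_⟩
  -- Long enough to contain every occurrence of `w` starting before `Q`. A single point `η` then
  -- shows these stretches of both `y` and `y'`.
  set n := Q + w.length
  obtain ⟨m, hm⟩ := h.exists_joined hdec hG hE (wordAt_mem_language Y y 0 n)
    (wordAt_mem_language Y y' 0 n)
  obtain ⟨η, hη⟩ := exists_of_mem_language hm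
  obtain ⟨h1, h2⟩ := wordAt_append hη
  obtain ⟨h3, -⟩ := wordAt_append h1
  set d := (wordAt y.1 0 n ++ m).length
  rw [length_wordAt, wordAt_eq_iff] at h2 h3
  simp only [zero_add] at h2 h3
  -- By periodicity of `η` the occurrences in `[d, d + Q)`, copied from `y'`, are as many as those
  -- in `[0, Q)`, copied from `y`.
  have hp : Function.Periodic (fun i : ℕ => wordAt η.1 (i : I) w.length = w) Q := by
    intro i
    have : wordAt η.1 ((i + Q : ℕ) : I) w.length = wordAt η.1 (i : I) w.length := by
      rw [wordAt_eq_iff]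
      intro k _
      rw [← Nat.cast_add, ← Nat.cast_add, hper η (i + k), show i + Q + k = i + k + Q by omega]
    simp only [this]
  have e1 : Q.count (fun i => wordAt y.1 (i : I) w.length = w) =
      Q.count (fun i => wordAt η.1 (i : I) w.length = w) := by
    rw [Nat.count_eq_card_filter_range, Nat.count_eq_card_filter_range]
    congr 1
    refine Finset.filter_congr fun i hi => ?_
    have : wordAt y.1 (i : I) w.length = wordAt η.1 (i : I) w.length := by
      rw [wordAt_eq_iff]
      intro k hk
      rw [← Nat.cast_add, h3 _ (by have := Finset.mem_range.1 hi; omega)]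
    rw [this]
  have e2 : Q.count (fun i => wordAt y'.1 (i : I) w.length = w) =
      Q.count (fun i => wordAt η.1 (i : I) w.length = w) := by
    rw [← Nat.filter_Ico_card_eq_of_periodic d Q _ hp, Nat.count_eq_card_filter_range]
    refine Finset.card_bij (fun i _ => d + i) ?_ (fun i _ j _ h => by omega) ?_
    · intro i hi
      simp only [Finset.mem_filter, Finset.mem_range, Finset.mem_Ico] at hi ⊢
      refine ⟨by omega, ?_⟩
      refine Eq.trans ?_ hi.2
      rw [wordAt_eq_iff]
      intro k hk
      have := h2 (i + k) (by omega)
      push_cast at this ⊢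
      rw [← this, add_assoc]
    · intro j hj
      simp only [Finset.mem_filter, Finset.mem_range, Finset.mem_Ico] at hj ⊢
      refine ⟨j - d, ⟨by omega, ?_⟩, by omega⟩
      refine Eq.trans ?_ hj.2
      rw [wordAt_eq_iff]
      intro k hk
      have := h2 (j - d + k) (by omega)
      rw [← Nat.cast_add, ← Nat.cast_add, ← this, ← Nat.cast_add,
        show d + (j - d + k) = j + k by omega]
  rw [e1, e2]

end ZeroEntropy

/-! ### Shannon entropy of finitely valued functions. -/

section FiniteEntropy

open Real

/-- The pointwise Gibbs inequality, from `log x ≤ x - 1` at `x = r / p`. The last hypothesis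
excludes the case spoilt by the convention `log 0 = 0`. -/
theorem mul_log_sub_le {p r : ℝ} (hp : 0 ≤ p) (hr : 0 ≤ r) (h : r = 0 → p = 0) :
    p * log r - p * log p ≤ r - p := by
  rcases hp.eq_or_lt with rfl | hp
  · simpa using hr
  · have hr' : 0 < r := hr.lt_of_ne fun h' => hp.ne' (h h'.symm)
    have h1 := Real.log_le_sub_one_of_pos (div_pos hr' hp)
    rw [Real.log_div hr'.ne' hp.ne'] at h1
    have h2 := mul_le_mul_of_nonneg_left h1 hp.le
    have h3 : p * (r / p - 1) = r - p := by field_simp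
    linarith

theorem negMulLog_sum_le {A : Type*} (s : Finset A) {p : A → ℝ} (hp : ∀ a, 0 ≤ p a) :
    negMulLog (∑ a ∈ s, p a) ≤ ∑ a ∈ s, negMulLog (p a) := by
  have h1 : negMulLog (∑ a ∈ s, p a) = ∑ a ∈ s, -(p a * log (∑ a ∈ s, p a)) := by
    rw [negMulLog, Finset.sum_neg_distrib, ← Finset.sum_mul, neg_mul]
  rw [h1]
  refine Finset.sum_le_sum fun a ha => ?_
  rcases (hp a).eq_or_lt with h0 | h0
  · simp [← h0]
  · rw [negMulLog, neg_mul, neg_le_neg_iff]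
    have : p a ≤ ∑ a ∈ s, p a := Finset.single_le_sum (fun a _ => hp a) ha
    exact mul_le_mul_of_nonneg_left (Real.log_le_log h0 this) h0.le

/-- Gibbs' inequality against the uniform distribution of the same total mass on `s`. -/
theorem sum_negMulLog_le {A : Type*} (s : Finset A) {p : A → ℝ} (hp : ∀ a, 0 ≤ p a) :
    ∑ a ∈ s, negMulLog (p a) ≤
      (∑ a ∈ s, p a) * log s.card + negMulLog (∑ a ∈ s, p a) := by
  set P := ∑ a ∈ s, p a with hP
  rcases s.eq_empty_or_nonempty with rfl | hs
  · simp [hP]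
  have hcard : (0 : ℝ) < s.card := by exact_mod_cast hs.card_pos
  have hP0 : 0 ≤ P := Finset.sum_nonneg fun a _ => hp a
  have h1 : ∀ a ∈ s, p a * log (P / s.card) - p a * log (p a) ≤ P / s.card - p a := by
    intro a ha
    refine mul_log_sub_le (hp a) (by positivity) fun h => ?_
    rw [div_eq_zero_iff, or_iff_left hcard.ne'] at h
    exact (Finset.sum_eq_zero_iff_of_nonneg fun a _ => hp a).1 h a ha
  have h2 := Finset.sum_le_sum h1
  rw [Finset.sum_sub_distrib, Finset.sum_sub_distrib, ← Finset.sum_mul, Finset.sum_const,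
    nsmul_eq_mul, mul_div_cancel₀ _ hcard.ne', ← hP, sub_self] at h2
  have h3 : ∑ a ∈ s, negMulLog (p a) = -∑ a ∈ s, p a * log (p a) := by
    simp [negMulLog, Finset.sum_neg_distrib]
  rcases hP0.eq_or_lt with h0 | h0
  · rw [← h0] at h2 ⊢
    simp only [zero_mul, zero_div, negMulLog_zero, add_zero] at h2 ⊢
    linarith
  · rw [Real.log_div h0.ne' hcard.ne', mul_sub] at h2
    rw [h3, negMulLog]
    linarith

/-- Strong subadditivity of Shannon entropy. -/
theorem sum_negMulLog_submodular {A B C : Type*} [Fintype A] [Fintype B] [Fintype C]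
    {p : A → B → C → ℝ} (hp : ∀ a b c, 0 ≤ p a b c) :
    ∑ a, ∑ b, ∑ c, negMulLog (p a b c) + ∑ c, negMulLog (∑ a, ∑ b, p a b c) ≤
      ∑ a, ∑ c, negMulLog (∑ b, p a b c) + ∑ b, ∑ c, negMulLog (∑ a, p a b c) := by
  set u : A → C → ℝ := fun a c => ∑ b, p a b c with hu
  set v : B → C → ℝ := fun b c => ∑ a, p a b c with hv
  set w : C → ℝ := fun c => ∑ a, ∑ b, p a b c with hw
  have hu0 : ∀ a c, 0 ≤ u a c := fun a c => Finset.sum_nonneg fun b _ => hp a b c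
  have hv0 : ∀ b c, 0 ≤ v b c := fun b c => Finset.sum_nonneg fun a _ => hp a b c
  have hwu : ∀ c, w c = ∑ a, u a c := fun c => rfl
  have hwv : ∀ c, w c = ∑ b, v b c := fun c => Finset.sum_comm
  have hw0 : ∀ c, 0 ≤ w c := fun c => Finset.sum_nonneg fun a _ => hu0 a c
  have hpu : ∀ a b c, p a b c ≤ u a c := fun a b c =>
    Finset.single_le_sum (f := fun b => p a b c) (fun b _ => hp a b c) (Finset.mem_univ b)
  have hpv : ∀ a b c, p a b c ≤ v b c := fun a b c =>
    Finset.single_le_sum (f := fun a => p a b c) (fun a _ => hp a b c) (Finset.mem_univ a)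
  have huw : ∀ a c, u a c ≤ w c := fun a c =>
    Finset.single_le_sum (f := fun a => u a c) (fun a _ => hu0 a c) (Finset.mem_univ a)
  -- Gibbs' inequality comparing `p` with `u v / w`, under which `a` and `b` are independent given
  -- `c`. Both have the same total mass, so the right-hand sides sum to zero.
  have term : ∀ a b c, negMulLog (p a b c) + -(p a b c * log (w c)) - (-(p a b c * log (u a c)))
      - (-(p a b c * log (v b c))) ≤ u a c * v b c / w c - p a b c := by
    intro a b c
    rcases (hp a b c).eq_or_lt with h0 | h0
    · rw [← h0]
      have := div_nonneg (mul_nonneg (hu0 a c) (hv0 b c)) (hw0 c)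
      simpa using this
    · have h1 : 0 < u a c := h0.trans_le (hpu a b c)
      have h2 : 0 < v b c := h0.trans_le (hpv a b c)
      have h3 : 0 < w c := h1.trans_le (huw a c)
      have := mul_log_sub_le (hp a b c) (r := u a c * v b c / w c) (by positivity)
        fun h => absurd h (by positivity)
      rw [Real.log_div (by positivity) h3.ne', Real.log_mul h1.ne' h2.ne'] at this
      rw [negMulLog]
      linarith
  have hsum := Finset.sum_le_sum fun a (_ : a ∈ Finset.univ) =>
    Finset.sum_le_sum fun b (_ : b ∈ Finset.univ) =>
      Finset.sum_le_sum fun c (_ : c ∈ Finset.univ) => term a b c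
  simp only [Finset.sum_sub_distrib, Finset.sum_add_distrib] at hsum
  have e1 : ∑ a, ∑ b, ∑ c, -(p a b c * log (w c)) = ∑ c, negMulLog (w c) := by
    calc _ = ∑ a, ∑ c, ∑ b, -(p a b c * log (w c)) :=
          Finset.sum_congr rfl fun a _ => Finset.sum_comm
      _ = ∑ c, ∑ a, ∑ b, -(p a b c * log (w c)) := Finset.sum_comm
      _ = _ := by
        refine Finset.sum_congr rfl fun c _ => ?_
        simp only [negMulLog, hw, Finset.sum_neg_distrib, Finset.sum_mul, neg_mul]
  have e2 : ∑ a, ∑ b, ∑ c, -(p a b c * log (u a c)) = ∑ a, ∑ c, negMulLog (u a c) := by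
    refine Finset.sum_congr rfl fun a _ => ?_
    rw [Finset.sum_comm]
    refine Finset.sum_congr rfl fun c _ => ?_
    simp only [negMulLog, hu, Finset.sum_neg_distrib, Finset.sum_mul, neg_mul]
  have e3 : ∑ a, ∑ b, ∑ c, -(p a b c * log (v b c)) = ∑ b, ∑ c, negMulLog (v b c) := by
    rw [Finset.sum_comm]
    refine Finset.sum_congr rfl fun b _ => ?_
    rw [Finset.sum_comm]
    refine Finset.sum_congr rfl fun c _ => ?_
    simp only [negMulLog, hv, Finset.sum_neg_distrib, Finset.sum_mul, neg_mul]
  have e4 : ∑ a, ∑ b, ∑ c, u a c * v b c / w c = ∑ c, w c := by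
    calc _ = ∑ a, ∑ c, ∑ b, u a c * v b c / w c :=
          Finset.sum_congr rfl fun a _ => Finset.sum_comm
      _ = ∑ c, ∑ a, ∑ b, u a c * v b c / w c := Finset.sum_comm
      _ = _ := by
        refine Finset.sum_congr rfl fun c _ => ?_
        simp only [← Finset.sum_div, ← Finset.mul_sum, ← hwv, ← Finset.sum_mul, ← hwu]
        rcases eq_or_ne (w c) 0 with h | h
        · simp [h]
        · field_simp
  have e5 : ∑ a, ∑ b, ∑ c, p a b c = ∑ c, w c := by
    calc _ = ∑ a, ∑ c, ∑ b, p a b c :=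
          Finset.sum_congr rfl fun a _ => Finset.sum_comm
      _ = _ := Finset.sum_comm
  rw [e1, e2, e3, e4, e5, sub_self] at hsum
  linarith

theorem restrict_eq_iff {Ω S : Type*} (F : ℕ → Ω → S) (n : ℕ) (ω ω' : Ω) :
    ((fun i : Fin (n + 1) => F i ω) = fun i : Fin (n + 1) => F i ω') ↔
    ((fun i : Fin n => F i ω) = fun i : Fin n => F i ω') ∧ F n ω = F n ω' := by
  simp only [funext_iff, Fin.forall_iff]
  constructor
  · intro h
    exact ⟨fun i hi => h i (by omega), h n (by omega)⟩
  · rintro ⟨h1, h2⟩ i hi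
    rcases Nat.lt_succ_iff_lt_or_eq.1 hi with h | rfl
    · exact h1 i h
    · exact h2

theorem sum_measureReal_preimage_finset {Ω A : Type*} [MeasurableSpace Ω] [MeasurableSpace A]
    [MeasurableSingletonClass A] (μ : Measure Ω) [IsFiniteMeasure μ] {f : Ω → A}
    (hf : Measurable f) (s : Finset A) :
    ∑ a ∈ s, μ.real (f ⁻¹' {a}) = μ.real {ω | f ω ∈ s} := by
  classical
  rw [← measureReal_biUnion_finset]
  · congr 1
    ext ω
    simp
  · intro a _ a' _ h
    exact Disjoint.preimage _ (by simpa using h)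
  · intro a _
    exact hf (measurableSet_singleton a)

variable {Ω : Type*} [MeasurableSpace Ω] {A B C : Type*} [Fintype A]

/-- Shannon entropy of a finitely valued function. -/
noncomputable def shannon (μ : Measure Ω) (f : Ω → A) : ℝ :=
  ∑ a, negMulLog (μ.real (f ⁻¹' {a}))

theorem shannon_nonneg (μ : Measure Ω) [IsProbabilityMeasure μ] (f : Ω → A) : 0 ≤ shannon μ f :=
  Finset.sum_nonneg fun _ _ => negMulLog_nonneg measureReal_nonneg measureReal_le_one

/-- Entropy of an average, lower bound. -/
theorem le_shannon_average {μ : Measure Ω} {ν : ℕ → Measure Ω} {m : ℕ} (hm : 0 < m) (f : Ω → A)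
    (h : ∀ a, μ.real (f ⁻¹' {a}) = (∑ i ∈ Finset.range m, (ν i).real (f ⁻¹' {a})) / m) :
    (∑ i ∈ Finset.range m, shannon (ν i) f) ≤ m * shannon μ f := by
  have hm' : (0 : ℝ) < m := by exact_mod_cast hm
  simp only [shannon]
  rw [Finset.sum_comm, Finset.mul_sum]
  refine Finset.sum_le_sum fun a _ => ?_
  have := Real.concaveOn_negMulLog.le_map_sum (t := Finset.range m) (w := fun _ => (1 / m : ℝ))
    (p := fun i => (ν i).real (f ⁻¹' {a})) (fun _ _ => by positivity)
    (by simp [hm'.ne']) (fun _ _ => measureReal_nonneg)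
  simp only [smul_eq_mul, ← Finset.mul_sum] at this
  rw [h a, div_eq_inv_mul, ← one_div]
  calc _ = m * ((1 / m : ℝ) * ∑ i ∈ Finset.range m, negMulLog ((ν i).real (f ⁻¹' {a}))) := by
        field_simp
    _ ≤ _ := by gcongr

variable [MeasurableSpace A] [MeasurableSingletonClass A]


theorem measureReal_preimage_comp [DecidableEq B] (μ : Measure Ω) [IsFiniteMeasure μ] {f : Ω → A}
    (hf : Measurable f) (g : A → B) (b : B) :
    μ.real ((fun ω => g (f ω)) ⁻¹' {b}) =
      ∑ a ∈ Finset.univ.filter (fun a => g a = b), μ.real (f ⁻¹' {a}) := by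
  rw [← measureReal_biUnion_finset]
  · congr 1
    ext ω
    simp
  · intro a _ a' _ h
    exact Disjoint.preimage _ (by simpa using h)
  · intro a _
    exact hf (measurableSet_singleton a)

theorem sum_measureReal_preimage (μ : Measure Ω) [IsProbabilityMeasure μ] {f : Ω → A}
    (hf : Measurable f) : ∑ a, μ.real (f ⁻¹' {a}) = 1 := by
  have := measureReal_preimage_comp μ hf (fun _ => ()) ()
  simpa using this.symm

variable [Fintype B]

/-- The entropy of a function that is determined by another one is smaller. -/
theorem shannon_le_of_determined (μ : Measure Ω) [IsProbabilityMeasure μ] {f : Ω → A} {g : Ω → B}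
    (hf : Measurable f) (h : ∀ ω ω', f ω = f ω' → g ω = g ω') : shannon μ g ≤ shannon μ f := by
  classical
  obtain ⟨ω0⟩ : Nonempty Ω := μ.nonempty_of_neZero
  -- Labels that `f` does not take are sent to the filler `g ω0`.
  let e : A → B := fun a => if h : ∃ ω, f ω = a then g h.choose else g ω0
  have he : g = fun ω => e (f ω) := by
    ext ω
    have hex : ∃ ω', f ω' = f ω := ⟨ω, rfl⟩
    simp only [e, dif_pos hex]
    exact h _ _ hex.choose_spec.symm
  rw [he, shannon, shannon]
  simp only [measureReal_preimage_comp μ hf e]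
  rw [← Finset.sum_fiberwise Finset.univ e fun a => negMulLog (μ.real (f ⁻¹' {a}))]
  exact Finset.sum_le_sum fun b _ => negMulLog_sum_le _ fun a => measureReal_nonneg

variable [MeasurableSpace B] [MeasurableSingletonClass B]

theorem shannon_eq_of_determined (μ : Measure Ω) [IsProbabilityMeasure μ] {f : Ω → A} {g : Ω → B}
    (hf : Measurable f) (hg : Measurable g) (h : ∀ ω ω', f ω = f ω' ↔ g ω = g ω') :
    shannon μ g = shannon μ f :=
  le_antisymm (shannon_le_of_determined μ hf fun ω ω' => (h ω ω').1)
    (shannon_le_of_determined μ hg fun ω ω' => (h ω ω').2)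

theorem shannon_submodular [Fintype C] [MeasurableSpace C] [MeasurableSingletonClass C]
    (μ : Measure Ω) [IsProbabilityMeasure μ] {f : Ω → A} {g : Ω → B}
    {h : Ω → C} (hf : Measurable f) (hg : Measurable g) (hh : Measurable h) :
    shannon μ (fun ω => (f ω, g ω, h ω)) + shannon μ h ≤
      shannon μ (fun ω => (f ω, h ω)) + shannon μ (fun ω => (g ω, h ω)) := by
  classical
  have hm : Measurable fun ω => (f ω, g ω, h ω) := by fun_prop
  have key := sum_negMulLog_submodular
    (p := fun a b c => μ.real ((fun ω => (f ω, g ω, h ω)) ⁻¹' {(a, b, c)}))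
    fun _ _ _ => measureReal_nonneg
  have e1 : ∀ a c, μ.real ((fun ω => (f ω, h ω)) ⁻¹' {(a, c)}) =
      ∑ b, μ.real ((fun ω => (f ω, g ω, h ω)) ⁻¹' {(a, b, c)}) := by
    intro a c
    rw [measureReal_preimage_comp μ hm (fun x => (x.1, x.2.2)) (a, c)]
    refine (Finset.sum_bij (fun b _ => (a, b, c)) ?_ ?_ ?_ ?_).symm <;> simp
  have e2 : ∀ b c, μ.real ((fun ω => (g ω, h ω)) ⁻¹' {(b, c)}) =
      ∑ a, μ.real ((fun ω => (f ω, g ω, h ω)) ⁻¹' {(a, b, c)}) := by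
    intro b c
    rw [measureReal_preimage_comp μ hm (fun x => (x.2.1, x.2.2)) (b, c)]
    refine (Finset.sum_bij (fun a _ => (a, b, c)) ?_ ?_ ?_ ?_).symm <;> simp
  have e3 : ∀ c, μ.real (h ⁻¹' {c}) =
      ∑ a, ∑ b, μ.real ((fun ω => (f ω, g ω, h ω)) ⁻¹' {(a, b, c)}) := by
    intro c
    have := measureReal_preimage_comp μ hm (fun x => x.2.2) c
    rw [this, ← Finset.sum_product']
    refine (Finset.sum_bij (fun ab _ => (ab.1, ab.2, c)) ?_ ?_ ?_ ?_).symm <;> simp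
  simp only [shannon, Fintype.sum_prod_type, e1, e2, e3]
  exact key

/-- Strong subadditivity with a trivial conditioning variable. -/
theorem shannon_prod_le (μ : Measure Ω) [IsProbabilityMeasure μ] {f : Ω → A} {g : Ω → B}
    (hf : Measurable f) (hg : Measurable g) :
    shannon μ (fun ω => (f ω, g ω)) ≤ shannon μ f + shannon μ g := by
  have h1 := shannon_submodular μ hf hg (measurable_const (a := ()))
  have h2 : shannon μ (fun _ : Ω => ()) = 0 := by
    simp [shannon]
  have h3 := shannon_eq_of_determined μ (f := fun ω => (f ω, ())) (g := f) (by fun_prop) hf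
    (by simp)
  have h4 := shannon_eq_of_determined μ (f := fun ω => (g ω, ())) (g := g) (by fun_prop) hg
    (by simp)
  have h5 := shannon_eq_of_determined μ (f := fun ω => (f ω, g ω, ()))
    (g := fun ω => (f ω, g ω)) (by fun_prop) (by fun_prop) (by simp)
  linarith

theorem shannon_le_log_card (μ : Measure Ω) [IsProbabilityMeasure μ] {f : Ω → A}
    (hf : Measurable f) (s : Finset A) (hs : ∀ ω, f ω ∈ s) : shannon μ f ≤ log s.card := by
  have h1 := sum_negMulLog_le s (p := fun a => μ.real (f ⁻¹' {a})) fun a => measureReal_nonneg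
  rw [sum_measureReal_preimage_finset μ hf] at h1
  have h2 : {ω | f ω ∈ s} = Set.univ := Set.eq_univ_of_forall hs
  rw [h2, probReal_univ, one_mul, negMulLog_one, add_zero] at h1
  refine le_trans (le_of_eq ?_) h1
  refine (Finset.sum_subset (Finset.subset_univ s) fun a _ ha => ?_).symm
  have : f ⁻¹' {a} = ∅ := by
    ext ω
    simp only [Set.mem_preimage, Set.mem_singleton_iff, Set.mem_empty_iff_false, iff_false]
    rintro rfl
    exact ha (hs ω)
  simp [this]

/-- Splitting the entropy according to whether `f` takes values in `s`. -/
theorem shannon_le_split (μ : Measure Ω) [IsProbabilityMeasure μ] {f : Ω → A}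
    (hf : Measurable f) (s t : Finset A) (hst : ∀ ω, f ω ∉ s → f ω ∈ t) :
    shannon μ f ≤ μ.real {ω | f ω ∈ s} * log s.card + (1 - μ.real {ω | f ω ∈ s}) * log t.card +
      2 := by
  classical
  set P := μ.real {ω | f ω ∈ s} with hP
  have hP0 : 0 ≤ P := measureReal_nonneg
  have hP1 : P ≤ 1 := measureReal_le_one
  have h1 := sum_negMulLog_le s (p := fun a => μ.real (f ⁻¹' {a})) fun a => measureReal_nonneg
  rw [sum_measureReal_preimage_finset μ hf] at h1
  have h2 := sum_negMulLog_le (t \ s) (p := fun a => μ.real (f ⁻¹' {a})) fun a => measureReal_nonneg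
  rw [sum_measureReal_preimage_finset μ hf] at h2
  have h3 : {ω | f ω ∈ t \ s} = (f ⁻¹' s)ᶜ := by
    ext ω
    simp only [Set.mem_ofPred_eq, Finset.mem_sdiff, Set.mem_compl_iff]
    exact ⟨fun h => h.2, fun h => ⟨hst ω h, h⟩⟩
  have h3' : μ.real (f ⁻¹' s) = P := rfl
  rw [h3, probReal_compl_eq_one_sub (hf (Finset.measurableSet s)), h3'] at h2
  have h4 : shannon μ f = ∑ a ∈ s, negMulLog (μ.real (f ⁻¹' {a})) +
      ∑ a ∈ t \ s, negMulLog (μ.real (f ⁻¹' {a})) := by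
    rw [← Finset.sum_union Finset.disjoint_sdiff, shannon]
    refine (Finset.sum_subset (Finset.subset_univ _) fun a _ ha => ?_).symm
    have : f ⁻¹' {a} = ∅ := by
      ext ω
      simp only [Set.mem_preimage, Set.mem_singleton_iff, Set.mem_empty_iff_false, iff_false]
      rintro rfl
      apply ha
      by_cases h : f ω ∈ s
      · simp [h]
      · simp [hst ω h]
    simp [this]
  have h5 : log ((t \ s).card : ℝ) ≤ log t.card := by
    rcases Nat.eq_zero_or_pos (t \ s).card with h | h
    · rw [h, Nat.cast_zero, Real.log_zero]
      exact Real.log_natCast_nonneg _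
    · refine Real.log_le_log (by exact_mod_cast h) ?_
      exact_mod_cast Finset.card_le_card Finset.sdiff_subset
  -- The entropy of the choice between the two sides has two terms, each at most 1; this is the 2 in
  -- the bound.
  have h6 : ∀ x : ℝ, 0 ≤ x → negMulLog x ≤ 1 := by
    intro x hx
    have := mul_log_sub_le hx zero_le_one (by simp)
    rw [Real.log_one, mul_zero] at this
    rw [negMulLog]; linarith
  have h7 := h6 P hP0
  have h8 := h6 (1 - P) (by linarith)
  have h9 : (1 - P) * log ((t \ s).card : ℝ) ≤ (1 - P) * log t.card :=
    mul_le_mul_of_nonneg_left h5 (by linarith)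
  linarith

/-- Entropy of a convex combination, upper bound. -/
theorem shannon_convex_le {μ μ₁ μ₂ : Measure Ω} [IsProbabilityMeasure μ₁] [IsProbabilityMeasure μ₂]
    {a b : ℝ} (ha : 0 ≤ a) (hb : 0 ≤ b) {f : Ω → A} (hf : Measurable f)
    (h : ∀ s, MeasurableSet s → μ.real s = a * μ₁.real s + b * μ₂.real s) :
    shannon μ f ≤ a * shannon μ₁ f + b * shannon μ₂ f + (negMulLog a + negMulLog b) := by
  have h1 : ∀ x, negMulLog (μ.real (f ⁻¹' {x})) ≤
      (a * negMulLog (μ₁.real (f ⁻¹' {x})) + μ₁.real (f ⁻¹' {x}) * negMulLog a) +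
      (b * negMulLog (μ₂.real (f ⁻¹' {x})) + μ₂.real (f ⁻¹' {x}) * negMulLog b) := by
    intro x
    rw [h _ (hf (measurableSet_singleton x))]
    -- Subadditivity separates the two summands; the product rule for `negMulLog` then yields the
    -- mixing terms, which do not depend on `f`.
    have := negMulLog_sum_le Finset.univ
      (p := fun i : Fin 2 => if i = 0 then a * μ₁.real (f ⁻¹' {x}) else b * μ₂.real (f ⁻¹' {x}))
      (fun i => by
        have := measureReal_nonneg (μ := μ₁) (s := f ⁻¹' {x})
        have := measureReal_nonneg (μ := μ₂) (s := f ⁻¹' {x})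
        split_ifs <;> positivity)
    simp only [Fin.sum_univ_two, if_true, one_ne_zero, if_false, negMulLog_mul] at this
    linarith
  have h2 := Finset.sum_le_sum fun x (_ : x ∈ Finset.univ) => h1 x
  simp only [Finset.sum_add_distrib, ← Finset.mul_sum, ← Finset.sum_mul,
    sum_measureReal_preimage _ hf, one_mul] at h2
  simp only [shannon]
  linarith

/-- Conditional entropies are subadditive in the conditioned variables. -/
theorem shannon_pi_prod_le (μ : Measure Ω) [IsProbabilityMeasure μ] {P : ℕ → Ω → A}
    {Q : ℕ → Ω → B} (hP : ∀ i, Measurable (P i)) (hQ : ∀ i, Measurable (Q i)) (n : ℕ) :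
    shannon μ (fun ω => ((fun i : Fin n => P i ω), (fun i : Fin n => Q i ω))) ≤
      shannon μ (fun ω => (fun i : Fin n => Q i ω)) +
        ∑ i ∈ Finset.range n, (shannon μ (fun ω => (P i ω, Q i ω)) - shannon μ (Q i)) := by
  induction n with
  | zero =>
    simp only [Finset.range_zero, Finset.sum_empty, add_zero]
    exact shannon_le_of_determined μ (by fun_prop) fun ω ω' _ => by
      ext i <;> exact i.elim0
  | succ n ih =>
    have mP : ∀ n, Measurable fun ω => (fun i : Fin n => P i ω) := fun n =>
      measurable_pi_lambda _ fun i => hP i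
    have mQ : ∀ n, Measurable fun ω => (fun i : Fin n => Q i ω) := fun n =>
      measurable_pi_lambda _ fun i => hQ i
    -- In conditional form, `s1` splits off `P n` given all of `Q`; `s2` drops `Q n` from the
    -- condition on the earlier `P i`, and `s3` drops the earlier `Q i` from the condition on `P n`.
    -- The equalities `t1` to `t5` only regroup tuples.
    have s1 := shannon_submodular μ (mP n) (hP n) (mQ (n + 1))
    have s2 := shannon_submodular μ (mP n) (hQ n) (mQ n)
    have s3 := shannon_submodular μ (hP n) (mQ n) (hQ n)
    have t1 := shannon_eq_of_determined μ
      (f := fun ω => ((fun i : Fin n => P i ω), P n ω, (fun i : Fin (n + 1) => Q i ω)))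
      (g := fun ω => ((fun i : Fin (n + 1) => P i ω), (fun i : Fin (n + 1) => Q i ω)))
      ((mP n).prodMk ((hP n).prodMk (mQ _))) ((mP _).prodMk (mQ _))
      (fun ω ω' => by simp only [Prod.mk.injEq, restrict_eq_iff P]; tauto)
    have t2 := shannon_eq_of_determined μ
      (f := fun ω => ((fun i : Fin n => P i ω), (fun i : Fin (n + 1) => Q i ω)))
      (g := fun ω => ((fun i : Fin n => P i ω), Q n ω, (fun i : Fin n => Q i ω)))
      ((mP n).prodMk (mQ _)) ((mP _).prodMk ((hQ n).prodMk (mQ n)))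
      (fun ω ω' => by simp only [Prod.mk.injEq, restrict_eq_iff Q]; tauto)
    have t3 := shannon_eq_of_determined μ
      (f := fun ω => (Q n ω, (fun i : Fin n => Q i ω)))
      (g := fun ω => (fun i : Fin (n + 1) => Q i ω))
      ((hQ n).prodMk (mQ n)) (mQ _)
      (fun ω ω' => by simp only [Prod.mk.injEq, restrict_eq_iff Q]; tauto)
    have t4 := shannon_eq_of_determined μ
      (f := fun ω => (P n ω, (fun i : Fin (n + 1) => Q i ω)))
      (g := fun ω => (P n ω, (fun i : Fin n => Q i ω), Q n ω))
      ((hP n).prodMk (mQ _)) ((hP n).prodMk ((mQ n).prodMk (hQ n)))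
      (fun ω ω' => by simp only [Prod.mk.injEq, restrict_eq_iff Q])
    have t5 := shannon_eq_of_determined μ
      (f := fun ω => ((fun i : Fin n => Q i ω), Q n ω))
      (g := fun ω => (fun i : Fin (n + 1) => Q i ω))
      ((mQ n).prodMk (hQ n)) (mQ _)
      (fun ω ω' => by simp only [Prod.mk.injEq, restrict_eq_iff Q])
    rw [Finset.sum_range_succ]
    linarith

end FiniteEntropy

/-! ### Entropy along orbits of a measure preserving map. -/

section BlockEntropy

variable {Ω : Type*} [MeasurableSpace Ω] {A B : Type*} [Fintype A] [Fintype B]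
  [MeasurableSpace A] [MeasurableSingletonClass A] [MeasurableSpace B] [MeasurableSingletonClass B]

theorem tendsto_shannon {μ : Measure Ω} [IsProbabilityMeasure μ] {f : Ω → A} {F : ℕ → Ω → A}
    (hf : Measurable f) (hF : ∀ n, Measurable (F n))
    (h : Tendsto (fun n => μ.real {ω | F n ω ≠ f ω}) atTop (𝓝 0)) :
    Tendsto (fun n => shannon μ (F n)) atTop (𝓝 (shannon μ f)) := by
  refine tendsto_finsetSum _ fun a _ => (Real.continuous_negMulLog.tendsto _).comp ?_
  rw [tendsto_iff_dist_tendsto_zero]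
  refine squeeze_zero (fun _ => dist_nonneg) (fun n => ?_) h
  rw [Real.dist_eq]
  refine (abs_measureReal_sub_le_measureReal_symmDiff
    (hF n (measurableSet_singleton a)).nullMeasurableSet
    (hf (measurableSet_singleton a)).nullMeasurableSet).trans (measureReal_mono ?_)
  rintro ω (⟨h1, h2⟩ | ⟨h1, h2⟩) h3
  · exact h2 (h3.symm.trans h1)
  · exact h2 (h3.trans h1)

/-- The sequence of labels of the first `n` points of an orbit. -/
def itinerary (T : Ω → Ω) (P : Ω → A) (n : ℕ) (x : Ω) : Fin n → A := fun i => P (T^[i] x)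

/-- The entropy of the first `n` labels. -/
noncomputable def blockEntropy (T : Ω → Ω) (μ : Measure Ω) (P : Ω → A) (n : ℕ) : ℝ :=
  shannon μ (itinerary T P n)

theorem partitionEntropy_eq (T : Ω → Ω) (μ : Measure Ω) {k : ℕ} (P : Ω → Fin k) (n : ℕ) :
    partitionEntropy T μ P n = blockEntropy T μ P n := by
  simp only [partitionEntropy, blockEntropy, shannon]
  refine Finset.sum_congr rfl fun a _ => ?_
  congr 2
  ext x
  simp [itinerary, funext_iff]

variable {T : Ω → Ω} {μ : Measure Ω} [IsProbabilityMeasure μ]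

omit [Fintype A] [MeasurableSingletonClass A] in
theorem measurable_itinerary (hT : Measurable T) {P : Ω → A} (hP : Measurable P) (n : ℕ) :
    Measurable (itinerary T P n) :=
  measurable_pi_lambda _ fun i => hP.comp (hT.iterate i)

omit [IsProbabilityMeasure μ] in
theorem shannon_comp_iterate (hT : MeasurePreserving T μ μ) {f : Ω → A} (hf : Measurable f)
    (j : ℕ) : shannon μ (f ∘ T^[j]) = shannon μ f := by
  refine Finset.sum_congr rfl fun a _ => ?_
  rw [Set.preimage_comp, (hT.iterate j).measureReal_preimage
    (hf (measurableSet_singleton a)).nullMeasurableSet]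

omit [MeasurableSpace A] [MeasurableSingletonClass A] in
theorem blockEntropy_nonneg (P : Ω → A) (n : ℕ) : 0 ≤ blockEntropy T μ P n :=
  shannon_nonneg _ _

omit [Fintype A] [MeasurableSpace A] [MeasurableSingletonClass A] [MeasurableSpace Ω] in
theorem itinerary_eq_iff (P : Ω → A) (n : ℕ) (x y : Ω) :
    itinerary T P n x = itinerary T P n y ↔ ∀ i < n, P (T^[i] x) = P (T^[i] y) := by
  simp [itinerary, funext_iff, Fin.forall_iff]

theorem shannon_itinerary_add_le {P : Ω → A} (hT : Measurable T) (hP : Measurable P) (m n : ℕ) :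
    blockEntropy T μ P (m + n) ≤
      blockEntropy T μ P m + shannon μ (itinerary T P n ∘ T^[m]) := by
  have mi := measurable_itinerary hT hP
  refine (shannon_le_of_determined μ
    (f := fun x => (itinerary T P m x, (itinerary T P n ∘ T^[m]) x))
    ((mi m).prodMk ((mi n).comp (hT.iterate m))) fun x y h => ?_).trans
    (shannon_prod_le μ (mi m) ((mi n).comp (hT.iterate m)))
  simp only [Prod.mk.injEq, Function.comp, itinerary_eq_iff, ← Function.iterate_add_apply] at h ⊢
  intro i hi
  rcases lt_or_ge i m with him | him
  · exact h.1 i him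
  · have := h.2 (i - m) (by omega)
    rwa [Nat.sub_add_cancel him] at this

theorem subadditive_blockEntropy (hT : MeasurePreserving T μ μ) {P : Ω → A} (hP : Measurable P) :
    Subadditive (blockEntropy T μ P) := fun m n => by
  refine (shannon_itinerary_add_le hT.measurable hP m n).trans ?_
  rw [shannon_comp_iterate hT (measurable_itinerary hT.measurable hP n)]
  rfl

omit [MeasurableSpace A] [MeasurableSingletonClass A] in
theorem bddBelow_blockEntropy (P : Ω → A) :
    BddBelow (Set.range fun n : ℕ => blockEntropy T μ P n / n) := by
  refine ⟨0, ?_⟩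
  rintro _ ⟨n, rfl⟩
  have := blockEntropy_nonneg (T := T) (μ := μ) P n
  positivity

/-- The finite-time form of `h(P) ≤ h(Q) + H(P | Q)`, by which continuous partitions can replace
measurable ones. -/
theorem blockEntropy_le_add (hT : MeasurePreserving T μ μ) {P : Ω → A} {Q : Ω → B}
    (hP : Measurable P) (hQ : Measurable Q) (n : ℕ) :
    blockEntropy T μ P n ≤ blockEntropy T μ Q n +
      n * (shannon μ (fun x => (P x, Q x)) - shannon μ Q) := by
  have mP : ∀ i, Measurable (P ∘ T^[i]) := fun i => hP.comp (hT.measurable.iterate i)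
  have mQ : ∀ i, Measurable (Q ∘ T^[i]) := fun i => hQ.comp (hT.measurable.iterate i)
  have h1 := shannon_pi_prod_le μ mP mQ n
  have h2 : ∀ i, shannon μ (fun x => ((P ∘ T^[i]) x, (Q ∘ T^[i]) x)) - shannon μ (Q ∘ T^[i]) =
      shannon μ (fun x => (P x, Q x)) - shannon μ Q := fun i => by
    rw [shannon_comp_iterate hT hQ, ← shannon_comp_iterate hT (hP.prodMk hQ) i]
    rfl
  simp only [h2, Finset.sum_const, Finset.card_range, nsmul_eq_mul] at h1
  refine le_trans ?_ h1
  exact shannon_le_of_determined μ ((measurable_itinerary hT.measurable hP n).prodMk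
    (measurable_itinerary hT.measurable hQ n)) fun x y h => (Prod.mk.injEq _ _ _ _ ▸ h).1

end BlockEntropy

/-! ### Kolmogorov–Sinai entropy of a shift as the entropy rate of words. -/

section ShiftEntropy

variable {I : Type} [AddMonoidWithOne I] [Countable I] {q : ℕ} {Y : Subshift (Fin q) I}

theorem isSetAlgebra_isClopen (Z : Type*) [TopologicalSpace Z] :
    IsSetAlgebra {s : Set Z | IsClopen s} :=
  ⟨isClopen_empty, fun _ h => h.compl, fun _ _ h h' => h.union h'⟩

/-- Clopen sets are an algebra generating the Borel sets, hence dense in measure. -/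
theorem exists_isClopen_symmDiff_lt (μ : Measure Y.carrier) [IsFiniteMeasure μ]
    {D : Set Y.carrier} (hD : MeasurableSet D) {ε : ℝ} (hε : 0 < ε) :
    ∃ C : Set Y.carrier, IsClopen C ∧ μ.real (symmDiff D C) < ε := by
  have hb := isTopologicalBasis_isClopen (X := Y.carrier)
  have hgen := hb.borel_eq_generateFrom
  obtain ⟨C, hC, h⟩ := (Measure.MeasureDense.of_generateFrom_isSetAlgebra_finite μ
    (isSetAlgebra_isClopen Y.carrier) (by rw [← hgen]; exact BorelSpace.measurable_eq)).approx D hD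
    (measure_ne_top μ D) ε hε
  refine ⟨C, hC, ?_⟩
  rw [measureReal_def]
  exact (ENNReal.lt_ofReal_iff_toReal_lt (measure_ne_top _ _)).1 h

/-- The symbol at the origin. -/
def letter (Y : Subshift (Fin q) I) (y : Y.carrier) : Fin q := y.1 0

omit [Countable I] in
theorem continuous_letter : Continuous (letter Y) :=
  (continuous_apply 0).comp continuous_subtype_val

theorem measurable_letter : Measurable (letter Y) :=
  continuous_letter.measurable

theorem measurable_shiftMap : Measurable (shiftMap Y) :=
  (continuous_shiftMap Y).measurable

omit [Countable I] in
theorem ofFn_itinerary (n : ℕ) (y : Y.carrier) :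
    List.ofFn (itinerary (shiftMap Y) (letter Y) n y) = wordAt y.1 0 n := by
  rw [wordAt]
  congr 1
  ext i
  simp [itinerary, letter, shiftMap_iterate_apply]

omit [Countable I] in
theorem itinerary_letter_eq_iff (n : ℕ) (y y' : Y.carrier) :
    itinerary (shiftMap Y) (letter Y) n y = itinerary (shiftMap Y) (letter Y) n y' ↔
      wordAt y.1 0 n = wordAt y'.1 0 n := by
  rw [← ofFn_itinerary, ← ofFn_itinerary, List.ofFn_inj]

variable [ShiftIndex I] {μ : Measure Y.carrier} [IsProbabilityMeasure μ]

/-- A continuous partition has at most the entropy of the words. -/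
theorem exists_blockEntropy_le (hT : MeasurePreserving (shiftMap Y) μ μ) {S : Type*} [Fintype S]
    [MeasurableSpace S] [MeasurableSingletonClass S] [TopologicalSpace S] [DiscreteTopology S]
    {Q : Y.carrier → S} (hQ : Continuous Q) (hQm : Measurable Q) :
    ∃ n0 : ℕ, ∀ n, blockEntropy (shiftMap Y) μ Q n ≤
      blockEntropy (shiftMap Y) μ (letter Y) (n + n0) := by
  obtain ⟨j, n0, -, h⟩ := exists_word_determines hQ
  refine ⟨n0, fun n => ?_⟩
  rw [blockEntropy, ← shannon_comp_iterate hT (measurable_itinerary hT.measurable hQm n) j]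
  refine shannon_le_of_determined μ (measurable_itinerary hT.measurable measurable_letter _)
    fun y y' hyy => ?_
  rw [itinerary_letter_eq_iff, wordAt_eq_iff] at hyy
  simp only [Function.comp]
  rw [itinerary_eq_iff]
  intro i hi
  rw [← Function.iterate_add_apply, ← Function.iterate_add_apply, add_comm i j,
    Function.iterate_add_apply, Function.iterate_add_apply]
  apply h
  rw [wordAt_iterate, wordAt_iterate, wordAt_eq_iff]
  intro k hk
  have := hyy (i + k) (by omega)
  simpa using this

omit [ShiftIndex I] in
theorem tendsto_blockEntropy (hT : MeasurePreserving (shiftMap Y) μ μ) :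
    Tendsto (fun n : ℕ => blockEntropy (shiftMap Y) μ (letter Y) n / n) atTop
      (𝓝 (subadditive_blockEntropy hT measurable_letter).lim) :=
  (subadditive_blockEntropy hT measurable_letter).tendsto_lim (bddBelow_blockEntropy _)

omit [ShiftIndex I] in
/-- Any finite partition is approximated by continuous ones. -/
theorem exists_continuous_conditional_lt {k : ℕ} {P : Y.carrier → Fin k} (hP : Measurable P)
    {η : ℝ} (hη : 0 < η) : ∃ Q : Y.carrier → Fin k → Bool, Continuous Q ∧
      shannon μ (fun x => (P x, Q x)) - shannon μ Q < η := by
  classical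
  have happ : ∀ (m : ℕ) (a : Fin k), ∃ C : Set Y.carrier, IsClopen C ∧
      μ.real (symmDiff (P ⁻¹' {a}) C) < 1 / ((m : ℝ) + 1) := fun m a =>
    exists_isClopen_symmDiff_lt μ (hP (measurableSet_singleton a)) (by positivity)
  choose C hC hCμ using happ
  -- Membership in each clopen approximant is recorded separately, so the approximants need not be
  -- disjoint. The exact version `Q'` determines `P`; hence `H(P | Q m)` tends to `H(P | Q') = 0`.
  let Q : ℕ → Y.carrier → Fin k → Bool := fun m y a => (C m a).boolIndicator y
  let Q' : Y.carrier → Fin k → Bool := fun y a => (P ⁻¹' {a}).boolIndicator y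
  have hQc : ∀ m, Continuous (Q m) := fun m =>
    continuous_pi fun a => (continuous_boolIndicator_iff_isClopen _).2 (hC m a)
  have hQm : ∀ m, Measurable (Q m) := fun m => (hQc m).measurable
  have hQ'eq : Q' = (fun b a => decide (b = a)) ∘ P := by
    ext y a
    simp [Q', Set.boolIndicator]
  have hQ'm : Measurable Q' := by
    rw [hQ'eq]
    exact (measurable_of_finite _).comp hP
  have hzero : Tendsto (fun m => μ.real {y | Q m y ≠ Q' y}) atTop (𝓝 0) := by
    have h1 : Tendsto (fun m : ℕ => (k : ℝ) * (1 / ((m : ℝ) + 1))) atTop (𝓝 (k * 0)) :=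
      tendsto_one_div_add_atTop_nhds_zero_nat.const_mul _
    rw [mul_zero] at h1
    refine squeeze_zero (fun _ => measureReal_nonneg) (fun m => ?_) h1
    have hsub : {y | Q m y ≠ Q' y} ⊆ ⋃ a ∈ (Finset.univ : Finset (Fin k)),
        symmDiff (P ⁻¹' {a}) (C m a) := by
      intro y hy
      obtain ⟨a, ha⟩ := Function.ne_iff.1 hy
      simp only [Set.mem_iUnion]
      refine ⟨a, Finset.mem_univ a, ?_⟩
      by_contra hcon
      apply ha
      simp only [Q, Q', Set.boolIndicator]
      rw [Set.mem_symmDiff] at hcon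
      by_cases h1 : y ∈ C m a <;> by_cases h2 : y ∈ P ⁻¹' {a} <;> simp_all
    refine (measureReal_mono hsub (measure_ne_top _ _)).trans ((measureReal_biUnion_finset_le _ _).trans ?_)
    calc _ ≤ ∑ a : Fin k, 1 / ((m : ℝ) + 1) := Finset.sum_le_sum fun a _ => (hCμ m a).le
      _ = _ := by simp
  have t1 : Tendsto (fun m => shannon μ (Q m)) atTop (𝓝 (shannon μ Q')) :=
    tendsto_shannon hQ'm hQm hzero
  have t2 : Tendsto (fun m => shannon μ (fun x => (P x, Q m x))) atTop
      (𝓝 (shannon μ (fun x => (P x, Q' x)))) := by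
    refine tendsto_shannon (hP.prodMk hQ'm) (fun m => hP.prodMk (hQm m)) ?_
    simpa using hzero
  have h0 : shannon μ (fun x => (P x, Q' x)) = shannon μ Q' := by
    refine shannon_eq_of_determined μ hQ'm (hP.prodMk hQ'm) fun x y => ?_
    simp only [Prod.mk.injEq]
    refine ⟨fun h => ⟨?_, h⟩, fun h => h.2⟩
    rw [hQ'eq] at h
    have := congrFun h (P x)
    simpa [eq_comm] using this
  have t3 := t2.sub t1
  rw [h0, sub_self] at t3
  obtain ⟨m, hm⟩ := (t3.eventually_lt_const hη).exists
  exact ⟨Q m, hQc m, hm⟩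

/-- The Kolmogorov–Sinai entropy of the shift is the entropy rate of words. -/
theorem measureEntropy_eq_lim (hT : MeasurePreserving (shiftMap Y) μ μ) :
    measureEntropy (shiftMap Y) μ =
      (((subadditive_blockEntropy hT measurable_letter).lim : ℝ) : EReal) := by
  set L := (subadditive_blockEntropy hT measurable_letter).lim with hL
  have hlim := tendsto_blockEntropy hT
  apply le_antisymm
  · refine iSup_le fun k => iSup_le fun P => iSup_le fun hP => ?_
    refine le_of_forall_gt_imp_ge_of_dense fun c hc => ?_
    obtain ⟨c', hc1, hc2⟩ := EReal.lt_iff_exists_real_btwn.1 hc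
    rw [EReal.coe_lt_coe_iff] at hc1
    -- Half of the room `c' - L` pays for `H(P | Q)`; the other half absorbs the `n0` extra letters
    -- after division by `n`.
    obtain ⟨Q, hQ, hlt⟩ := exists_continuous_conditional_lt (μ := μ) hP
      (η := (c' - L) / 2) (by linarith)
    obtain ⟨n0, hn0⟩ := exists_blockEntropy_le hT hQ hQ.measurable
    refine le_trans ?_ hc2.le
    have hb : Tendsto (fun n : ℕ => blockEntropy (shiftMap Y) μ (letter Y) n / n +
        blockEntropy (shiftMap Y) μ (letter Y) n0 / n + (c' - L) / 2) atTop
        (𝓝 (L + 0 + (c' - L) / 2)) :=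
      (hlim.add (tendsto_const_nhds.div_atTop tendsto_natCast_atTop_atTop)).add_const _
    have hev := hb.eventually_lt_const (u := c') (by linarith)
    refine limsup_le_of_le (by isBoundedDefault) ?_
    filter_upwards [hev, eventually_gt_atTop 0] with n hn hpos
    rw [EReal.coe_le_coe_iff]
    refine le_trans ?_ hn.le
    have hpos' : (0 : ℝ) < n := by exact_mod_cast hpos
    have h1 := blockEntropy_le_add hT hP hQ.measurable n
    have h2 := hn0 n
    have h3 := subadditive_blockEntropy hT measurable_letter n n0
    have h4 : n * (shannon μ (fun x => (P x, Q x)) - shannon μ Q) ≤ n * ((c' - L) / 2) :=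
      mul_le_mul_of_nonneg_left hlt.le hpos'.le
    rw [partitionEntropy_eq, ← add_div, div_add' _ _ _ hpos'.ne', div_le_div_iff_of_pos_right hpos']
    linarith
  · refine le_iSup_of_le q (le_iSup_of_le (letter Y) (le_iSup_of_le measurable_letter ?_))
    have h1 : Tendsto (fun n : ℕ => ((partitionEntropy (shiftMap Y) μ (letter Y) n / n : ℝ) : EReal))
        atTop (𝓝 (L : EReal)) := by
      simp only [partitionEntropy_eq]
      exact (continuous_coe_real_ereal.tendsto _).comp hlim
    exact h1.limsup_eq.ge

omit [Countable I] [ShiftIndex I] in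
theorem exists_finset_words (Y : Subshift (Fin q) I) (n : ℕ) (E : Set (List (Fin q))) :
    ∃ s : Finset (Fin n → Fin q), (∀ a, a ∈ s ↔ List.ofFn a ∈ wordsOfLength Y n ∩ E) ∧
      s.card = (wordsOfLength Y n ∩ E).ncard := by
  classical
  refine ⟨Finset.univ.filter fun a => List.ofFn a ∈ wordsOfLength Y n ∩ E, by simp, ?_⟩
  rw [← Set.ncard_coe_finset]
  rw [← Set.ncard_image_of_injective _ (List.ofFn_injective (α := Fin q) (n := n))]
  congr 1
  ext w
  simp only [Finset.coe_filter, Finset.mem_univ, true_and, Set.mem_image, Set.mem_ofPred_eq]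
  constructor
  · rintro ⟨a, ha, rfl⟩
    exact ha
  · intro hw
    have hl : w.length = n := hw.1.2
    subst hl
    exact ⟨w.get, by rwa [List.ofFn_get], List.ofFn_get w⟩

omit [ShiftIndex I] in
theorem blockEntropy_le_log_wordCount (n : ℕ) :
    blockEntropy (shiftMap Y) μ (letter Y) n ≤ Real.log (wordCount Y n) := by
  obtain ⟨s, hs, hcard⟩ := exists_finset_words Y n Set.univ
  rw [Set.inter_univ] at hcard
  have := shannon_le_log_card μ (measurable_itinerary measurable_shiftMap measurable_letter n) s
    fun y => (hs _).2 (by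
      rw [ofFn_itinerary]
      exact ⟨⟨wordAt_mem_language Y y _ _, by simp⟩, trivial⟩)
  rwa [hcard] at this

omit [ShiftIndex I] in
theorem lim_blockEntropy_le (hT : MeasurePreserving (shiftMap Y) μ μ) :
    (subadditive_blockEntropy hT measurable_letter).lim ≤ topEntropy Y :=
  le_of_tendsto_of_tendsto' (tendsto_blockEntropy hT) (tendsto_topEntropy Y) fun n => by
    have := blockEntropy_le_log_wordCount (μ := μ) n
    gcongr

end ShiftEntropy

/-! ### Entropy of long words against short ones, and uniform measures. -/

section Limits

variable {Ω : Type*} [MeasurableSpace Ω] {A : Type*} [Fintype A] [MeasurableSpace A]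
  [MeasurableSingletonClass A] {T : Ω → Ω} {μ : Measure Ω} [IsProbabilityMeasure μ]

theorem shannon_itinerary_le {f : Ω → Ω} (hT : Measurable T) (hf : Measurable f) {P : Ω → A}
    (hP : Measurable P) (n : ℕ) :
    shannon μ (itinerary T P n ∘ f) ≤ n * Real.log (Fintype.card A) := by
  have := shannon_le_log_card μ ((measurable_itinerary hT hP n).comp hf) Finset.univ
    fun _ => Finset.mem_univ _
  rwa [Finset.card_univ, Fintype.card_fun, Fintype.card_fin, Nat.cast_pow, Real.log_pow] at this

theorem shannon_itinerary_mul_le {P : Ω → A} (hT : Measurable T) (hP : Measurable P) (n j a : ℕ) :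
    shannon μ (itinerary T P (a * n) ∘ T^[j]) ≤
      ∑ b ∈ Finset.range a, shannon μ (itinerary T P n ∘ T^[j + b * n]) := by
  have mi := fun n i => (measurable_itinerary hT hP n).comp (hT.iterate i)
  induction a with
  | zero =>
    have h : ∀ k, k = 0 → shannon μ (itinerary T P k ∘ T^[j]) ≤ 0 := by
      rintro k rfl
      simpa using shannon_itinerary_le (μ := μ) hT (hT.iterate j) hP 0
    simpa using h _ (zero_mul n)
  | succ a ih =>
    rw [Finset.sum_range_succ]
    refine le_trans ?_ (add_le_add_left ih _)
    refine (shannon_le_of_determined μ ((mi (a * n) j).prodMk (mi n (j + a * n)))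
      fun x y h => ?_).trans (shannon_prod_le μ (mi _ _) (mi _ _))
    simp only [Prod.mk.injEq, Function.comp, itinerary_eq_iff, ← Function.iterate_add_apply] at h ⊢
    intro i hi
    rcases lt_or_ge i (a * n) with him | him
    · exact h.1 i him
    · have := h.2 (i - a * n) (by rw [Nat.succ_mul] at hi; omega)
      rwa [show i - a * n + (j + a * n) = i + j by omega] at this

theorem sum_sum_range_mul (f : ℕ → ℝ) (n a : ℕ) :
    ∑ j ∈ Finset.range n, ∑ b ∈ Finset.range a, f (j + b * n) =
      ∑ i ∈ Finset.range (a * n), f i := by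
  induction a with
  | zero => simp
  | succ a ih =>
    simp only [Finset.sum_range_succ, Finset.sum_add_distrib]
    rw [ih, Nat.succ_mul, Finset.sum_range_add]
    simp [add_comm]

/-- Comparison of the entropy of words of length `m` with that of the words of length `n` at the
positions below `m`. -/
theorem mul_blockEntropy_le_sum {P : Ω → A} (hT : Measurable T) (hP : Measurable P) {n : ℕ}
    (hn : 0 < n) (m : ℕ) :
    n * blockEntropy T μ P m ≤ ∑ i ∈ Finset.range m, shannon μ (itinerary T P n ∘ T^[i]) +
      2 * n * (n * Real.log (Fintype.card A)) := by
  set f : ℕ → ℝ := fun i => shannon μ (itinerary T P n ∘ T^[i]) with hf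
  set c := (n : ℝ) * Real.log (Fintype.card A) with hc
  have hlog : 0 ≤ Real.log (Fintype.card A : ℝ) := Real.log_natCast_nonneg _
  -- With this many blocks of length `n`, the stretch `[0, m)` is covered from any offset.
  set a := m / n + 1 with ha
  have ham : m ≤ a * n := by
    rw [ha, Nat.succ_mul]
    have := Nat.div_add_mod m n
    have := Nat.mod_lt m hn
    rw [mul_comm]; omega
  have ham' : a * n ≤ m + n := by
    rw [ha, Nat.succ_mul]
    have := Nat.div_mul_le_self m n
    omega
  -- For each offset `j < n`, cover `[0, m)` by `j` single letters and `a` blocks of length `n`.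
  -- Summing over `j` uses each starting position below `a * n` exactly once.
  have h1 : ∀ j ∈ Finset.range n, blockEntropy T μ P m ≤
      c + ∑ b ∈ Finset.range a, f (j + b * n) := by
    intro j hj
    have hj' := Finset.mem_range.1 hj
    have e1 : blockEntropy T μ P m ≤ blockEntropy T μ P (j + a * n) :=
      shannon_le_of_determined μ (measurable_itinerary hT hP _) fun x y h => by
        rw [itinerary_eq_iff] at h ⊢
        exact fun i hi => h i (by omega)
    have e2 := shannon_itinerary_add_le (μ := μ) hT hP j (a * n)
    have e3 := shannon_itinerary_mul_le (μ := μ) hT hP n j a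
    have e4 := shannon_itinerary_le (μ := μ) hT measurable_id hP j
    have e5 : (j : ℝ) * Real.log (Fintype.card A) ≤ c := by
      rw [hc]; gcongr
    have e6 : shannon μ (itinerary T P j ∘ id) = blockEntropy T μ P j := rfl
    rw [e6] at e4
    linarith
  have h2 := Finset.sum_le_sum h1
  rw [Finset.sum_const, Finset.card_range, nsmul_eq_mul, Finset.sum_add_distrib,
    sum_sum_range_mul, Finset.sum_const, Finset.card_range, nsmul_eq_mul] at h2
  -- At most `n` starting positions lie beyond `m`, at cost `c` each; with the initial letters the
  -- error is `2 n c`.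
  have h3 : ∑ i ∈ Finset.range (a * n), f i ≤ ∑ i ∈ Finset.range m, f i + n * c := by
    rw [← Nat.add_sub_cancel' ham, Finset.sum_range_add]
    gcongr
    calc ∑ x ∈ Finset.range (a * n - m), f (m + x) ≤ ∑ x ∈ Finset.range (a * n - m), c :=
          Finset.sum_le_sum fun i _ => shannon_itinerary_le hT (hT.iterate _) hP n
      _ = ((a * n - m : ℕ) : ℝ) * c := by simp
      _ ≤ n * c := by
        gcongr
        omega
  linarith

/-- The uniform distribution on a set. -/
noncomputable def uniformMeasure (P : Set Ω) : Measure Ω :=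
  (P.ncard : ℝ≥0∞)⁻¹ • Measure.sum (fun x : P => Measure.dirac (x : Ω))

theorem uniformMeasure_apply {P : Set Ω} (hP : P.Finite) {s : Set Ω} (hs : MeasurableSet s) :
    uniformMeasure P s = (P.ncard : ℝ≥0∞)⁻¹ * (P ∩ s).ncard := by
  classical
  rw [uniformMeasure, Measure.smul_apply, Measure.sum_apply _ hs, smul_eq_mul]
  congr 1
  have := hP.fintype
  rw [tsum_fintype]
  simp only [Measure.dirac_apply' _ hs, Set.indicator_apply, Pi.one_apply]
  rw [Finset.sum_boole, ← Set.ncard_coe_finset,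
    ← Set.ncard_image_of_injective _ (Subtype.val_injective (p := (· ∈ P)))]
  congr 2
  ext x
  simp [and_comm]

theorem isProbabilityMeasure_uniformMeasure {P : Set Ω} (hP : P.Finite) (hne : P.Nonempty) :
    IsProbabilityMeasure (uniformMeasure P) := by
  refine ⟨?_⟩
  rw [uniformMeasure_apply hP MeasurableSet.univ, Set.inter_univ]
  have := (Set.ncard_pos hP).2 hne
  exact ENNReal.inv_mul_cancel (by positivity) (ENNReal.natCast_ne_top _)

theorem uniformMeasure_real {P : Set Ω} (hP : P.Finite) {s : Set Ω} (hs : MeasurableSet s) :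
    (uniformMeasure P).real s = (P ∩ s).ncard / P.ncard := by
  rw [measureReal_def, uniformMeasure_apply hP hs]
  simp [div_eq_inv_mul]

/-- If the fibres of `f` on `P` have at most `b` elements then `f` has entropy at least
`log #P - log b`. -/
theorem le_shannon_uniformMeasure {P : Set Ω} (hP : P.Finite) (hne : P.Nonempty) {f : Ω → A}
    (hf : Measurable f) {b : ℕ} (hb : 0 < b) (h : ∀ a, (P ∩ f ⁻¹' {a}).ncard ≤ b) :
    Real.log P.ncard - Real.log b ≤ shannon (uniformMeasure P) f := by
  have := isProbabilityMeasure_uniformMeasure hP hne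
  have hN : (0 : ℝ) < P.ncard := by exact_mod_cast (Set.ncard_pos hP).2 hne
  have hb' : (0 : ℝ) < b := by exact_mod_cast hb
  rw [← one_mul (Real.log P.ncard - Real.log b), ← sum_measureReal_preimage (uniformMeasure P) hf,
    Finset.sum_mul]
  refine Finset.sum_le_sum fun a _ => ?_
  rw [uniformMeasure_real hP (hf (measurableSet_singleton a)), Real.negMulLog]
  rcases Nat.eq_zero_or_pos (P ∩ f ⁻¹' {a}).ncard with h0 | h0
  · simp [h0]
  · have h0' : (0 : ℝ) < (P ∩ f ⁻¹' {a}).ncard := by exact_mod_cast h0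
    rw [Real.log_div h0'.ne' hN.ne', neg_mul, ← mul_neg, neg_sub]
    have := Real.log_le_log h0' (show ((P ∩ f ⁻¹' {a}).ncard : ℝ) ≤ b by exact_mod_cast h a)
    gcongr

end Limits

/-! ### Existence and characterization of measures of maximal entropy. -/

section Existence

variable {I : Type} [AddMonoidWithOne I] [Countable I] {q : ℕ} {Y : Subshift (Fin q) I}

omit [Countable I] in
theorem continuous_itinerary_letter (n : ℕ) :
    Continuous (itinerary (shiftMap Y) (letter Y) n) :=
  continuous_pi fun _ => continuous_letter.comp ((continuous_shiftMap Y).iterate _)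

theorem tendsto_measureReal_of_isClopen {Z ι : Type*} [TopologicalSpace Z] [MeasurableSpace Z]
    [OpensMeasurableSpace Z] [HasOuterApproxClosed Z] {F : Filter ι}
    {ν : ι → ProbabilityMeasure Z} {μ : ProbabilityMeasure Z} (h : Tendsto ν F (𝓝 μ)) {C : Set Z}
    (hC : IsClopen C) :
    Tendsto (fun i => (ν i : Measure Z).real C) F (𝓝 ((μ : Measure Z).real C)) := by
  have := ProbabilityMeasure.tendsto_measure_of_null_frontier_of_tendsto' h (E := C)
    (by rw [hC.frontier_eq, measure_empty])
  exact (ENNReal.tendsto_toReal (measure_ne_top _ _)).comp this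

theorem ext_of_isClopen {μ ν : Measure Y.carrier} [IsProbabilityMeasure μ] [IsProbabilityMeasure ν]
    (h : ∀ C, IsClopen C → μ C = ν C) : μ = ν := by
  have hb := isTopologicalBasis_isClopen (X := Y.carrier)
  refine ext_of_generate_finite {s : Set Y.carrier | IsClopen s} ?_ ?_ h (by simp)
  · rw [← hb.borel_eq_generateFrom]
    exact BorelSpace.measurable_eq
  · intro s hs t ht _
    exact hs.inter ht

/-- A limit of asymptotically invariant measures of asymptotically maximal entropy is invariant and
has maximal entropy. -/
theorem measurePreserving_and_le_of_tendsto {F : Filter ℕ} [F.NeBot]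
    {ν : ℕ → ProbabilityMeasure Y.carrier} {μ : ProbabilityMeasure Y.carrier}
    (hν : Tendsto ν F (𝓝 μ))
    (hinv : ∀ s, MeasurableSet s → Tendsto (fun m => (ν m : Measure Y.carrier).real
      (shiftMap Y ⁻¹' s) - (ν m : Measure Y.carrier).real s) F (𝓝 0)) {h : ℝ}
    (hent : ∀ n : ℕ, 0 < n → ∀ ε > 0, ∀ᶠ m in F,
      n * h - ε ≤ blockEntropy (shiftMap Y) (ν m) (letter Y) n) :
    MeasurePreserving (shiftMap Y) (μ : Measure Y.carrier) μ ∧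
      ∀ n : ℕ, n * h ≤ blockEntropy (shiftMap Y) μ (letter Y) n := by
  constructor
  · refine ⟨measurable_shiftMap, ?_⟩
    have := Measure.isProbabilityMeasure_map (μ := (μ : Measure Y.carrier))
      (measurable_shiftMap (Y := Y)).aemeasurable
    refine ext_of_isClopen fun C hC => ?_
    rw [Measure.map_apply measurable_shiftMap hC.1.measurableSet]
    have h1 := tendsto_measureReal_of_isClopen hν hC
    have h2 := tendsto_measureReal_of_isClopen hν (hC.preimage (continuous_shiftMap Y))
    have h3 := tendsto_nhds_unique (h2.sub h1) (hinv C hC.1.measurableSet)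
    exact (measureReal_eq_measureReal_iff).1 (sub_eq_zero.1 h3)
  · intro n
    rcases Nat.eq_zero_or_pos n with rfl | hn
    · simpa using blockEntropy_nonneg (T := shiftMap Y) (μ := (μ : Measure Y.carrier)) (letter Y) 0
    -- Cylinders are clopen, so the entropy of `n` letters is continuous in the measure.
    have h1 : Tendsto (fun m => blockEntropy (shiftMap Y) (ν m) (letter Y) n) F
        (𝓝 (blockEntropy (shiftMap Y) μ (letter Y) n)) := by
      refine tendsto_finsetSum _ fun a _ => (Real.continuous_negMulLog.tendsto _).comp ?_
      exact tendsto_measureReal_of_isClopen hν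
        ((isClopen_discrete {a}).preimage (continuous_itinerary_letter n))
    refine le_of_forall_pos_le_add fun ε hε => ?_
    have := ge_of_tendsto h1 (hent n hn ε hε)
    linarith

/-- There is an invariant measure whose words of length `n` have entropy at least `n h`. -/
theorem exists_measurePreserving_le_blockEntropy (hY : Y.carrier.Nonempty) :
    ∃ μ : ProbabilityMeasure Y.carrier, MeasurePreserving (shiftMap Y) (μ : Measure Y.carrier) μ ∧
      ∀ n : ℕ, n * topEntropy Y ≤ blockEntropy (shiftMap Y) μ (letter Y) n := by
  set T := shiftMap Y with hT
  have mT : Measurable T := measurable_shiftMap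
  have hrep : ∀ w ∈ language Y, ∃ y : Y.carrier, wordAt y.1 0 w.length = w :=
    fun w hw => exists_of_mem_language hw
  have : Nonempty Y.carrier := hY.to_subtype
  choose! r hr using hrep
  -- One point for each word of length `m`, so that the uniform measure has `m`-block entropy at
  -- least `log #L_m ≥ m h`.
  let P : ℕ → Set Y.carrier := fun m => r '' wordsOfLength Y m
  have hPfin : ∀ m, (P m).Finite := fun m => (finite_wordsOfLength Y m).image r
  have hPne : ∀ m, (P m).Nonempty := fun m =>
    ((Set.ncard_pos (finite_wordsOfLength Y m)).1 (wordCount_pos hY m)).image r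
  have hcard : ∀ m, (P m).ncard = wordCount Y m := fun m => by
    refine Set.InjOn.ncard_image fun w hw w' hw' h => ?_
    rw [← hr w hw.1, ← hr w' hw'.1, hw.2, hw'.2, h]
  have hprob := fun m => isProbabilityMeasure_uniformMeasure (hPfin m) (hPne m)
  have hent : ∀ m, Real.log (wordCount Y m) ≤
      blockEntropy T (uniformMeasure (P m)) (letter Y) m := fun m => by
    have := le_shannon_uniformMeasure (hPfin m) (hPne m)
      (measurable_itinerary mT measurable_letter m) one_pos fun a => by
        rw [Set.ncard_le_one ((hPfin m).inter_of_left _)]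
        rintro _ ⟨⟨w, hw, rfl⟩, hwa⟩ _ ⟨⟨w', hw', rfl⟩, hwa'⟩
        have := hwa.trans hwa'.symm
        rw [itinerary_letter_eq_iff] at this
        rw [← hr w hw.1, ← hr w' hw'.1, hw.2, hw'.2, this]
    rwa [hcard, Nat.cast_one, Real.log_one, sub_zero] at this
  -- Averaging over the first images makes the measures asymptotically invariant; `m + 1` keeps the
  -- denominator nonzero.
  have hθ : ∀ m : ℕ, ∃ ν : ProbabilityMeasure Y.carrier, ∀ s, MeasurableSet s →
      (ν : Measure Y.carrier).real s = (∑ i ∈ Finset.range (m + 1),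
        ((uniformMeasure (P (m + 1))).map T^[i]).real s) / ((m + 1 : ℕ) : ℝ) := by
    intro m
    have hp := fun i => Measure.isProbabilityMeasure_map (μ := uniformMeasure (P (m + 1)))
      (mT.iterate i).aemeasurable
    refine ⟨⟨((m + 1 : ℕ) : ℝ≥0∞)⁻¹ • ∑ i ∈ Finset.range (m + 1),
      (uniformMeasure (P (m + 1))).map T^[i], ⟨?_⟩⟩, fun s hs => ?_⟩
    · rw [Measure.smul_apply, Measure.finsetSum_apply]
      simp only [measure_univ, Finset.sum_const, Finset.card_range, nsmul_eq_mul, mul_one,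
        smul_eq_mul]
      exact ENNReal.inv_mul_cancel (by simp) (ENNReal.natCast_ne_top _)
    · simp only [ProbabilityMeasure.coe_mk, measureReal_def, Measure.smul_apply,
        Measure.finsetSum_apply, smul_eq_mul, ENNReal.toReal_mul, ENNReal.toReal_inv,
        ENNReal.toReal_natCast]
      rw [ENNReal.toReal_sum fun i _ => measure_ne_top _ _, div_eq_inv_mul]
  choose ν hν using hθ
  -- Compactness of the space of probability measures gives a limit along the ultrafilter without a
  -- choice of subsequence.
  let U : Ultrafilter ℕ := Ultrafilter.of atTop
  have hU : (U : Filter ℕ) ≤ atTop := Ultrafilter.of_le atTop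
  obtain ⟨μ, -, hμ⟩ := (isCompact_univ (X := ProbabilityMeasure Y.carrier)).ultrafilter_le_nhds
    (U.map ν) (by simp)
  refine ⟨μ, measurePreserving_and_le_of_tendsto (F := (U : Filter ℕ)) (ν := ν) hμ ?_ ?_⟩
  · intro s hs
    refine Tendsto.mono_left ?_ hU
    have hz : Tendsto (fun m : ℕ => 1 / ((m : ℝ) + 1)) atTop (𝓝 0) :=
      tendsto_one_div_add_atTop_nhds_zero_nat
    refine squeeze_zero_norm (fun m => ?_) hz
    rw [hν m _ (mT hs), hν m _ hs, ← sub_div]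
    set g : ℕ → ℝ := fun i => ((uniformMeasure (P (m + 1))).map T^[i]).real s with hg
    have hg' : ∀ i, ((uniformMeasure (P (m + 1))).map T^[i]).real (T ⁻¹' s) = g (i + 1) := by
      intro i
      simp only [hg]
      rw [map_measureReal_apply (mT.iterate i) (mT hs), map_measureReal_apply (mT.iterate _) hs,
        Function.iterate_succ', Set.preimage_comp]
    simp only [hg']
    -- The sum telescopes to a difference of two probabilities.
    rw [← Finset.sum_sub_distrib, Finset.sum_range_sub, norm_div, Real.norm_eq_abs, Real.norm_eq_abs]
    have h0 : ∀ i, 0 ≤ g i ∧ g i ≤ 1 := fun i => by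
      have := Measure.isProbabilityMeasure_map (μ := uniformMeasure (P (m + 1)))
        (mT.iterate i).aemeasurable
      exact ⟨measureReal_nonneg, measureReal_le_one⟩
    have h1 : |g (m + 1) - g 0| ≤ 1 := by
      rw [abs_le]
      constructor <;> linarith [(h0 0).1, (h0 0).2, (h0 (m + 1)).1, (h0 (m + 1)).2]
    rw [Nat.cast_succ, abs_of_pos (by positivity : (0 : ℝ) < (m : ℝ) + 1)]
    gcongr
  · intro n hn ε hε
    set c := 2 * (n : ℝ) * (n * Real.log (Fintype.card (Fin q)))
    have hz : Tendsto (fun m : ℕ => c * (1 / ((m : ℝ) + 1))) atTop (𝓝 (c * 0)) :=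
      tendsto_one_div_add_atTop_nhds_zero_nat.const_mul c
    rw [mul_zero] at hz
    refine hU ?_
    filter_upwards [hz.eventually_lt_const hε] with m hm
    have h1 := mul_blockEntropy_le_sum (μ := uniformMeasure (P (m + 1))) mT
      (measurable_letter (Y := Y)) hn (m + 1)
    have h2 : ∑ i ∈ Finset.range (m + 1), shannon (uniformMeasure (P (m + 1)))
        (itinerary T (letter Y) n ∘ T^[i]) ≤
        ((m + 1 : ℕ) : ℝ) * blockEntropy T (ν m) (letter Y) n := by
      have h3 := le_shannon_average (μ := (ν m : Measure Y.carrier))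
        (ν := fun i => (uniformMeasure (P (m + 1))).map T^[i]) (m := m + 1) m.succ_pos
        (itinerary T (letter Y) n) fun a => hν m _
          (measurable_itinerary mT measurable_letter n (measurableSet_singleton a))
      refine le_trans (le_of_eq ?_) h3
      refine Finset.sum_congr rfl fun i _ => Finset.sum_congr rfl fun a _ => ?_
      rw [map_measureReal_apply (mT.iterate i)
        (measurable_itinerary mT measurable_letter n (measurableSet_singleton a)),
        Set.preimage_comp]
    have h4 := mul_topEntropy_le Y (m + 1)
    have h5 := hent (m + 1)
    have h6 : (n : ℝ) * (((m + 1 : ℕ) : ℝ) * topEntropy Y) ≤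
        ((m + 1 : ℕ) : ℝ) * blockEntropy T (ν m) (letter Y) n + c := by
      have : (n : ℝ) * (((m + 1 : ℕ) : ℝ) * topEntropy Y) ≤
          n * blockEntropy T (uniformMeasure (P (m + 1))) (letter Y) (m + 1) := by
        gcongr; exact h4.trans h5
      linarith
    have hm' : (0 : ℝ) < (m : ℝ) + 1 := by positivity
    rw [mul_one_div, div_lt_iff₀ hm'] at hm
    push_cast at h6
    by_contra hcon
    rw [not_le] at hcon
    nlinarith

/-- By subadditivity the entropy rate is the infimum of the averages, so a lower bound for it is one
for every `n`. -/
theorem lim_eq_topEntropy_iff {μ : Measure Y.carrier} [IsProbabilityMeasure μ]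
    (hT : MeasurePreserving (shiftMap Y) μ μ) :
    topEntropy Y ≤ (subadditive_blockEntropy hT measurable_letter).lim ↔
      ∀ n : ℕ, n * topEntropy Y ≤ blockEntropy (shiftMap Y) μ (letter Y) n := by
  constructor
  · intro h n
    rcases Nat.eq_zero_or_pos n with rfl | hn
    · simpa using blockEntropy_nonneg (T := shiftMap Y) (μ := μ) (letter Y) 0
    have h1 := (subadditive_blockEntropy hT measurable_letter).lim_le_div
      (bddBelow_blockEntropy _) hn.ne'
    have hn' : (0 : ℝ) < n := by exact_mod_cast hn
    rw [le_div_iff₀ hn'] at h1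
    nlinarith
  · intro h
    refine ge_of_tendsto (tendsto_blockEntropy hT) ?_
    filter_upwards [eventually_gt_atTop 0] with n hn
    have hn' : (0 : ℝ) < n := by exact_mod_cast hn
    rw [le_div_iff₀ hn', mul_comm]
    exact h n

variable [ShiftIndex I]

/-- The measures of maximal entropy are the invariant measures for which words of length `n` have
entropy at least `n h`. -/
theorem isMME_iff (hY : Y.carrier.Nonempty) (μ : ProbabilityMeasure Y.carrier) :
    IsMME (shiftMap Y) μ ↔ MeasurePreserving (shiftMap Y) (μ : Measure Y.carrier) μ ∧
      ∀ n : ℕ, n * topEntropy Y ≤ blockEntropy (shiftMap Y) μ (letter Y) n := by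
  constructor
  · rintro ⟨hT, hmax⟩
    refine ⟨hT, (lim_eq_topEntropy_iff hT).1 ?_⟩
    -- A measure of entropy `h` exists, so a maximal one has entropy at least `h`.
    obtain ⟨ν, hν, hνe⟩ := exists_measurePreserving_le_blockEntropy hY
    have h1 := hmax ν hν
    rw [measureEntropy_eq_lim hT, measureEntropy_eq_lim hν, EReal.coe_le_coe_iff] at h1
    exact ((lim_eq_topEntropy_iff hν).2 hνe).trans h1
  · rintro ⟨hT, he⟩
    refine ⟨hT, fun ν hν => ?_⟩
    rw [measureEntropy_eq_lim hT, measureEntropy_eq_lim hν, EReal.coe_le_coe_iff]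
    exact (lim_blockEntropy_le hν).trans ((lim_eq_topEntropy_iff hT).2 he)

end Existence

/-! ### Measures of maximal entropy are not mutually singular. -/

section Uniqueness

variable {I : Type} [AddMonoidWithOne I] [Countable I] {q : ℕ} {Y : Subshift (Fin q) I}

/-- A measure of maximal entropy cannot give large measure to few words. -/
theorem le_ncard_of_half_le {C : ℝ} (hC : 1 ≤ C)
    (hcount : ∀ n : ℕ, (wordCount Y n : ℝ) ≤ C * Real.exp (n * topEntropy Y))
    (hY : Y.carrier.Nonempty) {μ : Measure Y.carrier} [IsProbabilityMeasure μ] {n : ℕ}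
    (hμ : n * topEntropy Y ≤ blockEntropy (shiftMap Y) μ (letter Y) n) {E : Set (List (Fin q))}
    (hE : 1 / 2 ≤ μ.real {y | wordAt y.1 0 n ∈ E}) :
    Real.exp (-(2 * (Real.log C + 2))) * Real.exp (n * topEntropy Y) ≤
      (wordsOfLength Y n ∩ E).ncard := by
  obtain ⟨s, hs, hscard⟩ := exists_finset_words Y n E
  obtain ⟨t, ht, htcard⟩ := exists_finset_words Y n Set.univ
  rw [Set.inter_univ] at htcard
  change t.card = wordCount Y n at htcard
  have hmem : ∀ y : Y.carrier, wordAt y.1 0 n ∈ wordsOfLength Y n := fun y =>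
    ⟨wordAt_mem_language Y y _ _, by simp⟩
  have h1 := shannon_le_split μ (measurable_itinerary measurable_shiftMap measurable_letter n) s t
    fun y _ => (ht _).2 (by rw [ofFn_itinerary]; exact ⟨hmem y, trivial⟩)
  have h2 : {y : Y.carrier | itinerary (shiftMap Y) (letter Y) n y ∈ s} =
      {y | wordAt y.1 0 n ∈ E} := by
    ext y
    simp only [Set.mem_ofPred_eq, hs, ofFn_itinerary]
    exact ⟨fun h => h.2, fun h => ⟨hmem y, h⟩⟩
  rw [h2, htcard] at h1
  set P := μ.real {y : Y.carrier | wordAt y.1 0 n ∈ E} with hP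
  have hP1 : P ≤ 1 := measureReal_le_one
  have hlogC : 0 ≤ Real.log C := Real.log_nonneg hC
  have h3 : Real.log (wordCount Y n) ≤ Real.log C + n * topEntropy Y := by
    rw [← Real.log_exp (n * topEntropy Y), ← Real.log_mul (by positivity) (by positivity)]
    exact Real.log_le_log (by exact_mod_cast wordCount_pos hY n) (hcount n)
  have hspos : 0 < s.card := by
    rw [Finset.card_pos]
    by_contra hne
    rw [Finset.not_nonempty_iff_eq_empty] at hne
    have : {y : Y.carrier | wordAt y.1 0 n ∈ E} = ∅ := by
      rw [← h2, hne]; simp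
    rw [hP, this, measureReal_empty] at hE
    norm_num at hE
  change n * topEntropy Y ≤ shannon μ _ at hμ
  rw [hscard] at h1 hspos
  set N := (wordsOfLength Y n ∩ E).ncard
  have hspos' : (0 : ℝ) < N := by exact_mod_cast hspos
  rw [← Real.exp_add, ← Real.le_log_iff_exp_le hspos']
  have h4 : (1 - P) * Real.log (wordCount Y n) ≤ (1 - P) * (Real.log C + n * topEntropy Y) :=
    mul_le_mul_of_nonneg_left h3 (by linarith)
  -- Splitting gave `nh ≤ P log N + (1 - P)(log C + nh) + 2`. As `P ≥ 1/2`, dividing by `P` at most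
  -- doubles `log C + 2`, whence the constant in the statement.
  have h5 : P * (n * topEntropy Y - Real.log N) ≤ Real.log C + 2 := by
    nlinarith [mul_nonneg (by linarith : (0 : ℝ) ≤ P) hlogC]
  by_contra hcon
  push Not at hcon
  have h6 : 2 * (Real.log C + 2) < n * topEntropy Y - Real.log N := by linarith
  nlinarith

theorem measureReal_wordAt_eq {μ : Measure Y.carrier}
    (hT : MeasurePreserving (shiftMap Y) μ μ) (i l : ℕ) (A : Set (List (Fin q))) :
    μ.real {y | wordAt y.1 (i : I) l ∈ A} = μ.real {y | wordAt y.1 0 l ∈ A} := by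
  have h1 : {y : Y.carrier | wordAt y.1 (i : I) l ∈ A} =
      (shiftMap Y)^[i] ⁻¹' {y | wordAt y.1 0 l ∈ A} := by
    ext y
    simp only [Set.mem_preimage, Set.mem_ofPred_eq]
    rw [wordAt_iterate, add_zero]
  have h2 : {y : Y.carrier | wordAt y.1 0 l ∈ A} =
      itinerary (shiftMap Y) (letter Y) l ⁻¹' {a | List.ofFn a ∈ A} := by
    ext y
    simp only [Set.mem_preimage, Set.mem_ofPred_eq, ofFn_itinerary]
  rw [h1, (hT.iterate i).measureReal_preimage]
  rw [h2]
  exact (measurable_itinerary hT.measurable measurable_letter l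
    (Set.toFinite _).measurableSet).nullMeasurableSet

/-- Measurable sets are approximated, up to a shift, by words. -/
theorem exists_words_symmDiff_lt [ShiftIndex I] {μ : Measure Y.carrier} [IsFiniteMeasure μ]
    {D : Set Y.carrier} (hD : MeasurableSet D) {ε : ℝ} (hε : 0 < ε) :
    ∃ (C : Set Y.carrier) (j l : ℕ) (A : Set (List (Fin q))), MeasurableSet C ∧
      μ.real (symmDiff D C) < ε ∧
      {y : Y.carrier | wordAt y.1 0 l ∈ A} = (shiftMap Y)^[j] ⁻¹' C := by
  obtain ⟨C, hC, hlt⟩ := exists_isClopen_symmDiff_lt μ hD hε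
  obtain ⟨j, l, -, h⟩ := exists_word_determines
    ((continuous_boolIndicator_iff_isClopen C).2 hC)
  refine ⟨C, j, l, {w | ∃ y : Y.carrier, wordAt y.1 0 l = w ∧ (shiftMap Y)^[j] y ∈ C},
    hC.1.measurableSet, hlt, ?_⟩
  ext y
  simp only [Set.mem_ofPred_eq, Set.mem_preimage]
  constructor
  · rintro ⟨y', h1, h2⟩
    rw [Set.mem_iff_boolIndicator] at h2 ⊢
    rw [← h2, h y y' h1.symm]
  · exact fun hy => ⟨y, rfl, hy⟩

/-- One clopen set approximates `D` for `μ₁ + μ₂`, hence for both measures; invariance undoes the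
shift needed to describe it by words. -/
theorem exists_words_separating [ShiftIndex I] {μ₁ μ₂ : Measure Y.carrier}
    [IsProbabilityMeasure μ₁] [IsProbabilityMeasure μ₂] (h₁ : MeasurePreserving (shiftMap Y) μ₁ μ₁)
    (h₂ : MeasurePreserving (shiftMap Y) μ₂ μ₂) {D : Set Y.carrier} (hD : MeasurableSet D)
    (hD₁ : μ₁ Dᶜ = 0) (hD₂ : μ₂ D = 0) {ε : ℝ} (hε : 0 < ε) :
    ∃ (l : ℕ) (A : Set (List (Fin q))), μ₁.real {y | wordAt y.1 0 l ∈ Aᶜ} ≤ ε ∧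
      μ₂.real {y | wordAt y.1 0 l ∈ A} ≤ ε := by
  obtain ⟨C, j, l, A, hC, hlt, hA⟩ := exists_words_symmDiff_lt (μ := μ₁ + μ₂) hD hε
  have hle : ∀ μ : Measure Y.carrier, IsProbabilityMeasure μ → μ ≤ μ₁ + μ₂ → ∀ s t : Set Y.carrier,
      μ s = 0 → t ⊆ s ∪ symmDiff D C → μ.real t ≤ ε := by
    intro μ _ hμ s t hs ht
    refine (measureReal_mono ht).trans ((measureReal_union_le _ _).trans ?_)
    have e1 : μ.real s = 0 := by rw [measureReal_def, hs, ENNReal.toReal_zero]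
    have e2 : μ.real (symmDiff D C) ≤ (μ₁ + μ₂).real (symmDiff D C) :=
      ENNReal.toReal_mono (measure_ne_top _ _) (hμ _)
    linarith
  refine ⟨l, A, ?_, ?_⟩
  · have : {y : Y.carrier | wordAt y.1 0 l ∈ Aᶜ} = (shiftMap Y)^[j] ⁻¹' Cᶜ := by
      rw [Set.preimage_compl, ← hA]; rfl
    rw [this, (h₁.iterate j).measureReal_preimage hC.compl.nullMeasurableSet]
    refine hle μ₁ inferInstance (Measure.le_add_right le_rfl) Dᶜ _ hD₁ fun y hy => ?_
    by_cases hyD : y ∈ D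
    · exact Or.inr (Or.inl ⟨hyD, hy⟩)
    · exact Or.inl hyD
  · rw [hA, (h₂.iterate j).measureReal_preimage hC.nullMeasurableSet]
    refine hle μ₂ inferInstance (Measure.le_add_left le_rfl) D _ hD₂ fun y hy => ?_
    by_cases hyD : y ∈ D
    · exact Or.inl hyD
    · exact Or.inr (Or.inr ⟨hy, hyD⟩)

theorem take_drop_append_left {A : Type*} {u v : List A} {a l : ℕ} (h : a + l ≤ u.length) :
    ((u ++ v).drop a).take l = (u.drop a).take l := by
  rw [List.drop_append_of_le_length (by omega), List.take_append_of_le_length (by simp; omega)]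

theorem take_drop_append_right {A : Type*} {u v : List A} {a l : ℕ} :
    ((u ++ v).drop (u.length + a)).take l = (v.drop a).take l := by
  rw [List.drop_append, List.drop_eq_nil_of_le (by omega), Nat.add_sub_cancel_left, List.nil_append]

omit [Countable I] in
/-- Counting words that switch from a set `S₁ a` to a set `S₂ a` at position `a D`: the switching
positions are recognizable from `A`. -/
theorem sum_switch_le {J A : Set (List (Fin q))} {g l D K N : ℕ}
    (hg : ∀ a ∈ J, ∀ b ∈ J, ∃ y, y.length ≤ g ∧ a ++ y ++ b ∈ language Y)
    (hD : g + l ≤ D) (hN : N = K * D + g + l)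
    {S₁ S₂ : ℕ → Finset (List (Fin q))} (h₁J : ∀ a, ∀ w ∈ S₁ a, w ∈ J)
    (h₂J : ∀ a, ∀ w ∈ S₂ a, w ∈ J) (h₁l : ∀ a, ∀ w ∈ S₁ a, w.length = a * D)
    (h₂l : ∀ a, ∀ w ∈ S₂ a, w.length = N - a * D - g)
    (h₁A : ∀ a, ∀ w ∈ S₁ a, ∀ b < a, (w.drop (b * D + g)).take l ∈ A)
    (h₂A : ∀ a, ∀ w ∈ S₂ a, ∀ s ≤ g, (w.drop s).take l ∉ A) :
    ∑ a ∈ Finset.range K, (S₁ a).card * (S₂ a).card ≤ wordCount Y N * (g + 1) := by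
  classical
  choose! y hy hyL using hg
  have hKD : ∀ a < K, a * D + D ≤ K * D := fun a ha => by
    rw [← Nat.succ_mul]; exact Nat.mul_le_mul_right _ ha
  have hext : ∀ a u v, ∃ z, a < K → u ∈ S₁ a → v ∈ S₂ a →
      u ++ y u v ++ v ++ z ∈ wordsOfLength Y N := by
    intro a u v
    by_cases h : a < K ∧ u ∈ S₁ a ∧ v ∈ S₂ a
    · obtain ⟨ha, hu, hv⟩ := h
      have e1 := hy u (h₁J a u hu) v (h₂J a v hv)
      have e2 := h₁l a u hu
      have e3 := h₂l a v hv
      have e4 := hKD a ha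
      obtain ⟨z, hz, hzl⟩ := exists_extension (hyL u (h₁J a u hu) v (h₂J a v hv)) (n := N)
        (by simp only [List.length_append]; omega)
      exact ⟨z, fun _ _ _ => ⟨hz, hzl⟩⟩
    · exact ⟨[], fun h1 h2 h3 => (h ⟨h1, h2, h3⟩).elim⟩
  choose z hz using hext
  -- The glued word, padded to length `N`, and the length of its bridge determine the switching
  -- position and both pieces.
  have hcard : ((Finset.range K).sigma fun a => S₁ a ×ˢ S₂ a).card ≤
      ((finite_wordsOfLength Y N).toFinset ×ˢ Finset.range (g + 1)).card := by
    refine Finset.card_le_card_of_injOn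
      (fun x : Σ _ : ℕ, List (Fin q) × List (Fin q) =>
        (x.2.1 ++ y x.2.1 x.2.2 ++ x.2.2 ++ z x.1 x.2.1 x.2.2, (y x.2.1 x.2.2).length)) ?_ ?_
    · rintro ⟨a, u, v⟩ hx
      simp only [Finset.coe_sigma, Set.mem_sigma_iff, Finset.mem_coe, Finset.mem_range,
        Finset.mem_product] at hx
      simp only [Finset.coe_product, Set.mem_prod, Finset.mem_coe, Set.Finite.mem_toFinset,
        Finset.mem_range]
      exact ⟨hz a u v hx.1 hx.2.1 hx.2.2,
        Nat.lt_succ_of_le (hy u (h₁J a u hx.2.1) v (h₂J a v hx.2.2))⟩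
    -- Inspect the window of length `l` at `a * D + g`. In the word switching at `b` it lies in the
    -- first piece, because `g + l ≤ D`, and belongs to `A`. In the word switching at `a` the bridge
    -- is already over, and the window starts at most `g` letters into the second piece, so it is
    -- not in `A`.
    · have key : ∀ a b u v u' v', a < b → b < K → u ∈ S₁ a → v ∈ S₂ a → u' ∈ S₁ b → v' ∈ S₂ b →
          u ++ y u v ++ v ++ z a u v ≠ u' ++ y u' v' ++ v' ++ z b u' v' := by
        intro a b u v u' v' hab hb hu hv hu' hv' heq
        have e1 := hy u (h₁J a u hu) v (h₂J a v hv)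
        have e2 := h₁l a u hu
        have e3 := h₂l a v hv
        have e4 := hKD a (hab.trans hb)
        have e5 := h₁l b u' hu'
        have e6 : a * D + D ≤ b * D := by
          rw [← Nat.succ_mul]; exact Nat.mul_le_mul_right _ hab
        have i1 := h₁A b u' hu' a hab
        have i2 := h₂A a v hv (g - (y u v).length) (by omega)
        have j1 : ((u' ++ y u' v' ++ v' ++ z b u' v').drop (a * D + g)).take l =
            (u'.drop (a * D + g)).take l := by
          rw [List.append_assoc, List.append_assoc, take_drop_append_left (by omega)]
        have j2 : ((u ++ y u v ++ v ++ z a u v).drop (a * D + g)).take l =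
            (v.drop (g - (y u v).length)).take l := by
          have : a * D + g = (u ++ y u v).length + (g - (y u v).length) := by
            rw [List.length_append]; omega
          rw [this, List.append_assoc (u ++ y u v), take_drop_append_right,
            take_drop_append_left (by omega)]
        rw [heq, j1] at j2
        rw [j2] at i1
        exact i2 i1
      rintro ⟨a, u, v⟩ hx ⟨b, u', v'⟩ hx' heq
      simp only [Finset.coe_sigma, Set.mem_sigma_iff, Finset.mem_coe, Finset.mem_range,
        Finset.mem_product] at hx hx'
      simp only [Prod.mk.injEq] at heq
      rcases lt_trichotomy a b with hab | rfl | hab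
      · exact (key a b u v u' v' hab hx'.1 hx.2.1 hx.2.2 hx'.2.1 hx'.2.2 heq.1).elim
      · obtain ⟨heq1, heq2⟩ := heq
        simp only [List.append_assoc] at heq1
        obtain ⟨h1, h2⟩ := List.append_inj heq1
          ((h₁l a u hx.2.1).trans (h₁l a u' hx'.2.1).symm)
        obtain ⟨h3, h4⟩ := List.append_inj h2 heq2
        have h5 := (List.append_inj h4 ((h₂l a v hx.2.2).trans (h₂l a v' hx'.2.2).symm)).1
        subst h1 h5
        rfl
      · exact (key b a u' v' u v hab hx.1 hx'.2.1 hx'.2.2 hx.2.1 hx.2.2 heq.1.symm).elim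
  rw [Finset.card_sigma, Finset.card_product, Finset.card_range,
    ← Set.ncard_eq_toFinset_card _ (finite_wordsOfLength Y N)] at hcard
  simp only [Finset.card_product] at hcard
  exact hcard

omit [Countable I] in
theorem half_le_of_union {μ : Measure Y.carrier} [IsProbabilityMeasure μ] {S : Set Y.carrier}
    {t : Finset ℕ} {B : ℕ → Set Y.carrier} {ε : ℝ} {K : ℕ} (ht : t.card ≤ K)
    (hε : ε = 1 / (2 * (K + 1))) (hS : Sᶜ ⊆ ⋃ b ∈ t, B b) (hB : ∀ b ∈ t, μ.real (B b) ≤ ε) :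
    1 / 2 ≤ μ.real S := by
  have h1 : μ.real Sᶜ ≤ ∑ b ∈ t, μ.real (B b) :=
    (measureReal_mono hS (measure_ne_top _ _)).trans (measureReal_biUnion_finset_le _ _)
  have h2 : ∑ b ∈ t, μ.real (B b) ≤ t.card * ε := by
    simpa using Finset.sum_le_sum hB
  have h3 : (t.card : ℝ) * ε ≤ 1 / 2 := by
    have : (t.card : ℝ) ≤ K := by exact_mod_cast ht
    rw [hε, mul_one_div, div_le_div_iff₀ (by positivity) (by norm_num)]
    linarith
  have h4 : 1 ≤ μ.real S + μ.real Sᶜ := by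
    rw [← probReal_univ (μ := μ), ← Set.union_compl_self S]
    exact measureReal_union_le _ _
  linarith

/-- Two measures of maximal entropy are never mutually singular. -/
theorem HasJoinableWords.not_mutuallySingular [ShiftIndex I] (hJ : HasJoinableWords Y)
    (hY : Y.carrier.Nonempty) {μ₁ μ₂ : Measure Y.carrier}
    [IsProbabilityMeasure μ₁] [IsProbabilityMeasure μ₂] (h₁ : MeasurePreserving (shiftMap Y) μ₁ μ₁)
    (h₂ : MeasurePreserving (shiftMap Y) μ₂ μ₂)
    (he₁ : ∀ n : ℕ, n * topEntropy Y ≤ blockEntropy (shiftMap Y) μ₁ (letter Y) n)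
    (he₂ : ∀ n : ℕ, n * topEntropy Y ≤ blockEntropy (shiftMap Y) μ₂ (letter Y) n)
    {D : Set Y.carrier} (hD : MeasurableSet D) (hD₁ : μ₁ Dᶜ = 0) (hD₂ : μ₂ D = 0) : False := by
  obtain ⟨C, hC1, hC⟩ := hJ.exists_wordCount_le hY
  set η := topEntropy Y with hη
  set c := Real.exp (-(2 * (Real.log C + 2))) with hc
  have hcpos : 0 < c := Real.exp_pos _
  -- Sets of words of mass at least 1/2 have at least `c e^(nη)` elements; half of that survives
  -- intersection with `J`.
  obtain ⟨J, g, hbad, hg⟩ := hJ (c / 2) (by positivity)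
  -- `K` switching positions give at least `K (c/2)^2 e^((N-g)η)` pairs, while at most `C e^(Nη) (g
  -- + 1)` are possible.
  obtain ⟨K, hK⟩ := exists_nat_gt (C * (g + 1) * Real.exp (g * η) / (c / 2) ^ 2)
  -- At most `K + g + 1` windows are tested under either measure, so all tests succeed with
  -- probability at least 1/2.
  set ε : ℝ := 1 / (2 * (((K + g + 1 : ℕ) : ℝ) + 1)) with hε
  obtain ⟨l, A, hA₁, hA₂⟩ := exists_words_separating h₁ h₂ hD hD₁ hD₂ (ε := ε) (by positivity)
  set d := g + l with hd
  set N := K * d + g + l with hN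
  -- `A` is the test for `μ₁`: first pieces pass it at every earlier candidate position, and second
  -- pieces fail it at each of the `g + 1` offsets that a bridge can produce.
  let E₁ : ℕ → Set (List (Fin q)) := fun a => {w | ∀ b < a, (w.drop (b * d + g)).take l ∈ A}
  let E₂ : Set (List (Fin q)) := {w | ∀ s ≤ g, (w.drop s).take l ∉ A}
  let S₁ : ℕ → Set (List (Fin q)) := fun a => (wordsOfLength Y (a * d) ∩ E₁ a) ∩ J
  let S₂ : ℕ → Set (List (Fin q)) := fun a => (wordsOfLength Y (N - a * d - g) ∩ E₂) ∩ J
  have hf₁ : ∀ a, (S₁ a).Finite := fun a =>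
    ((finite_wordsOfLength Y _).inter_of_left _).inter_of_left _
  have hf₂ : ∀ a, (S₂ a).Finite := fun a =>
    ((finite_wordsOfLength Y _).inter_of_left _).inter_of_left _
  have hcount := sum_switch_le (J := J) (A := A) (K := K) hg le_rfl hN
    (S₁ := fun a => (hf₁ a).toFinset) (S₂ := fun a => (hf₂ a).toFinset)
    (fun a w hw => ((hf₁ a).mem_toFinset.1 hw).2) (fun a w hw => ((hf₂ a).mem_toFinset.1 hw).2)
    (fun a w hw => ((hf₁ a).mem_toFinset.1 hw).1.1.2)
    (fun a w hw => ((hf₂ a).mem_toFinset.1 hw).1.1.2)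
    (fun a w hw => ((hf₁ a).mem_toFinset.1 hw).1.2)
    (fun a w hw => ((hf₂ a).mem_toFinset.1 hw).1.2)
  simp only [← Set.ncard_eq_toFinset_card] at hcount
  have b₁ : ∀ a < K, c / 2 * Real.exp (((a * d : ℕ) : ℝ) * η) ≤ (S₁ a).ncard := by
    intro a ha
    have hhalf : 1 / 2 ≤ μ₁.real {y | wordAt y.1 0 (a * d) ∈ E₁ a} := by
      refine half_le_of_union (t := Finset.range a) (K := K + g + 1)
        (B := fun b => {y | wordAt y.1 ((b * d + g : ℕ) : I) l ∈ Aᶜ}) (by simp; omega) hε ?_ ?_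
      · intro y hy
        simp only [E₁, Set.mem_compl_iff, Set.mem_ofPred_eq, not_forall] at hy
        obtain ⟨b, hb, hbA⟩ := hy
        have : b * d + d ≤ a * d := by
          rw [← Nat.succ_mul]; exact Nat.mul_le_mul_right _ hb
        rw [window_wordAt _ _ (by omega), zero_add] at hbA
        simp only [Set.mem_iUnion]
        exact ⟨b, Finset.mem_range.2 hb, hbA⟩
      · intro b _
        rw [measureReal_wordAt_eq h₁]
        exact hA₁
    have e1 := le_ncard_of_half_le hC1 hC hY (he₁ _) hhalf
    have e2 := ncard_le_of_bad_le (Y := Y) (E := wordsOfLength Y (a * d) ∩ E₁ a)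
      Set.inter_subset_left (hbad (a * d))
    linarith
  have b₂ : ∀ a < K, c / 2 * Real.exp (((N - a * d - g : ℕ) : ℝ) * η) ≤ (S₂ a).ncard := by
    intro a ha
    have hle : a * d + d ≤ K * d := by
      rw [← Nat.succ_mul]; exact Nat.mul_le_mul_right _ ha
    have hhalf : 1 / 2 ≤ μ₂.real {y | wordAt y.1 0 (N - a * d - g) ∈ E₂} := by
      refine half_le_of_union (t := Finset.range (g + 1)) (K := K + g + 1)
        (B := fun s => {y | wordAt y.1 (s : I) l ∈ A}) (by simp) hε ?_ ?_
      · intro y hy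
        simp only [E₂, Set.mem_compl_iff, Set.mem_ofPred_eq, not_forall, not_not] at hy
        obtain ⟨s, hs, hsA⟩ := hy
        rw [window_wordAt _ _ (by omega), zero_add] at hsA
        simp only [Set.mem_iUnion]
        exact ⟨s, Finset.mem_range.2 (by omega), hsA⟩
      · intro b _
        rw [measureReal_wordAt_eq h₂]
        exact hA₂
    have e1 := le_ncard_of_half_le hC1 hC hY (he₂ _) hhalf
    have e2 := ncard_le_of_bad_le (Y := Y) (E := wordsOfLength Y (N - a * d - g) ∩ E₂)
      Set.inter_subset_left (hbad (N - a * d - g))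
    linarith
  have hsum : (K : ℝ) * ((c / 2) ^ 2 * (Real.exp (N * η) / Real.exp (g * η))) ≤
      ∑ a ∈ Finset.range K, ((S₁ a).ncard : ℝ) * (S₂ a).ncard := by
    have : ∀ a ∈ Finset.range K, (c / 2) ^ 2 * (Real.exp (N * η) / Real.exp (g * η)) ≤
        ((S₁ a).ncard : ℝ) * (S₂ a).ncard := by
      intro a ha
      have ha' := Finset.mem_range.1 ha
      have hle : a * d + d ≤ K * d := by
        rw [← Nat.succ_mul]; exact Nat.mul_le_mul_right _ ha'
      refine le_trans (le_of_eq ?_) (mul_le_mul (b₁ a ha') (b₂ a ha') (by positivity)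
        (by positivity))
      rw [← Real.exp_sub]
      have : (N : ℝ) * η - g * η = ((a * d : ℕ) : ℝ) * η + ((N - a * d - g : ℕ) : ℝ) * η := by
        rw [← add_mul, ← Nat.cast_add, ← sub_mul, ← Nat.cast_sub (by omega)]
        congr 2; omega
      rw [this, Real.exp_add]
      ring
    simpa using Finset.sum_le_sum this
  have hcount' : ∑ a ∈ Finset.range K, ((S₁ a).ncard : ℝ) * (S₂ a).ncard ≤
      C * Real.exp (N * η) * (g + 1) := by
    have e1 : ∑ a ∈ Finset.range K, ((S₁ a).ncard : ℝ) * (S₂ a).ncard ≤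
        (wordCount Y N : ℝ) * (g + 1) := by exact_mod_cast hcount
    refine e1.trans ?_
    gcongr
    exact hC N
  have hfinal := hsum.trans hcount'
  rw [div_lt_iff₀ (by positivity)] at hK
  have e3 : (K : ℝ) * ((c / 2) ^ 2 * (Real.exp (N * η) / Real.exp (g * η))) =
      (K * (c / 2) ^ 2) * (Real.exp (N * η) / Real.exp (g * η)) := by ring
  have e4 : C * Real.exp (N * η) * (g + 1) =
      (C * (g + 1) * Real.exp (g * η)) * (Real.exp (N * η) / Real.exp (g * η)) := by
    field_simp
  rw [e3, e4] at hfinal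
  exact absurd (le_of_mul_le_mul_right hfinal (by positivity)) (not_le.2 hK)

end Uniqueness

/-! ### Conditioning on invariant sets. -/

section Conditioning

variable {Ω : Type*} [MeasurableSpace Ω] {T : Ω → Ω}

open ProbabilityTheory in
theorem measurePreserving_cond {μ : Measure Ω} (hT : MeasurePreserving T μ μ) {D : Set Ω}
    (hD : MeasurableSet D) (hDT : T ⁻¹' D =ᵐ[μ] D) : MeasurePreserving T μ[|D] μ[|D] := by
  refine ⟨hT.measurable, Measure.ext fun s hs => ?_⟩
  rw [Measure.map_apply hT.measurable hs, cond_apply hD, cond_apply hD]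
  congr 1
  rw [← hT.measure_preimage (hD.inter hs).nullMeasurableSet, Set.preimage_inter]
  exact measure_congr (hDT.symm.inter (ae_eq_refl _))

/-- Two different invariant measures are separated by an invariant set. -/
theorem exists_invariant_of_ne {μ₁ μ₂ : Measure Ω} [IsProbabilityMeasure μ₁]
    [IsProbabilityMeasure μ₂] (h₁ : MeasurePreserving T μ₁ μ₁) (h₂ : MeasurePreserving T μ₂ μ₂)
    (hne : μ₁ ≠ μ₂) : ∃ D, MeasurableSet D ∧ T ⁻¹' D =ᵐ[μ₁] D ∧ T ⁻¹' D =ᵐ[μ₂] D ∧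
      μ₁ D ≠ 0 ∧ μ₂ Dᶜ ≠ 0 := by
  set ν := μ₁ + μ₂ with hν
  have hνT : MeasurePreserving T ν ν := by
    refine ⟨h₁.measurable, ?_⟩
    rw [hν, Measure.map_add _ _ h₁.measurable, h₁.map_eq, h₂.map_eq]
  have hle₁ : μ₁ ≤ ν := Measure.le_add_right le_rfl
  have hle₂ : μ₂ ≤ ν := Measure.le_add_left le_rfl
  have hac : μ₁ ≪ ν := Measure.absolutelyContinuous_of_le hle₁
  set f := μ₁.rnDeriv ν with hf
  have hfT : f ∘ T =ᵐ[ν] f := h₁.rnDeriv_comp_aeEq hνT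
  -- `f` is the density of `μ₁` in `μ₁ + μ₂`, so `μ₂ ≤ μ₁` on `D` and `μ₁ ≤ μ₂` off `D`. If `D` were
  -- null for `μ₁`, then `μ₁ ≤ μ₂` everywhere and equal total mass would force equality;
  -- symmetrically for `Dᶜ` and `μ₂`.
  set D := {x | 2⁻¹ < f x} with hDdef
  have hD : MeasurableSet D := measurableSet_lt measurable_const (Measure.measurable_rnDeriv _ _)
  have hDT : T ⁻¹' D =ᵐ[ν] D := by
    filter_upwards [hfT] with x hx
    apply propext
    change 2⁻¹ < (f ∘ T) x ↔ 2⁻¹ < f x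
    rw [hx]
  have hint : ∀ s, ∫⁻ x in s, f x ∂ν = μ₁ s := fun s => Measure.setLIntegral_rnDeriv hac s
  have hup : ∀ s, MeasurableSet s → μ₁ (s ∩ Dᶜ) ≤ 2⁻¹ * ν (s ∩ Dᶜ) := fun s hs => by
    rw [← hint, ← setLIntegral_const]
    exact setLIntegral_mono' (hs.inter hD.compl) fun x hx => not_lt.1 hx.2
  have hlow : ∀ s, MeasurableSet s → 2⁻¹ * ν (s ∩ D) ≤ μ₁ (s ∩ D) := fun s hs => by
    rw [← hint, ← setLIntegral_const]
    exact setLIntegral_mono' (hs.inter hD) fun x hx => hx.2.le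
  have htwo : ∀ x : ℝ≥0∞, 2 * (2⁻¹ * x) = x := fun x => by
    rw [← mul_assoc, ENNReal.mul_inv_cancel (by norm_num) (by norm_num), one_mul]
  refine ⟨D, hD, hDT.filter_mono (ae_mono hle₁), hDT.filter_mono (ae_mono hle₂), fun h0 => hne ?_,
    fun h0 => hne ?_⟩
  · refine Measure.eq_of_le_of_measure_univ_eq (Measure.le_iff.2 fun s hs => ?_) (by simp)
    have e1 : μ₁ (s ∩ Dᶜ) = μ₁ s := by
      rw [← Set.sdiff_eq]; exact measure_sdiff_null h0
    have e2 := mul_le_mul_right (hup s hs) 2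
    rw [htwo, e1, two_mul, hν, Measure.add_apply, e1] at e2
    exact ((ENNReal.add_le_add_iff_left (measure_ne_top _ _)).1 e2).trans
      (measure_mono Set.inter_subset_left)
  · refine (Measure.eq_of_le_of_measure_univ_eq (Measure.le_iff.2 fun s hs => ?_) (by simp)).symm
    have e1 : μ₂ (s ∩ D) = μ₂ s := by
      rw [← Set.sdiff_compl (s := s) (t := D)]; exact measure_sdiff_null h0
    have e2 := mul_le_mul_right (hlow s hs) 2
    rw [htwo, two_mul, hν, Measure.add_apply, e1] at e2
    exact ((ENNReal.add_le_add_iff_left (measure_ne_top _ _)).1 e2).trans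
      (measure_mono Set.inter_subset_left)

end Conditioning

/-! ### Uniqueness of the measure of maximal entropy. -/

section Uniqueness

variable {I : Type} [AddMonoidWithOne I] [Countable I] {p q : ℕ} {Y : Subshift (Fin q) I}

/-- Invariant pieces of a measure of maximal entropy have maximal entropy. -/
theorem le_blockEntropy_of_convex {a b : ℝ} (ha : 0 < a) (hb : 0 ≤ b) (hab : a + b = 1)
    {μ μ₁ μ₂ : Measure Y.carrier} [IsProbabilityMeasure μ] [IsProbabilityMeasure μ₁]
    [IsProbabilityMeasure μ₂] (h₁ : MeasurePreserving (shiftMap Y) μ₁ μ₁)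
    (h₂ : MeasurePreserving (shiftMap Y) μ₂ μ₂)
    (he : ∀ n : ℕ, n * topEntropy Y ≤ blockEntropy (shiftMap Y) μ (letter Y) n)
    (h : ∀ s, MeasurableSet s → μ.real s = a * μ₁.real s + b * μ₂.real s) (n : ℕ) :
    n * topEntropy Y ≤ blockEntropy (shiftMap Y) μ₁ (letter Y) n := by
  refine (lim_eq_topEntropy_iff h₁).1 ?_ n
  set c := Real.negMulLog a + Real.negMulLog b
  -- The mixing term `c` vanishes after division by `n`. Since the second piece has entropy at most
  -- `h`, the first one must have at least `h`.
  have h2 : topEntropy Y ≤ a * (subadditive_blockEntropy h₁ measurable_letter).lim +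
      b * (subadditive_blockEntropy h₂ measurable_letter).lim + 0 := by
    refine ge_of_tendsto ((((tendsto_blockEntropy h₁).const_mul a).add
      ((tendsto_blockEntropy h₂).const_mul b)).add
      (tendsto_const_nhds (x := c).div_atTop tendsto_natCast_atTop_atTop)) ?_
    filter_upwards [eventually_gt_atTop 0] with m hm
    have hm' : (0 : ℝ) < m := by exact_mod_cast hm
    have h3 := shannon_convex_le ha.le hb
      (measurable_itinerary (measurable_shiftMap (Y := Y)) measurable_letter m) h
    have h4 := (he m).trans h3
    rw [← mul_div_assoc, ← mul_div_assoc, ← add_div, ← add_div, le_div_iff₀ hm', mul_comm]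
    exact h4
  have h3 := mul_le_mul_of_nonneg_left (lim_blockEntropy_le h₂) hb
  have h4 : b * topEntropy Y = topEntropy Y - a * topEntropy Y := by
    rw [eq_sub_iff_add_eq, ← add_mul, add_comm b, hab, one_mul]
  exact le_of_mul_le_mul_left (by linarith) ha

open ProbabilityTheory in
theorem le_blockEntropy_cond {μ : Measure Y.carrier} [IsProbabilityMeasure μ]
    (hT : MeasurePreserving (shiftMap Y) μ μ)
    (he : ∀ n : ℕ, n * topEntropy Y ≤ blockEntropy (shiftMap Y) μ (letter Y) n) {D : Set Y.carrier}
    (hD : MeasurableSet D) (hDT : shiftMap Y ⁻¹' D =ᵐ[μ] D) (h0 : μ D ≠ 0) (n : ℕ) :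
    n * topEntropy Y ≤ blockEntropy (shiftMap Y) μ[|D] (letter Y) n := by
  have := cond_isProbabilityMeasure h0
  have hmul : ∀ E : Set Y.carrier, MeasurableSet E → μ E ≠ 0 → ∀ s,
      μ.real E * (μ[|E]).real s = μ.real (E ∩ s) := fun E hE hE0 s => by
    have : μ.real E ≠ 0 := (measureReal_ne_zero_iff).2 hE0
    rw [measureReal_def (μ := μ[|E]), cond_apply hE, ENNReal.toReal_mul, ENNReal.toReal_inv,
      ← measureReal_def, ← measureReal_def, mul_inv_cancel_left₀ this]
  have hsplit : ∀ s, μ.real s = μ.real (D ∩ s) + μ.real (Dᶜ ∩ s) := fun s => by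
    rw [Set.inter_comm, Set.inter_comm Dᶜ, ← Set.sdiff_eq, measureReal_inter_add_sdiff hD]
  have hab : μ.real D + μ.real Dᶜ = 1 := by
    rw [measureReal_add_measureReal_compl hD, probReal_univ]
  have hpos : 0 < μ.real D := (measureReal_nonneg).lt_of_ne' ((measureReal_ne_zero_iff).2 h0)
  have hT₁ := measurePreserving_cond hT hD hDT
  by_cases hc : μ Dᶜ = 0
  -- A null complement cannot be conditioned on; `μ` stands in as second measure with weight 0.
  · refine le_blockEntropy_of_convex (μ₂ := μ) hpos measureReal_nonneg hab hT₁ hT he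
      (fun s _ => ?_) n
    rw [hmul D hD h0, hsplit s, measureReal_def (s := Dᶜ), measureReal_def (s := Dᶜ ∩ s), hc,
      measure_mono_null Set.inter_subset_left hc]
    simp
  · have := cond_isProbabilityMeasure hc
    refine le_blockEntropy_of_convex hpos measureReal_nonneg hab hT₁
      (measurePreserving_cond hT hD.compl ?_) he (fun s _ => ?_) n
    · rw [Set.preimage_compl]; exact hDT.compl
    · rw [hmul D hD h0, hmul _ hD.compl hc, ← hsplit s]

open ProbabilityTheory in
/-- With positive entropy there is at most one measure of maximal entropy. -/
theorem HasJoinableWords.unique [ShiftIndex I] (hJ : HasJoinableWords Y)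
    (hY : Y.carrier.Nonempty) {μ₁ μ₂ : Measure Y.carrier}
    [IsProbabilityMeasure μ₁] [IsProbabilityMeasure μ₂] (h₁ : MeasurePreserving (shiftMap Y) μ₁ μ₁)
    (h₂ : MeasurePreserving (shiftMap Y) μ₂ μ₂)
    (he₁ : ∀ n : ℕ, n * topEntropy Y ≤ blockEntropy (shiftMap Y) μ₁ (letter Y) n)
    (he₂ : ∀ n : ℕ, n * topEntropy Y ≤ blockEntropy (shiftMap Y) μ₂ (letter Y) n) : μ₁ = μ₂ := by
  by_contra hne
  obtain ⟨D, hD, hD₁, hD₂, h0₁, h0₂⟩ := exists_invariant_of_ne h₁ h₂ hne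
  have hD₂' : shiftMap Y ⁻¹' Dᶜ =ᵐ[μ₂] (Dᶜ : Set Y.carrier) := by
    rw [Set.preimage_compl]; exact hD₂.compl
  have := cond_isProbabilityMeasure h0₁
  have := cond_isProbabilityMeasure h0₂
  refine hJ.not_mutuallySingular hY (μ₁ := μ₁[|D]) (μ₂ := μ₂[|Dᶜ])
    (measurePreserving_cond h₁ hD hD₁) (measurePreserving_cond h₂ hD.compl hD₂')
    (le_blockEntropy_cond h₁ he₁ hD hD₁ h0₁) (le_blockEntropy_cond h₂ he₂ hD.compl hD₂' h0₂) hD ?_ ?_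
  · rw [cond_apply hD]; simp
  · rw [cond_apply hD.compl]; simp

/-- Measures are determined by their values on words. -/
theorem ext_of_wordAt [ShiftIndex I] {μ₁ μ₂ : Measure Y.carrier}
    [IsProbabilityMeasure μ₁] [IsProbabilityMeasure μ₂] (h₁ : MeasurePreserving (shiftMap Y) μ₁ μ₁)
    (h₂ : MeasurePreserving (shiftMap Y) μ₂ μ₂)
    (h : ∀ w : List (Fin q), μ₁.real {y | wordAt y.1 0 w.length = w} =
      μ₂.real {y | wordAt y.1 0 w.length = w}) : μ₁ = μ₂ := by
  refine ext_of_isClopen fun C hC => ?_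
  obtain ⟨j, l, -, hd⟩ := exists_word_determines ((continuous_boolIndicator_iff_isClopen C).2 hC)
  set A := {w : List (Fin q) | ∃ y : Y.carrier, wordAt y.1 0 l = w ∧ (shiftMap Y)^[j] y ∈ C} with hA
  have hlen : ∀ w ∈ A, w.length = l := by
    rintro w ⟨y, rfl, -⟩
    simp
  have hAfin : A.Finite := (finite_wordsOfLength Y l).subset fun w hw => by
    obtain ⟨y, rfl, -⟩ := hw
    exact ⟨wordAt_mem_language Y y _ _, by simp⟩
  have hCA : (shiftMap Y)^[j] ⁻¹' C = ⋃ w ∈ hAfin.toFinset, {y | wordAt y.1 0 w.length = w} := by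
    ext y
    simp only [Set.mem_preimage, Set.mem_iUnion, Set.Finite.mem_toFinset, Set.mem_ofPred_eq,
      exists_prop]
    constructor
    · exact fun hy => ⟨wordAt y.1 0 l, ⟨y, rfl, hy⟩, by simp⟩
    · rintro ⟨w, ⟨y', h3, h4⟩, h5⟩
      have h6 : wordAt y.1 0 l = wordAt y'.1 0 l := by
        rw [h3, ← h5, hlen w ⟨y', h3, h4⟩]
      rw [Set.mem_iff_boolIndicator] at h4 ⊢
      rw [← h4, hd y y' h6]
  have hmeas : ∀ w : List (Fin q), MeasurableSet {y : Y.carrier | wordAt y.1 0 w.length = w} := by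
    intro w
    have : {y : Y.carrier | wordAt y.1 0 w.length = w} =
        itinerary (shiftMap Y) (letter Y) w.length ⁻¹' {a | List.ofFn a = w} := by
      ext y
      simp only [Set.mem_preimage, Set.mem_ofPred_eq, ofFn_itinerary]
    rw [this]
    exact measurable_itinerary measurable_shiftMap measurable_letter _ (Set.toFinite _).measurableSet
  have hdisj : (hAfin.toFinset : Set (List (Fin q))).PairwiseDisjoint
      fun w => {y : Y.carrier | wordAt y.1 0 w.length = w} := by
    intro w hw w' hw' hne
    rw [Finset.mem_coe, Set.Finite.mem_toFinset] at hw hw'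
    refine Set.disjoint_left.2 fun y hy hy' => hne ?_
    rw [Set.mem_ofPred_eq, hlen w hw] at hy
    rw [Set.mem_ofPred_eq, hlen w' hw'] at hy'
    rw [← hy, hy']
  rw [← (h₁.iterate j).measure_preimage hC.1.measurableSet.nullMeasurableSet,
    ← (h₂.iterate j).measure_preimage hC.1.measurableSet.nullMeasurableSet, hCA,
    measure_biUnion_finset hdisj fun w _ => hmeas w, measure_biUnion_finset hdisj fun w _ => hmeas w]
  refine Finset.sum_congr rfl fun w _ => ?_
  rw [← ENNReal.toReal_eq_toReal_iff' (measure_ne_top _ _) (measure_ne_top _ _)]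
  exact h w

/-- The average number of occurrences of a word. -/
theorem mul_measureReal_wordAt_eq {μ : Measure Y.carrier} [IsProbabilityMeasure μ]
    (hT : MeasurePreserving (shiftMap Y) μ μ) (w : List (Fin q)) {Q c : ℕ}
    (hc : ∀ y : Y.carrier, Q.count (fun i => wordAt y.1 (i : I) w.length = w) = c) :
    Q * μ.real {y | wordAt y.1 0 w.length = w} = c := by
  have hpre : ∀ i : ℕ, {y : Y.carrier | wordAt y.1 (i : I) w.length = w} =
      itinerary (shiftMap Y) (letter Y) (i + w.length) ⁻¹'
        {a | ((List.ofFn a).drop i).take w.length = w} := by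
    intro i
    ext y
    simp only [Set.mem_preimage, Set.mem_ofPred_eq, ofFn_itinerary]
    rw [window_wordAt _ _ le_rfl, zero_add]
  have hmeas : ∀ i : ℕ, MeasurableSet {y : Y.carrier | wordAt y.1 (i : I) w.length = w} := by
    intro i
    rw [hpre]
    exact measurable_itinerary measurable_shiftMap measurable_letter _ (Set.toFinite _).measurableSet
  have h1 : ∀ i : ℕ, ∫ y, Set.indicator {y : Y.carrier | wordAt y.1 (i : I) w.length = w}
      (fun _ => (1 : ℝ)) y ∂μ = μ.real {y | wordAt y.1 0 w.length = w} := fun i => by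
    rw [integral_indicator_const _ (hmeas i), smul_eq_mul, mul_one]
    exact measureReal_wordAt_eq hT i w.length {w}
  -- The count is integrated in two ways: it is constant, and by invariance each of the `Q`
  -- positions contributes the measure of the cylinder.
  have h2 : ∫ y, ∑ i ∈ Finset.range Q, Set.indicator
      {y : Y.carrier | wordAt y.1 (i : I) w.length = w} (fun _ => (1 : ℝ)) y ∂μ =
      Q * μ.real {y | wordAt y.1 0 w.length = w} := by
    rw [integral_finsetSum _ fun i _ => (integrable_const 1).indicator (hmeas i)]
    simp [h1]
  rw [← h2]
  have h3 : ∀ y : Y.carrier, ∑ i ∈ Finset.range Q, Set.indicator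
      {y : Y.carrier | wordAt y.1 (i : I) w.length = w} (fun _ => (1 : ℝ)) y = c := by
    intro y
    rw [← hc y, Nat.count_eq_card_filter_range, Finset.card_filter]
    push_cast
    exact Finset.sum_congr rfl fun i _ => by simp [Set.indicator_apply]
  simp [h3]

variable [ShiftIndex I] {X : Subshift (Fin p) I}

/-- The summation behind joinability needs `h > 0`. For `h = 0`, equal word counts in all points fix
the measure of every cylinder. -/
theorem IsFactor.intrinsicallyErgodic (h : IsFactor X Y) (hX : X.carrier.Nonempty)
    {Cp G Cs : Set (List (Fin p))} (hdec : IsDecomposition X Cp G Cs) {t : ℕ} (hG : SpecS X G t)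
    (hgr : growthRate (Cp ∪ Cs) ≤ 0) (hE : ExtensionCondition X Cp G Cs) :
    IntrinsicallyErgodic (shiftMap Y) := by
  have hY := h.nonempty hX
  obtain ⟨R, Φ, π, hb⟩ := h.exists_isBlockFactor
  obtain ⟨μ, hμ⟩ := exists_measurePreserving_le_blockEntropy hY
  refine ⟨μ, (isMME_iff hY μ).2 hμ, fun ν hν => ProbabilityMeasure.toMeasure_injective ?_⟩
  replace hν := (isMME_iff hY ν).1 hν
  rcases (topEntropy_nonneg Y).eq_or_lt' with h0 | hpos
  · obtain ⟨Q, hQ, hcount⟩ := hb.exists_count_eq hX hdec hG hE h0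
    obtain ⟨y₀⟩ := hY.to_subtype
    refine ext_of_wordAt hν.1 hμ.1 fun w => ?_
    have e1 := mul_measureReal_wordAt_eq hν.1 w fun y => hcount w y y₀
    have e2 := mul_measureReal_wordAt_eq hμ.1 w fun y => hcount w y y₀
    exact mul_left_cancel₀ (by exact_mod_cast hQ.ne') (e1.trans e2.symm)
  · exact (hb.hasJoinableWords hdec hG hgr hE hpos).unique hY hν.1 hμ.1 hν.2 hμ.2

end Uniqueness

/-! ### Counting periodic points. -/

section PeriodicPoints

theorem bijOn_perPts {Z : Type*} (T : Z → Z) (n : ℕ) : Set.BijOn T (perPts T n) (perPts T n) := by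
  refine ⟨?_, (Function.bijOn_periodicPts (f := T)).injOn.mono ?_, ?_⟩
  · rintro x ⟨k, hk, hkn, hx⟩
    exact ⟨k, hk, hkn, hx.apply_iterate 1⟩
  · rintro x ⟨k, hk, -, hx⟩
    exact ⟨k, hk, hx⟩
  · rintro x ⟨k, hk, hkn, hx⟩
    refine ⟨T^[k - 1] x, ⟨k, hk, hkn, hx.apply_iterate (k - 1)⟩, ?_⟩
    rw [← Function.iterate_succ_apply' T, Nat.succ_eq_add_one, Nat.sub_add_cancel hk]
    exact hx

theorem measurePreserving_uniformMeasure {Z : Type*} [MeasurableSpace Z] {T : Z → Z}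
    (hT : Measurable T) {P : Set Z} (hP : P.Finite) (hTP : Set.BijOn T P P) :
    MeasurePreserving T (uniformMeasure P) (uniformMeasure P) := by
  refine ⟨hT, Measure.ext fun s hs => ?_⟩
  rw [Measure.map_apply hT hs, uniformMeasure_apply hP (hT hs), uniformMeasure_apply hP hs]
  have : T '' (P ∩ T ⁻¹' s) = P ∩ s := by
    rw [Set.image_inter_preimage, hTP.image_eq]
  rw [← this, Set.InjOn.ncard_image (hTP.injOn.mono Set.inter_subset_left)]

variable {I : Type} [AddMonoidWithOne I] {p q : ℕ} {X : Subshift (Fin p) I} {Y : Subshift (Fin q) I}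

/-- A point of period `k` is determined by its first `k` letters. -/
theorem eq_of_isPeriodicPt [ShiftIndex I] {k n : ℕ} (hk : 0 < k) (hkn : k ≤ n) {x y : Y.carrier}
    (hx : Function.IsPeriodicPt (shiftMap Y) k x) (hy : Function.IsPeriodicPt (shiftMap Y) k y)
    (h : wordAt x.1 0 n = wordAt y.1 0 n) : x = y := by
  rw [wordAt_eq_iff] at h
  have hnat : ∀ z : Y.carrier, Function.IsPeriodicPt (shiftMap Y) k z → ∀ a : ℕ,
      z.1 (a : I) = z.1 ((a % k : ℕ) : I) := fun z hz a => by
    have h1 : (shiftMap Y)^[k * (a / k)] z = z := hz.mul_const _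
    conv_rhs => rw [← h1]
    rw [shiftMap_iterate_apply, ← Nat.cast_add, Nat.div_add_mod]
  have hxy : ∀ a : ℕ, x.1 (a : I) = y.1 (a : I) := fun a => by
    rw [hnat x hx, hnat y hy]
    simpa using h (a % k) ((Nat.mod_lt _ hk).trans_le hkn)
  refine Subtype.ext (funext fun i => ?_)
  obtain ⟨j, -, hj⟩ := ShiftIndex.exists_translate ({i} : Finset I)
  obtain ⟨m, hm, -⟩ := hj i (Finset.mem_singleton_self i)
  -- Adding the multiple `k * j` of the period moves a possibly negative coordinate `i` into `ℕ`,
  -- since `j + i = m`.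
  have hgen : ∀ z : Y.carrier, Function.IsPeriodicPt (shiftMap Y) k z →
      z.1 i = z.1 (((k - 1) * j + m : ℕ) : I) := fun z hz => by
    have h1 : (shiftMap Y)^[k * j] z = z := hz.mul_const _
    conv_lhs => rw [← h1]
    rw [shiftMap_iterate_apply, Nat.cast_add, ← hm, ← add_assoc, ← Nat.cast_add]
    obtain ⟨k, rfl⟩ := Nat.exists_eq_succ_of_ne_zero hk.ne'
    rw [Nat.succ_mul, Nat.succ_sub_one]
  rw [hgen x hx, hgen y hy, hxy]

theorem finite_perPts [ShiftIndex I] (Y : Subshift (Fin q) I) (n : ℕ) :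
    (perPts (shiftMap Y) n).Finite := by
  have h : ∀ x : perPts (shiftMap Y) n, ∃ k : ℕ, 1 ≤ k ∧ k ≤ n ∧
    Function.IsPeriodicPt (shiftMap Y) k x.1 := fun x => x.2
  choose k hk hkn hper using h
  refine Finite.of_injective (fun x : perPts (shiftMap Y) n =>
    ((⟨k x, Nat.lt_succ_of_le (hkn x)⟩ : Fin (n + 1)),
      itinerary (shiftMap Y) (letter Y) n x.1)) fun x y hxy => ?_
  simp only [Prod.mk.injEq, Fin.mk.injEq] at hxy
  obtain ⟨h1, h2⟩ := hxy
  rw [itinerary_letter_eq_iff] at h2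
  exact Subtype.ext (eq_of_isPeriodicPt (hk x) (hkn x) (hper x) (h1 ▸ hper y) h2)

/-- The first `n` letters and a period determine the point. The at most `n` periods cost only `log
n` in entropy. -/
theorem ncard_perPts_inter_le [ShiftIndex I] (Y : Subshift (Fin q) I) (n : ℕ) (a : Fin n → Fin q) :
    (perPts (shiftMap Y) n ∩ itinerary (shiftMap Y) (letter Y) n ⁻¹' {a}).ncard ≤ n := by
  have h : ∀ x ∈ perPts (shiftMap Y) n ∩ itinerary (shiftMap Y) (letter Y) n ⁻¹' {a}, ∃ k : ℕ,
    1 ≤ k ∧ k ≤ n ∧ Function.IsPeriodicPt (shiftMap Y) k x := fun x hx => hx.1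
  choose! k hk hkn hper using h
  refine (Set.ncard_le_ncard_of_injOn k (t := (Finset.Icc 1 n : Set ℕ)) (fun x hx => ?_)
    (fun x hx y hy hxy => ?_) (Finset.finite_toSet _)).trans (by simp)
  · simpa using ⟨hk x hx, hkn x hx⟩
  · have h2 := hx.2.trans hy.2.symm
    rw [itinerary_letter_eq_iff] at h2
    exact eq_of_isPeriodicPt (hk x hx) (hkn x hx) (hper x hx) (hxy ▸ hper y hy) h2

theorem SpecPer.exists_isPeriodicPt {G : Set (List (Fin p))} {t : ℕ} (h : SpecPer X G t)
    {w : List (Fin p)} (hw : w ∈ G) : ∃ ξ : X.carrier, wordAt ξ.1 0 w.length = w ∧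
      Function.IsPeriodicPt (shiftMap X) (w.length + t) ξ := by
  obtain ⟨v, -, -, ξ, h1, h2⟩ := h 0 (fun _ => w) fun _ _ => hw
  exact ⟨ξ, h1, h2⟩

variable {R : ℕ} {Φ : List (Fin p) → List (Fin q)} {π : X.carrier → Y.carrier}

theorem IsBlockFactor.nonempty_perPts (hb : IsBlockFactor X Y R Φ π) (hX : X.carrier.Nonempty)
    {Cp G Cs : Set (List (Fin p))} (hdec : IsDecomposition X Cp G Cs)
    (hE : ExtensionCondition X Cp G Cs) {t : ℕ} (hP : SpecPer X G t) :
    ∀ᶠ n in atTop, (perPts (shiftMap Y) n).Nonempty := by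
  obtain ⟨x, hx⟩ := hX
  obtain ⟨u, w, huw⟩ := exists_extension_mem hdec hE (wordAt_mem_language X ⟨x, hx⟩ 0 1)
  obtain ⟨ξ, -, hξ⟩ := hP.exists_isPeriodicPt huw
  filter_upwards [eventually_ge_atTop ((u ++ wordAt x 0 1 ++ w).length + t)] with n hn
  refine ⟨π ξ, _, ?_, hn, hξ.map hb.semiconj⟩
  simp only [List.length_append, length_wordAt]
  omega

/-- Every good word appears near the origin of a periodic point. -/
theorem IsBlockFactor.exists_ncard_le_perPts [ShiftIndex I] (hb : IsBlockFactor X Y R Φ π)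
    {Cp G Cs : Set (List (Fin p))} (hE : ExtensionCondition X Cp G Cs) {t : ℕ}
    (hP : SpecPer X G t) (M : ℕ) : ∃ c τ : ℕ, ∀ n > 0,
      (wordsOfLength Y n ∩ Φ '' goodWords X Cp G Cs M).ncard ≤
        (perPts (shiftMap Y) (n + c)).ncard * (τ + 1) := by
  obtain ⟨τ, hτ⟩ := hE M
  -- A preimage has length `n + R`, its extension to `G` at most `2 * τ` more, and the period
  -- another `t`. The word is read at an offset of at most `τ`. Positivity of `n` turns the
  -- truncated `|x| - R = n` into `|x| = n + R`.
  refine ⟨R + 2 * τ + t, τ, fun n hn => ?_⟩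
  have hfin := finite_perPts Y (n + (R + 2 * τ + t))
  set S := (fun z : Y.carrier × ℕ => wordAt z.1.1 (z.2 : I) n) ''
    (perPts (shiftMap Y) (n + (R + 2 * τ + t)) ×ˢ (Finset.range (τ + 1) : Set ℕ)) with hS
  have hSfin : S.Finite := (hfin.prod (Finset.finite_toSet _)).image _
  have hsub : wordsOfLength Y n ∩ Φ '' goodWords X Cp G Cs M ⊆ S := by
    rintro _ ⟨⟨-, hs⟩, x, hx, rfl⟩
    obtain ⟨u, w, hu, hw, huw⟩ := hτ x hx
    obtain ⟨ξ, h1, h2⟩ := hP.exists_isPeriodicPt huw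
    have hlen := hb.length_map hx.1
    refine ⟨(π ξ, u.length), ⟨⟨_, ?_, ?_, h2.map hb.semiconj⟩, ?_⟩, ?_⟩
    · simp only [List.length_append]; omega
    · simp only [List.length_append]; omega
    · simp; omega
    · have h3 := (wordAt_append (wordAt_append h1).1).2
      rw [zero_add] at h3
      have h4 := hb.wordAt_eq ξ u.length x.length
      rw [h3, ← hlen, hs] at h4
      exact h4
  calc (wordsOfLength Y n ∩ Φ '' goodWords X Cp G Cs M).ncard ≤ S.ncard :=
        Set.ncard_le_ncard hsub hSfin
    _ ≤ (perPts (shiftMap Y) (n + (R + 2 * τ + t)) ×ˢ (Finset.range (τ + 1) : Set ℕ)).ncard :=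
        Set.ncard_image_le (hfin.prod (Finset.finite_toSet _))
    _ = _ := by rw [Set.ncard_prod, Set.ncard_coe_finset, Finset.card_range]

/-- The number of periodic points grows at the rate of the topological entropy. -/
theorem IsBlockFactor.exists_le_log_ncard_perPts [ShiftIndex I] (hb : IsBlockFactor X Y R Φ π)
    (hX : Y.carrier.Nonempty)
    {Cp G Cs : Set (List (Fin p))} (hdec : IsDecomposition X Cp G Cs) {s t : ℕ}
    (hG : SpecS X G s) (hgr : growthRate (Cp ∪ Cs) ≤ 0) (hE : ExtensionCondition X Cp G Cs)
    (hP : SpecPer X G t) :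
    ∃ c : ℝ, ∀ᶠ n : ℕ in atTop, n * topEntropy Y - c ≤ Real.log (perPts (shiftMap Y) n).ncard := by
  rcases (topEntropy_nonneg Y).eq_or_lt' with h0 | hpos
  · exact ⟨0, Eventually.of_forall fun n => by simpa [h0] using Real.log_natCast_nonneg _⟩
  obtain ⟨M, hM⟩ := hb.exists_ncard_bad_le hdec hG hgr hpos (δ := 1 / 2) (by norm_num)
  obtain ⟨c, τ, hc⟩ := hb.exists_ncard_le_perPts hE hP M
  -- The first term pays for words shorter than the period bound by `c`, the 2 for the bad words,
  -- and `τ + 1` for the offset.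
  refine ⟨c * topEntropy Y + Real.log (2 * (τ + 1)), ?_⟩
  filter_upwards [eventually_gt_atTop c] with m hm
  obtain ⟨n, rfl⟩ := Nat.exists_eq_add_of_le' hm.le
  have h1 := ncard_le_of_bad_le subset_rfl (hM n)
  have h2 := exp_le_wordCount hX n
  have h3 : (((wordsOfLength Y n ∩ Φ '' goodWords X Cp G Cs M).ncard : ℕ) : ℝ) ≤
      (perPts (shiftMap Y) (n + c)).ncard * ((τ : ℝ) + 1) := by
    exact_mod_cast hc n (by omega)
  change (wordCount Y n : ℝ) - _ ≤ _ at h1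
  have h4 : Real.exp (n * topEntropy Y) ≤
      2 * ((τ : ℝ) + 1) * (perPts (shiftMap Y) (n + c)).ncard := by linarith
  have h5 : (perPts (shiftMap Y) (n + c)).ncard ≠ 0 := fun h => by
    rw [h] at h4
    have := Real.exp_pos (n * topEntropy Y)
    simp at h4
    linarith
  have h6 := Real.log_le_log (Real.exp_pos _) h4
  rw [Real.log_exp, Real.log_mul (by positivity) (by exact_mod_cast h5)] at h6
  push_cast
  linarith

end PeriodicPoints

/-! ### Convergence of the periodic orbit measures. -/

section Convergence

variable {I : Type} [AddMonoidWithOne I] [Countable I] [ShiftIndex I] {p q : ℕ}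
  {X : Subshift (Fin p) I} {Y : Subshift (Fin q) I}

/-- The uniform measure on `Per(m)` is invariant and its `m`-block entropy is at least `m h - c -
log m`. Comparing blocks of length `m` and `n` loses a term that vanishes after division by `m`. -/
theorem eventually_le_blockEntropy_perPts {c : ℝ}
    (hne : ∀ᶠ n in atTop, (perPts (shiftMap Y) n).Nonempty)
    (hc : ∀ᶠ n : ℕ in atTop, n * topEntropy Y - c ≤ Real.log (perPts (shiftMap Y) n).ncard)
    {n : ℕ} (hn : 0 < n) {ε : ℝ} (hε : 0 < ε) : ∀ᶠ m in atTop, n * topEntropy Y - ε ≤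
      blockEntropy (shiftMap Y) (uniformMeasure (perPts (shiftMap Y) m)) (letter Y) n := by
  set b := 2 * (n : ℝ) * (n * Real.log (Fintype.card (Fin q)))
  have hz : Tendsto (fun m : ℕ => ((n : ℝ) * c + b) / (m : ℝ) + (n : ℝ) * (Real.log m ^ 1 / (1 * m + 0)))
      atTop (𝓝 (0 + (n : ℝ) * 0)) :=
    (tendsto_const_nhds.div_atTop tendsto_natCast_atTop_atTop).add
      (((Real.tendsto_pow_log_div_mul_add_atTop 1 0 1 one_ne_zero).comp
        tendsto_natCast_atTop_atTop).const_mul _)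
  rw [mul_zero, add_zero] at hz
  filter_upwards [hne, hc, eventually_gt_atTop 0, hz.eventually_lt_const hε] with m h1 h2 hm h3
  have hfin := finite_perPts Y m
  have := isProbabilityMeasure_uniformMeasure hfin h1
  have hT := measurePreserving_uniformMeasure (measurable_shiftMap (Y := Y)) hfin
    (bijOn_perPts (shiftMap Y) m)
  have h4 : Real.log (perPts (shiftMap Y) m).ncard - Real.log m ≤
      blockEntropy (shiftMap Y) (uniformMeasure (perPts (shiftMap Y) m)) (letter Y) m :=
    le_shannon_uniformMeasure hfin h1
      (measurable_itinerary measurable_shiftMap measurable_letter m) hm (ncard_perPts_inter_le Y m)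
  have h5 := mul_blockEntropy_le_sum (μ := uniformMeasure (perPts (shiftMap Y) m))
    (measurable_shiftMap (Y := Y)) measurable_letter hn m
  simp only [shannon_comp_iterate hT
    (measurable_itinerary (measurable_shiftMap (Y := Y)) measurable_letter n)] at h5
  rw [Finset.sum_const, Finset.card_range, nsmul_eq_mul] at h5
  change _ ≤ m * blockEntropy (shiftMap Y) (uniformMeasure (perPts (shiftMap Y) m)) (letter Y) n +
    b at h5
  have hm' : (0 : ℝ) < m := by exact_mod_cast hm
  have hn' : (0 : ℝ) < n := by exact_mod_cast hn
  have h6 := mul_le_mul_of_nonneg_left (show m * topEntropy Y - c - Real.log m ≤ _ by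
    linarith) hn'.le |>.trans h5
  rw [pow_one, one_mul, add_zero, ← mul_div_assoc, ← add_div, div_lt_iff₀ hm'] at h3
  refine le_of_mul_le_mul_left ?_ hm'
  linarith

/-- By compactness every ultrafilter at infinity has a limit measure; it is invariant with maximal
entropy, so uniqueness makes it `μ`. -/
theorem IsFactor.perMeasuresTendsto (h : IsFactor X Y) (hX : X.carrier.Nonempty)
    {Cp G Cs : Set (List (Fin p))} (hdec : IsDecomposition X Cp G Cs) {s t : ℕ} (hG : SpecS X G s)
    (hgr : growthRate (Cp ∪ Cs) ≤ 0) (hE : ExtensionCondition X Cp G Cs) (hP : SpecPer X G t)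
    {μ : ProbabilityMeasure Y.carrier} (hμ : IsMME (shiftMap Y) μ) :
    PerMeasuresTendsto (shiftMap Y) μ := by
  classical
  have hY := h.nonempty hX
  obtain ⟨R, Φ, π, hb⟩ := h.exists_isBlockFactor
  have hne := hb.nonempty_perPts hX hdec hE hP
  obtain ⟨c, hc⟩ := hb.exists_le_log_ncard_perPts hY hdec hG hgr hE hP
  have hfin := finite_perPts Y
  -- `μ` is a filler for those `n` without periodic points; `perMeasure` unfolds to the
  -- `uniformMeasure` of `perPts`.
  let ν : ℕ → ProbabilityMeasure Y.carrier := fun n =>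
    if hn : (perPts (shiftMap Y) n).Nonempty then
      ⟨perMeasure (shiftMap Y) n, isProbabilityMeasure_uniformMeasure (hfin n) hn⟩ else μ
  have hν : ∀ᶠ n in atTop, (ν n : Measure Y.carrier) = uniformMeasure (perPts (shiftMap Y) n) := by
    filter_upwards [hne] with n hn
    have : ν n = ⟨perMeasure (shiftMap Y) n, isProbabilityMeasure_uniformMeasure (hfin n) hn⟩ :=
      dif_pos hn
    rw [this]
    rfl
  refine ⟨hne.mono fun n hn => ⟨hfin n, hn⟩, ν, hν, ?_⟩
  rw [tendsto_iff_ultrafilter]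
  intro U hU
  obtain ⟨μ', -, hμ'⟩ := (isCompact_univ (X := ProbabilityMeasure Y.carrier)).ultrafilter_le_nhds
    (U.map ν) (by simp)
  have hmme : IsMME (shiftMap Y) μ' := by
    rw [isMME_iff hY]
    refine measurePreserving_and_le_of_tendsto (F := (U : Filter ℕ)) (ν := ν) hμ' ?_ ?_
    · refine fun s hs => Tendsto.mono_left (tendsto_const_nhds.congr' ?_) hU
      filter_upwards [hν] with n hn
      rw [hn, (measurePreserving_uniformMeasure measurable_shiftMap (hfin n)
        (bijOn_perPts (shiftMap Y) n)).measureReal_preimage hs.nullMeasurableSet, sub_self]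
    · intro n hn ε hε
      refine hU ?_
      filter_upwards [hν, eventually_le_blockEntropy_perPts hne hc hn hε] with m h1 h2
      rwa [h1]
  rw [(h.intrinsicallyErgodic hX hdec hG hgr hE).unique hμ hmme]
  exact hμ'

end Convergence

end IntrinsicErgodicity

open IntrinsicErgodicity in
theorem theoremD :
    (∀ (p : ℕ) (X : Subshift (Fin p) ℕ) (Cp G Cs : Set (List (Fin p))),
      X.carrier.Nonempty →
      IsDecomposition X Cp G Cs →
      (∃ t, SpecS X G t) →
      growthRate (Cp ∪ Cs) ≤ 0 →
      ExtensionCondition X Cp G Cs →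
      ∀ (q : ℕ) (Y : Subshift (Fin q) ℕ), IsFactor X Y →
        IntrinsicallyErgodic (shiftMap Y) ∧
        ((∃ t, SpecPer X G t) →
          ∀ μ : ProbabilityMeasure Y.carrier, IsMME (shiftMap Y) μ →
            PerMeasuresTendsto (shiftMap Y) μ)) ∧
    (∀ (p : ℕ) (X : Subshift (Fin p) ℤ) (Cp G Cs : Set (List (Fin p))),
      X.carrier.Nonempty →
      IsDecomposition X Cp G Cs →
      (∃ t, SpecS X G t) →
      growthRate (Cp ∪ Cs) ≤ 0 →
      ExtensionCondition X Cp G Cs →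
      ∀ (q : ℕ) (Y : Subshift (Fin q) ℤ), IsFactor X Y →
        IntrinsicallyErgodic (shiftMap Y) ∧
        ((∃ t, SpecPer X G t) →
          ∀ μ : ProbabilityMeasure Y.carrier, IsMME (shiftMap Y) μ →
            PerMeasuresTendsto (shiftMap Y) μ)) := by
  exact ⟨fun _ _ _ _ _ hX hdec ⟨_, hG⟩ hgr hE _ _ h =>
      ⟨h.intrinsicallyErgodic hX hdec hG hgr hE,
        fun ⟨_, hP⟩ _ hμ => h.perMeasuresTendsto hX hdec hG hgr hE hP hμ⟩,
    fun _ _ _ _ _ hX hdec ⟨_, hG⟩ hgr hE _ _ h =>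
      ⟨h.intrinsicallyErgodic hX hdec hG hgr hE,
        fun ⟨_, hP⟩ _ hμ => h.perMeasuresTendsto hX hdec hG hgr hE hP hμ⟩⟩
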